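/- Let $\mathcal M$ be a compact foliated space of leaf dimension $p$: a compact metrizable space with an atlas of foliated charts onto products $B_1\times B_2$, with $B_1\subset\mathbb R^p$ open and connected and $B_2$ open in a fixed locally compact, separable, metrizable space $\mathcal Z$, whose transition maps are leafwise smooth, i.e. for every $k$ locally of the form $(y,z)\mapsto(f_1(y,z),f_2(z))$ with $f_2$ continuous and $f_1$ of class $C_L^k$ ($f_1(\cdot,z)$ is $C^k$ and all its $y$-derivatives of order $\le k$ are jointly continuous in $(y,z)$). The leaf through a point consists of all points joined to it by a finite chain of successively intersecting plaques. Let $V_0,\dots,V_d$ be leafwise $C^3$ vector fields on $\mathcal M$ (tangent to the leaves, with components of class $C_L^3$ in the foliated charts), let $T>0$ and $\alpha\in(1/3,1/2)$, and let $\mu$ be the $d$-dimensional Wiener measure on $C_0([0,T],\mathbb R^d)$. Let $G\Omega_\alpha$ be the space of $\alpha$-Hölder geometric rough paths $\mathbf w=(\mathbf w^1,\mathbf w^2)$ on $[0,T]$ over $\mathbb R^d$: the closure of the set of natural lifts $\mathbf L(w)_{s,t}=(w_t-w_s,\int_s^t(w_u-w_s)\otimes dw_u)$ of Lipschitz paths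 $w$ with $w_0=0$, in the set of all $\alpha$-Hölder rough paths with the distance $$d_\alpha(\mathbf w,\mathbf v)=\max_{i=1,2}\ \sup_{0\le s<t\le T}\frac{|\mathbf w^i_{s,t}-\mathbf v^i_{s,t}|}{(t-s)^{i\alpha}}.$$ For $m\in\mathcal M$ and $\mathbf w\in G\Omega_\alpha$, a continuous path $x:[0,T]\to\mathcal M$ solves the rough differential equation $dx_t=\sum_{i=1}^dV_i(x_t)\,dw^i_t+V_0(x_t)\,dt$, $x_0=m$, if $x_0=m$ and for every function $f:\mathcal M\to\mathbb R$ of class $C_L^3$ there is a constant $C$ such that for all $0\le s\le t\le T$ $$\Bigl|f(x_t)-f(x_s)-\sum_{i=1}^dV_if(x_s)\mathbf w^{1,i}_{s,t}-\sum_{j,k=1}^dV_jV_kf(x_s)\mathbf w^{2,jk}_{s,t}-V_0f(x_s)(t-s)\Bigr|\le C|t-s|^{3\alpha}.$$ This equation has exactly one solution for every $m$ and $\mathbf w$, denoted $\Phi(m,\mathbf w)$, and it stays in a single leaf. For $w\in C_0([0,T],\mathbb R^d)$ let $\mathbf W(n)(w)=\mathbf L(w(n))$, where $w(n)$ is the piecewise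 linear approximation of $w$ along the dyadic partition $\{jT/2^n\}_{0\le j\le2^n}$, and let $\mathcal N$ be the set of all $w$ for which $(\mathbf W(n)(w))_n$ is not Cauchy in $G\Omega_\alpha$. Then $\mu(\mathcal N)=0$ and, for $w\notin\mathcal N$, the limit $\mathbf W(w)=\lim_n\mathbf W(n)(w)$ exists in $G\Omega_\alpha$ (Brownian rough path); for $w\in\mathcal N$ let $\mathbf W(w)\in G\Omega_\alpha$ be arbitrary. Let $C_L([0,T],\mathcal M)$ be the space of continuous maps $[0,T]\to\mathcal M$ whose image lies in a single leaf, with the topology of uniform convergence. Then, however $\mathbf W$ is chosen on $\mathcal N$, the map $$\mathcal M\times C_0([0,T],\mathbb R^d)\ni(m,w)\longmapsto\Phi(m,\mathbf W(w))\in C_L([0,T],\mathcal M)$$ is measurable with respect to $\mathcal B(\mathcal M)\otimes\overline{\mathcal B(C_0([0,T],\mathbb R^d))}^{\mu}$ and $\mathcal B(C_L([0,T],\mathcal M))$, where $\mathcal B$ denotes Borel $\sigma$-fields and $\overline{\,\cdot\,}^{\mu}$ the $\mu$-completion. -/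

import Mathlib

open Filter Topology MeasureTheory ProbabilityTheory
open scoped NNReal

/-! ### Leafwise regularity on open subsets of `ℝᵖ × Z` -/

/-- `f` is of class `C_L^k` on the open set `U ⊆ ℝᵖ × Z`: every slice `f(·, z)` is `C^k`, and all
its derivatives of order at most `k` are jointly continuous in `(y, z)`. -/
def IsCL {p : ℕ} {Z F : Type*} [TopologicalSpace Z] [NormedAddCommGroup F] [NormedSpace ℝ F]
    (k : ℕ) (f : EuclideanSpace ℝ (Fin p) × Z → F) (U : Set (EuclideanSpace ℝ (Fin p) × Z)) :
    Prop :=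
  (∀ z : Z, ContDiffOn ℝ k (fun y => f (y, z)) {y | (y, z) ∈ U}) ∧
  ∀ j ≤ k, ContinuousOn (fun q : EuclideanSpace ℝ (Fin p) × Z =>
    iteratedFDeriv ℝ j (fun y => f (y, q.2)) q.1) U

/-- A map between open sets of `ℝᵖ × Z` is of class `C_L^k` if it is locally of the form
`(y, z) ↦ (f₁ (y, z), f₂ z)` with `f₁` of class `C_L^k` and `f₂` continuous. -/
def IsCLMap {p : ℕ} {Z : Type*} [TopologicalSpace Z] (k : ℕ)
    (f : EuclideanSpace ℝ (Fin p) × Z → EuclideanSpace ℝ (Fin p) × Z)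
    (U : Set (EuclideanSpace ℝ (Fin p) × Z)) : Prop :=
  ∀ q ∈ U, ∃ U' ⊆ U, IsOpen U' ∧ q ∈ U' ∧ IsCL k (fun r => (f r).1) U' ∧
    ∃ f₂ : Z → Z, ContinuousOn f₂ (Prod.snd '' U') ∧ ∀ r ∈ U', (f r).2 = f₂ r.2

/-! ### Foliated spaces, leaves, leafwise functions and vector fields -/

/-- A foliated atlas on `M`, of leaf dimension `p`, modelled transversely on `Z`. -/
structure FoliatedAtlas (p : ℕ) (M Z : Type*) [TopologicalSpace M] [TopologicalSpace Z] where
  charts : Set (OpenPartialHomeomorph M (EuclideanSpace ℝ (Fin p) × Z))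
  cover : ∀ x : M, ∃ φ ∈ charts, x ∈ φ.source
  target_eq_prod : ∀ φ ∈ charts, ∃ (B₁ : Set (EuclideanSpace ℝ (Fin p))) (B₂ : Set Z),
    IsOpen B₁ ∧ IsConnected B₁ ∧ IsOpen B₂ ∧ φ.target = B₁ ×ˢ B₂
  compatible : ∀ φ ∈ charts, ∀ ψ ∈ charts, ∀ k : ℕ,
    IsCLMap k (fun q => ψ (φ.symm q)) (φ.target ∩ φ.symm ⁻¹' ψ.source)

namespace FoliatedAtlas

variable {p : ℕ} {M Z : Type*} [TopologicalSpace M] [TopologicalSpace Z]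

/-- The plaques `φ⁻¹(B₁ × {z})` of the foliated charts. -/
def plaques (A : FoliatedAtlas p M Z) : Set (Set M) :=
  {P | ∃ φ ∈ A.charts, ∃ z : Z, P = {x | x ∈ φ.source ∧ (φ x).2 = z}}

/-- The leaf through `m`: all points that are joined to `m` by a finite chain of plaques in which
consecutive plaques meet. -/
def leaf (A : FoliatedAtlas p M Z) (m : M) : Set M :=
  {x | Relation.TransGen (fun a b => ∃ P ∈ A.plaques, a ∈ P ∧ b ∈ P) m x}

/-- Leafwise `C^k` functions on `M`. -/
def IsLeafwiseFunction (A : FoliatedAtlas p M Z) (k : ℕ) (f : M → ℝ) : Prop :=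
  ∀ φ ∈ A.charts, IsCL k (fun q => f (φ.symm q)) φ.target

/-- A chosen foliated chart around `x`. -/
noncomputable def chartAt (A : FoliatedAtlas p M Z) (x : M) :
    OpenPartialHomeomorph M (EuclideanSpace ℝ (Fin p) × Z) :=
  (A.cover x).choose

/-- A leafwise `C^k` vector field, given by its components `comp φ x ∈ ℝᵖ` with respect to the
basis `∂/∂y¹, …, ∂/∂yᵖ` of the tangent space at `x` of the leaf through `x` that is induced by a
foliated chart `φ = (y, z)` around `x`.  Components in two charts are related by the
leafwise derivative of the transition map.  (Values of `comp φ` off `φ.source` are irrelevant.) -/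
structure LeafwiseVectorField (A : FoliatedAtlas p M Z) (k : ℕ) where
  comp : OpenPartialHomeomorph M (EuclideanSpace ℝ (Fin p) × Z) → M → EuclideanSpace ℝ (Fin p)
  comp_eq : ∀ φ ∈ A.charts, ∀ ψ ∈ A.charts, ∀ x ∈ φ.source ∩ ψ.source,
    comp ψ x = fderiv ℝ (fun y => (ψ (φ.symm (y, (φ x).2))).1) (φ x).1 (comp φ x)
  isCL : ∀ φ ∈ A.charts, IsCL k (fun q => comp φ (φ.symm q)) φ.target

/-- The derivative `V f` of a function `f` along a leafwise vector field `V`, computed in a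
chart around each point: `(V f)(x) = ∑ᵢ Ṽⁱ(x) ∂f/∂yⁱ(x)`. -/
noncomputable def LeafwiseVectorField.apply {A : FoliatedAtlas p M Z} {k : ℕ}
    (V : A.LeafwiseVectorField k) (f : M → ℝ) (x : M) : ℝ :=
  fderiv ℝ (fun y => f ((A.chartAt x).symm (y, (A.chartAt x x).2))) (A.chartAt x x).1
    (V.comp (A.chartAt x) x)

end FoliatedAtlas

/-! ### Path spaces -/

/-- The time interval `[0, T]`. -/
abbrev TimeInterval (T : ℝ≥0) : Type := Set.Icc (0 : ℝ) (T : ℝ)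

/-- The time `0` in `[0, T]`. -/
def startTime (T : ℝ≥0) : TimeInterval T := ⟨0, le_refl _, T.coe_nonneg⟩

/-- The simplex `{(s, t) : 0 ≤ s ≤ t ≤ T}`. -/
abbrev Simplex (T : ℝ≥0) : Type := {q : TimeInterval T × TimeInterval T // q.1 ≤ q.2}

/-- `C₀([0, T], ℝᵈ)`, the continuous paths in `ℝᵈ` that start at the origin, with the topology of
uniform convergence and its Borel `σ`-field. -/
structure PathSpace (T : ℝ≥0) (d : ℕ) where
  path : C(TimeInterval T, EuclideanSpace ℝ (Fin d))
  path_start : path (startTime T) = 0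

namespace PathSpace

variable {T : ℝ≥0} {d : ℕ}

instance : TopologicalSpace (PathSpace T d) := TopologicalSpace.induced PathSpace.path inferInstance

instance : MeasurableSpace (PathSpace T d) := borel _

instance : BorelSpace (PathSpace T d) := ⟨rfl⟩

instance : CoeFun (PathSpace T d) (fun _ => TimeInterval T → EuclideanSpace ℝ (Fin d)) :=
  ⟨fun w => w.path⟩

/-- The path extended to all of `ℝ` by its constant values at the endpoints. -/
noncomputable def extend (w : PathSpace T d) (u : ℝ) : EuclideanSpace ℝ (Fin d) :=
  w (Set.projIcc (0 : ℝ) T T.coe_nonneg u)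

end PathSpace

/-- `μ` is the `d`-dimensional Wiener measure: under `μ` the coordinate process, which starts at
`0` and is continuous, has independent increments, and `w_t - w_s` is centred Gaussian with
covariance matrix `(t - s) I`. -/
structure IsWienerMeasure {T : ℝ≥0} {d : ℕ} (μ : Measure (PathSpace T d)) : Prop where
  isProbabilityMeasure : IsProbabilityMeasure μ
  hasIndepIncrements : HasIndepIncrements (fun (t : TimeInterval T) (w : PathSpace T d) => w t) μ
  hasLaw : ∀ s t : TimeInterval T, s ≤ t →
    HasLaw (fun w : PathSpace T d => w t - w s)
      (multivariateGaussian 0 (((t : ℝ) - (s : ℝ)) • (1 : Matrix (Fin d) (Fin d) ℝ))) μ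

/-- `C_L([0, T], M)`, the continuous paths whose image lies in a single leaf, with the topology of
uniform convergence (the compact-open topology) and its Borel `σ`-field. -/
structure LeafPath {p : ℕ} {M Z : Type*} [TopologicalSpace M] [TopologicalSpace Z]
    (A : FoliatedAtlas p M Z) (T : ℝ≥0) where
  path : C(TimeInterval T, M)
  path_mem : ∃ m : M, ∀ t, path t ∈ A.leaf m

namespace LeafPath

variable {p : ℕ} {M Z : Type*} [TopologicalSpace M] [TopologicalSpace Z]
  {A : FoliatedAtlas p M Z} {T : ℝ≥0}

instance : TopologicalSpace (LeafPath A T) := TopologicalSpace.induced LeafPath.path inferInstance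

instance : MeasurableSpace (LeafPath A T) := borel _

instance : BorelSpace (LeafPath A T) := ⟨rfl⟩

end LeafPath

/-! ### Rough paths -/

/-- The admissible Hölder exponents `α ∈ (1/3, 1/2)`. -/
abbrev HolderExponent : Type := Set.Ioo (1 / 3 : ℝ) (1 / 2 : ℝ)

/-- An `α`-Hölder rough path `𝐰 = (1, 𝐰¹, 𝐰²)` on `[0, T]` over `ℝᵈ`; `ℝᵈ ⊗ ℝᵈ` is identified with
`ℝ^(d × d)`. -/
structure RoughPath (α : HolderExponent) (T : ℝ≥0) (d : ℕ) where
  fst : C(Simplex T, EuclideanSpace ℝ (Fin d))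
  snd : C(Simplex T, EuclideanSpace ℝ (Fin d × Fin d))
  chen_fst : ∀ (s u t : TimeInterval T) (hsu : s ≤ u) (hut : u ≤ t),
    fst ⟨(s, t), hsu.trans hut⟩ = fst ⟨(s, u), hsu⟩ + fst ⟨(u, t), hut⟩
  chen_snd : ∀ (s u t : TimeInterval T) (hsu : s ≤ u) (hut : u ≤ t) (i j : Fin d),
    snd ⟨(s, t), hsu.trans hut⟩ (i, j) = snd ⟨(s, u), hsu⟩ (i, j) + snd ⟨(u, t), hut⟩ (i, j)
      + fst ⟨(s, u), hsu⟩ i * fst ⟨(u, t), hut⟩ j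
  holder_fst : ∃ C : ℝ, ∀ q : Simplex T,
    ‖fst q‖ ≤ C * ((q.1.2 : ℝ) - (q.1.1 : ℝ)) ^ (α : ℝ)
  holder_snd : ∃ C : ℝ, ∀ q : Simplex T,
    ‖snd q‖ ≤ C * ((q.1.2 : ℝ) - (q.1.1 : ℝ)) ^ (2 * (α : ℝ))

/-- `sup_{s < t} |f_{s,t} - g_{s,t}| / (t - s)^β`. -/
noncomputable def holderDist {T : ℝ≥0} {F : Type*} [NormedAddCommGroup F] (β : ℝ)
    (f g : C(Simplex T, F)) : ℝ :=
  ⨆ q : {q : Simplex T // q.1.1 < q.1.2},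
    ‖f q.1 - g q.1‖ / ((q.1.1.2 : ℝ) - (q.1.1.1 : ℝ)) ^ β

section holderDist

variable {T : ℝ≥0} {F : Type*} [NormedAddCommGroup F] {β : ℝ}

theorem holderDist_bddAbove {f g : C(Simplex T, F)}
    (hf : ∃ C : ℝ, ∀ q : Simplex T, ‖f q‖ ≤ C * ((q.1.2 : ℝ) - (q.1.1 : ℝ)) ^ β)
    (hg : ∃ C : ℝ, ∀ q : Simplex T, ‖g q‖ ≤ C * ((q.1.2 : ℝ) - (q.1.1 : ℝ)) ^ β) :
    BddAbove (Set.range fun q : {q : Simplex T // q.1.1 < q.1.2} =>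
      ‖f q.1 - g q.1‖ / ((q.1.1.2 : ℝ) - (q.1.1.1 : ℝ)) ^ β) := by
  obtain ⟨C, hC⟩ := hf
  obtain ⟨D, hD⟩ := hg
  refine ⟨C + D, ?_⟩
  rintro _ ⟨q, rfl⟩
  have hq : (0 : ℝ) < (q.1.1.2 : ℝ) - (q.1.1.1 : ℝ) := sub_pos.2 q.2
  rw [div_le_iff₀ (Real.rpow_pos_of_pos hq β), add_mul]
  exact (norm_sub_le _ _).trans (add_le_add (hC _) (hD _))

theorem holderDist_nonneg (f g : C(Simplex T, F)) : 0 ≤ holderDist β f g := by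
  refine Real.iSup_nonneg fun q => div_nonneg (norm_nonneg _) (Real.rpow_nonneg ?_ _)
  have hq : (0 : ℝ) < (q.1.1.2 : ℝ) - (q.1.1.1 : ℝ) := sub_pos.2 q.2
  exact hq.le

theorem holderDist_self (f : C(Simplex T, F)) : holderDist β f f = 0 := by
  simp [holderDist]

theorem holderDist_comm (f g : C(Simplex T, F)) : holderDist β f g = holderDist β g f := by
  simp only [holderDist, norm_sub_rev]

theorem holderDist_triangle {f g h : C(Simplex T, F)}
    (hf : ∃ C : ℝ, ∀ q : Simplex T, ‖f q‖ ≤ C * ((q.1.2 : ℝ) - (q.1.1 : ℝ)) ^ β)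
    (hg : ∃ C : ℝ, ∀ q : Simplex T, ‖g q‖ ≤ C * ((q.1.2 : ℝ) - (q.1.1 : ℝ)) ^ β)
    (hh : ∃ C : ℝ, ∀ q : Simplex T, ‖h q‖ ≤ C * ((q.1.2 : ℝ) - (q.1.1 : ℝ)) ^ β) :
    holderDist β f h ≤ holderDist β f g + holderDist β g h := by
  refine Real.iSup_le (fun q => ?_) (add_nonneg (holderDist_nonneg _ _) (holderDist_nonneg _ _))
  have hq : (0 : ℝ) < (q.1.1.2 : ℝ) - (q.1.1.1 : ℝ) := sub_pos.2 q.2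
  refine le_trans ?_ (add_le_add (le_ciSup (holderDist_bddAbove hf hg) q)
    (le_ciSup (holderDist_bddAbove hg hh) q))
  rw [← add_div]
  exact div_le_div_of_nonneg_right (norm_sub_le_norm_sub_add_norm_sub _ _ _)
    (Real.rpow_nonneg hq.le _)

theorem eq_of_holderDist_eq_zero (hβ : 0 < β) {f g : C(Simplex T, F)}
    (hf : ∃ C : ℝ, ∀ q : Simplex T, ‖f q‖ ≤ C * ((q.1.2 : ℝ) - (q.1.1 : ℝ)) ^ β)
    (hg : ∃ C : ℝ, ∀ q : Simplex T, ‖g q‖ ≤ C * ((q.1.2 : ℝ) - (q.1.1 : ℝ)) ^ β)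
    (h : holderDist β f g = 0) : f = g := by
  ext q
  rcases q.2.lt_or_eq with hlt | heq
  · have hq : (0 : ℝ) < (q.1.2 : ℝ) - (q.1.1 : ℝ) := sub_pos.2 hlt
    have h1 := le_ciSup (holderDist_bddAbove hf hg) ⟨q, hlt⟩
    have h2 : ‖f q - g q‖ / ((q.1.2 : ℝ) - (q.1.1 : ℝ)) ^ β ≤ 0 := h1.trans h.le
    rw [div_le_iff₀ (Real.rpow_pos_of_pos hq β), zero_mul] at h2
    exact sub_eq_zero.1 (norm_le_zero_iff.1 h2)
  · obtain ⟨C, hC⟩ := hf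
    obtain ⟨D, hD⟩ := hg
    have hC' := hC q
    have hD' := hD q
    rw [heq, sub_self, Real.zero_rpow hβ.ne', mul_zero] at hC' hD'
    rw [norm_le_zero_iff.1 hC', norm_le_zero_iff.1 hD']

end holderDist

namespace RoughPath

variable {α : HolderExponent} {T : ℝ≥0} {d : ℕ}

theorem exponent_pos (α : HolderExponent) : (0 : ℝ) < α := by
  have := α.2.1
  linarith

/-- The distance `d_α(𝐰, 𝐯) = max_{i = 1, 2} ‖𝐰ⁱ - 𝐯ⁱ‖_{iα}`. -/
noncomputable instance : MetricSpace (RoughPath α T d) where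
  dist w v := max (holderDist (α : ℝ) w.fst v.fst) (holderDist (2 * (α : ℝ)) w.snd v.snd)
  dist_self w := by simp [holderDist_self]
  dist_comm w v := by rw [holderDist_comm w.fst, holderDist_comm w.snd]
  dist_triangle w v u := max_le
    ((holderDist_triangle w.holder_fst v.holder_fst u.holder_fst).trans
      (add_le_add (le_max_left _ _) (le_max_left _ _)))
    ((holderDist_triangle w.holder_snd v.holder_snd u.holder_snd).trans
      (add_le_add (le_max_right _ _) (le_max_right _ _)))
  eq_of_dist_eq_zero {w v} h := by
    have h1 : holderDist (α : ℝ) w.fst v.fst = 0 :=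
      le_antisymm ((le_max_left _ _).trans h.le) (holderDist_nonneg _ _)
    have h2 : holderDist (2 * (α : ℝ)) w.snd v.snd = 0 :=
      le_antisymm ((le_max_right _ _).trans h.le) (holderDist_nonneg _ _)
    have e1 := eq_of_holderDist_eq_zero (exponent_pos α) w.holder_fst v.holder_fst h1
    have e2 := eq_of_holderDist_eq_zero (mul_pos two_pos (exponent_pos α))
      w.holder_snd v.holder_snd h2
    cases w
    cases v
    cases e1
    cases e2
    rfl

end RoughPath

/-! ### Natural lift, geometric rough paths and Brownian rough path -/

/-- `C₀^{1-Hld}([0, T], ℝᵈ)`, the Lipschitz continuous paths that start at the origin. -/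
structure LipschitzPath (T : ℝ≥0) (d : ℕ) extends PathSpace T d where
  lipschitz : ∃ K : ℝ≥0, LipschitzWith K path

namespace LipschitzPath

variable {T : ℝ≥0} {d : ℕ}

/-- The `i`-th coordinate of a Lipschitz path, extended constantly outside `[0, T]`. -/
noncomputable def coord (w : LipschitzPath T d) (i : Fin d) (u : ℝ) : ℝ := w.toPathSpace.extend u i

theorem exists_lipschitz_coord (w : LipschitzPath T d) :
    ∃ K : ℝ≥0, ∀ i, LipschitzWith K (w.coord i) := by
  obtain ⟨K, hK⟩ := w.lipschitz
  refine ⟨K, fun i => LipschitzWith.of_dist_le_mul fun u v => ?_⟩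
  have h1 : dist (w.toPathSpace.extend u) (w.toPathSpace.extend v) ≤ K * dist u v := by
    refine (hK.dist_le_mul _ _).trans ?_
    gcongr
    have := (LipschitzWith.projIcc T.coe_nonneg).dist_le_mul u v
    rwa [NNReal.coe_one, one_mul] at this
  refine le_trans ?_ h1
  rw [dist_eq_norm, dist_eq_norm]
  exact PiLp.norm_apply_le (w.toPathSpace.extend u - w.toPathSpace.extend v) i

theorem coord_coe (w : LipschitzPath T d) (i : Fin d) (t : TimeInterval T) :
    w.coord i (t : ℝ) = w.path t i := by
  rw [coord, PathSpace.extend, Set.projIcc_val]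

theorem intervalIntegrable_coord_deriv (w : LipschitzPath T d) (c : ℝ) (i j : Fin d) (a b : ℝ) :
    IntervalIntegrable (fun u => (w.coord i u - c) * deriv (w.coord j) u) volume a b := by
  obtain ⟨K, hK⟩ := w.exists_lipschitz_coord
  have h1 : IntervalIntegrable (deriv (w.coord j)) volume a b :=
    (hK j).lipschitzOnWith.absolutelyContinuousOnInterval.intervalIntegrable_deriv
  exact h1.continuousOn_mul (((hK i).continuous.sub continuous_const).continuousOn)

theorem integral_deriv_coord (w : LipschitzPath T d) (j : Fin d) (a b : ℝ) :
    ∫ u in a..b, deriv (w.coord j) u = w.coord j b - w.coord j a := by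
  obtain ⟨K, hK⟩ := w.exists_lipschitz_coord
  exact (hK j).lipschitzOnWith.absolutelyContinuousOnInterval.integral_deriv_eq_sub

/-- The iterated integral `∫_s^t (wⁱ_u - wⁱ_s) dwʲ_u`.  As `wʲ` is Lipschitz, hence absolutely
continuous, `dwʲ_u = (wʲ)'(u) du`. -/
noncomputable def area (w : LipschitzPath T d) (i j : Fin d) (s t : ℝ) : ℝ :=
  ∫ u in s..t, (w.coord i u - w.coord i s) * deriv (w.coord j) u

theorem area_chen (w : LipschitzPath T d) (i j : Fin d) (s u t : ℝ) :
    w.area i j s t = w.area i j s u + w.area i j u t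
      + (w.coord i u - w.coord i s) * (w.coord j t - w.coord j u) := by
  have h1 := w.intervalIntegrable_coord_deriv (w.coord i s) i j
  have h2 := w.intervalIntegrable_coord_deriv (w.coord i u) i j
  have h3 : IntervalIntegrable (fun r => (w.coord i u - w.coord i s) * deriv (w.coord j) r)
      volume u t := by
    refine ((h1 u t).sub (h2 u t)).congr ?_
    intro r _
    ring
  rw [← w.integral_deriv_coord j u t, ← intervalIntegral.integral_const_mul, add_assoc]
  unfold area
  rw [← intervalIntegral.integral_add (h2 u t) h3,
    ← intervalIntegral.integral_add_adjacent_intervals (h1 s u) (h1 u t)]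
  congr 1
  refine intervalIntegral.integral_congr fun r _ => ?_
  ring

theorem exists_area_bound (w : LipschitzPath T d) :
    ∃ K : ℝ, 0 ≤ K ∧ ∀ i j : Fin d, ∀ s t : ℝ, s ≤ t → |w.area i j s t| ≤ K * (t - s) ^ 2 := by
  obtain ⟨K, hK⟩ := w.exists_lipschitz_coord
  refine ⟨(K : ℝ) * K, by positivity, fun i j s t hst => ?_⟩
  have hb : ∀ u ∈ Set.uIoc s t,
      ‖(w.coord i u - w.coord i s) * deriv (w.coord j) u‖ ≤ (K * (t - s)) * K := by
    intro u hu
    rw [Set.uIoc_of_le hst] at hu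
    rw [norm_mul]
    gcongr
    · have := (hK i).dist_le_mul u s
      rw [Real.dist_eq, Real.dist_eq, abs_of_nonneg (by linarith [hu.1] : (0 : ℝ) ≤ u - s)] at this
      rw [Real.norm_eq_abs]
      refine this.trans ?_
      gcongr
      exact hu.2
    · exact norm_deriv_le_of_lipschitz (hK j)
  have := intervalIntegral.norm_integral_le_of_norm_le_const hb
  rw [Real.norm_eq_abs, abs_of_nonneg (sub_nonneg.2 hst)] at this
  refine this.trans (le_of_eq ?_)
  ring

theorem continuous_area (w : LipschitzPath T d) (i j : Fin d) :
    Continuous fun q : ℝ × ℝ => w.area i j q.1 q.2 := by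
  obtain ⟨K, hK⟩ := w.exists_lipschitz_coord
  have hc := fun i => (hK i).continuous
  have hA : Continuous fun t : ℝ => w.area i j 0 t :=
    intervalIntegral.continuous_primitive (w.intervalIntegrable_coord_deriv _ i j) 0
  have he : (fun q : ℝ × ℝ => w.area i j q.1 q.2) = fun q : ℝ × ℝ =>
      w.area i j 0 q.2 - w.area i j 0 q.1
        - (w.coord i q.1 - w.coord i 0) * (w.coord j q.2 - w.coord j q.1) := by
    funext q
    rw [w.area_chen i j 0 q.1 q.2]
    ring
  rw [he]
  have := hc i
  have := hc j
  fun_prop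

end LipschitzPath

theorem rpow_holder_bound {T : ℝ≥0} {β γ : ℝ} (hβ : 0 < β) (hγ : β ≤ γ) (q : Simplex T) :
    ((q.1.2 : ℝ) - (q.1.1 : ℝ)) ^ γ
      ≤ (T : ℝ) ^ (γ - β) * ((q.1.2 : ℝ) - (q.1.1 : ℝ)) ^ β := by
  have h0 : (0 : ℝ) ≤ (q.1.2 : ℝ) - (q.1.1 : ℝ) := sub_nonneg.2 q.2
  have h1 : (q.1.2 : ℝ) - (q.1.1 : ℝ) ≤ T := by
    have h2 := q.1.2.2.2
    have h3 := q.1.1.2.1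
    linarith
  have h4 : ((q.1.2 : ℝ) - (q.1.1 : ℝ)) ^ γ
      = ((q.1.2 : ℝ) - (q.1.1 : ℝ)) ^ (γ - β) * ((q.1.2 : ℝ) - (q.1.1 : ℝ)) ^ β := by
    rw [← Real.rpow_add_of_nonneg h0 (sub_nonneg.2 hγ) hβ.le, sub_add_cancel]
  rw [h4]
  have h5 := sub_nonneg.2 hγ
  gcongr

/-- The natural lift `𝐋 (w) = (w_t - w_s, ∫_s^t (w_u - w_s) ⊗ dw_u)` of a Lipschitz path `w`. -/
noncomputable def naturalLift (α : HolderExponent) {T : ℝ≥0} {d : ℕ} (w : LipschitzPath T d) :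
    RoughPath α T d where
  fst := ⟨fun q => w.path q.1.2 - w.path q.1.1, by
    have : Continuous w.path := w.path.continuous
    fun_prop⟩
  snd := ⟨fun q => WithLp.toLp 2 fun ij => w.area ij.1 ij.2 (q.1.1 : ℝ) (q.1.2 : ℝ), by
    refine (PiLp.continuous_toLp 2 _).comp (continuous_pi fun ij => ?_)
    exact (w.continuous_area ij.1 ij.2).comp (by fun_prop :
      Continuous fun q : Simplex T => ((q.1.1 : ℝ), (q.1.2 : ℝ)))⟩
  chen_fst s u t hsu hut := by simp
  chen_snd s u t hsu hut i j := by
    have := w.area_chen i j (s : ℝ) (u : ℝ) (t : ℝ)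
    simp only [w.coord_coe] at this
    simpa using this
  holder_fst := by
    obtain ⟨K, hK⟩ := w.lipschitz
    have hα := RoughPath.exponent_pos α
    have hα' := α.2.2
    refine ⟨K * (T : ℝ) ^ (1 - (α : ℝ)), fun q => ?_⟩
    have h0 : (0 : ℝ) ≤ (q.1.2 : ℝ) - (q.1.1 : ℝ) := sub_nonneg.2 q.2
    have h1 := hK.dist_le_mul q.1.2 q.1.1
    rw [dist_eq_norm, Subtype.dist_eq, Real.dist_eq, abs_of_nonneg h0] at h1
    have h2 := rpow_holder_bound (γ := 1) hα (by linarith) q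
    rw [Real.rpow_one] at h2
    calc _ ≤ (K : ℝ) * ((q.1.2 : ℝ) - (q.1.1 : ℝ)) := h1
      _ ≤ K * ((T : ℝ) ^ (1 - (α : ℝ)) * ((q.1.2 : ℝ) - (q.1.1 : ℝ)) ^ (α : ℝ)) := by gcongr
      _ = _ := by ring
  holder_snd := by
    obtain ⟨K, hK0, hK⟩ := w.exists_area_bound
    have hα := RoughPath.exponent_pos α
    have hα' := α.2.2
    refine ⟨(∑ _ij : Fin d × Fin d, K) * (T : ℝ) ^ (2 - 2 * (α : ℝ)), fun q => ?_⟩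
    have h2 := rpow_holder_bound (γ := 2) (mul_pos two_pos hα) (by linarith) q
    rw [Real.rpow_two] at h2
    have h3 : ‖(WithLp.toLp 2 fun ij : Fin d × Fin d =>
        w.area ij.1 ij.2 (q.1.1 : ℝ) (q.1.2 : ℝ) : EuclideanSpace ℝ (Fin d × Fin d))‖
        ≤ ∑ ij : Fin d × Fin d, |w.area ij.1 ij.2 (q.1.1 : ℝ) (q.1.2 : ℝ)| := by
      rw [EuclideanSpace.norm_eq]
      refine Real.sqrt_le_iff.2 ⟨Finset.sum_nonneg fun _ _ => abs_nonneg _, ?_⟩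
      simpa using Finset.sum_sq_le_sq_sum_of_nonneg (s := Finset.univ)
        (f := fun ij : Fin d × Fin d => |w.area ij.1 ij.2 (q.1.1 : ℝ) (q.1.2 : ℝ)|)
        (fun _ _ => abs_nonneg _)
    have hS : (0 : ℝ) ≤ ∑ _ij : Fin d × Fin d, K := Finset.sum_nonneg fun _ _ => hK0
    calc _ ≤ ∑ ij : Fin d × Fin d, |w.area ij.1 ij.2 (q.1.1 : ℝ) (q.1.2 : ℝ)| := h3
      _ ≤ ∑ _ij : Fin d × Fin d, K * ((q.1.2 : ℝ) - (q.1.1 : ℝ)) ^ 2 :=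
        Finset.sum_le_sum fun ij _ => hK ij.1 ij.2 _ _ q.2
      _ = (∑ _ij : Fin d × Fin d, K) * ((q.1.2 : ℝ) - (q.1.1 : ℝ)) ^ 2 :=
        (Finset.sum_mul _ _ _).symm
      _ ≤ (∑ _ij : Fin d × Fin d, K) * ((T : ℝ) ^ (2 - 2 * (α : ℝ))
          * ((q.1.2 : ℝ) - (q.1.1 : ℝ)) ^ (2 * (α : ℝ))) := by gcongr
      _ = _ := by ring

/-- `GΩ_α([0, T], ℝᵈ)`, the `α`-Hölder geometric rough paths: the `d_α`-closure of the natural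
lifts of Lipschitz paths, with the distance `d_α`. -/
abbrev GeometricRoughPath (α : HolderExponent) (T : ℝ≥0) (d : ℕ) : Type :=
  {w : RoughPath α T d // w ∈ closure (Set.range (naturalLift α (T := T) (d := d)))}

namespace PathSpace

variable {T : ℝ≥0} {d : ℕ}

/-- The value of the `n`-th dyadic piecewise linear approximation of `w`: on
`[jT/2ⁿ, (j+1)T/2ⁿ]` it interpolates linearly between `w (jT/2ⁿ)` and `w ((j+1)T/2ⁿ)`, i.e. it is
the sum of the increments of `w` over the dyadic intervals, each multiplied by the fraction
of that interval that lies before `t`. -/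
noncomputable def dyadicFun (n : ℕ) (w : PathSpace T d) (t : ℝ) : EuclideanSpace ℝ (Fin d) :=
  ∑ j ∈ Finset.range (2 ^ n), max 0 (min 1 (2 ^ n * t / T - j)) •
    (w.extend ((j + 1 : ℝ) * T / 2 ^ n) - w.extend ((j : ℝ) * T / 2 ^ n))

theorem exists_lipschitz_dyadicFun (n : ℕ) (w : PathSpace T d) :
    ∃ K : ℝ≥0, LipschitzWith K (w.dyadicFun n) := by
  unfold dyadicFun
  generalize Finset.range (2 ^ n) = s
  induction s using Finset.cons_induction with
  | empty => exact ⟨0, by simp⟩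
  | cons j s hj ih =>
    obtain ⟨K, hK⟩ := ih
    have h1 : LipschitzWith (2 ^ n / T) fun t : ℝ => 2 ^ n * t / T - (j : ℝ) := by
      refine LipschitzWith.of_dist_le_mul fun x y => le_of_eq ?_
      rw [Real.dist_eq, Real.dist_eq]
      have : 2 ^ n * x / (T : ℝ) - j - (2 ^ n * y / T - j) = 2 ^ n / T * (x - y) := by ring
      rw [this, abs_mul, abs_of_nonneg (by positivity)]
      simp
    have h2 : LipschitzWith (2 ^ n / T) fun t : ℝ => max 0 (min 1 (2 ^ n * t / T - (j : ℝ))) :=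
      (h1.const_min 1).const_max 0
    have h3 : ∀ v : EuclideanSpace ℝ (Fin d), LipschitzWith (‖v‖₊ * (2 ^ n / T)) fun t : ℝ =>
        max 0 (min 1 (2 ^ n * t / T - (j : ℝ))) • v := by
      intro v
      refine LipschitzWith.of_dist_le_mul fun x y => ?_
      rw [dist_eq_norm, ← sub_smul, norm_smul, ← dist_eq_norm, mul_comm]
      push_cast
      rw [mul_assoc]
      exact mul_le_mul_of_nonneg_left (by simpa using h2.dist_le_mul x y) (norm_nonneg _)
    exact ⟨_, by simpa only [Finset.sum_cons] using (h3 _).add hK⟩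

/-- The `n`-th dyadic piecewise linear approximation `w(n)` of `w`, as a Lipschitz path. -/
noncomputable def dyadicApprox (n : ℕ) (w : PathSpace T d) : LipschitzPath T d where
  path := ⟨fun t => w.dyadicFun n t,
    (w.exists_lipschitz_dyadicFun n).choose_spec.continuous.comp continuous_subtype_val⟩
  path_start := by simp [startTime, dyadicFun]
  lipschitz :=
    ⟨_, (w.exists_lipschitz_dyadicFun n).choose_spec.comp (LipschitzWith.subtype_val _)⟩

end PathSpace

section BrownianRoughPath

variable (α : HolderExponent) {T : ℝ≥0} {d : ℕ}

/-- The lifts `𝐖(n) = 𝐋 (w(n))`. -/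
noncomputable def dyadicLift (n : ℕ) (w : PathSpace T d) : GeometricRoughPath α T d :=
  ⟨naturalLift α (w.dyadicApprox n), subset_closure ⟨_, rfl⟩⟩

/-- The set of all `w` for which `(𝐖(n))ₙ` is not Cauchy in `GΩ_α([0, T], ℝᵈ)`. -/
def exceptionalSet (T : ℝ≥0) (d : ℕ) : Set (PathSpace T d) :=
  {w | ¬ CauchySeq fun n => dyadicLift α n w}

open Classical in
/-- Brownian rough path `𝐖 = lim 𝐖(n)`; where the limit does not exist, `𝐖` takes
the value prescribed by `W₀`. -/
noncomputable def brownianRoughPath (W₀ : PathSpace T d → GeometricRoughPath α T d)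
    (w : PathSpace T d) : GeometricRoughPath α T d :=
  if h : ∃ W, Tendsto (fun n => dyadicLift α n w) atTop (𝓝 W) then h.choose else W₀ w

end BrownianRoughPath

/-! ### Rough differential equations on a foliated space -/

section RDE

variable {p : ℕ} {M Z : Type*} [TopologicalSpace M] [TopologicalSpace Z]
  {A : FoliatedAtlas p M Z} {α : HolderExponent} {T : ℝ≥0} {d : ℕ}

/-- `x` solves `dx_t = ∑_{i=1}^d V_i(x_t) dwⁱ_t + V_0(x_t) dt` on `[0, T]` with `x_0 = m`, driven by the
geometric rough path `𝐰`: for every leafwise `C³` function `f`, uniformly over `s ≤ t`,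
`f(x_t) - f(x_s) = ∑ V_i f(x_s) 𝐰¹ⁱ_{s,t} + ∑ V_j V_k f(x_s) 𝐰²ʲᵏ_{s,t} + V_0 f(x_s) (t - s)
+ O(|t - s|^{3α})`.  The drift is `V 0`; the fields `V_1, …, V_d` are `V i.succ`. -/
def IsRDESolution (V : Fin (d + 1) → A.LeafwiseVectorField 3) (w : GeometricRoughPath α T d)
    (m : M) (x : C(TimeInterval T, M)) : Prop :=
  x (startTime T) = m ∧
  ∀ f : M → ℝ, A.IsLeafwiseFunction 3 f → ∃ C : ℝ, ∀ (s t : TimeInterval T) (hst : s ≤ t),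
    |f (x t) - f (x s) -
      (∑ i : Fin d, (V i.succ).apply f (x s) * w.1.fst ⟨(s, t), hst⟩ i
        + ∑ j : Fin d, ∑ k : Fin d,
            (V j.succ).apply ((V k.succ).apply f) (x s) * w.1.snd ⟨(s, t), hst⟩ (j, k)
        + (V 0).apply f (x s) * ((t : ℝ) - (s : ℝ)))|
      ≤ C * ((t : ℝ) - (s : ℝ)) ^ (3 * (α : ℝ))

open Classical in
/-- The Lyons–Itô map `Φ(m, 𝐰)`: the solution of the RDE driven by `𝐰` that starts at `m`
(the constant path where there is no solution). -/
noncomputable def lyonsIto (V : Fin (d + 1) → A.LeafwiseVectorField 3) (m : M)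
    (w : GeometricRoughPath α T d) : C(TimeInterval T, M) :=
  if h : ∃ x, IsRDESolution V w m x then h.choose else ContinuousMap.const _ m

end RDE

/-! The measurability rests on one deterministic and one probabilistic fact. The solution map Φ is
well defined and jointly continuous in the starting point and the rough path (`tendsto_lyonsIto`),
and the dyadic lifts are Cauchy for μ-almost every w (`measure_exceptionalSet`). For fixed m, the
map w ↦ Φ(m, W(w)) is an almost everywhere limit of w ↦ Φ(m, W(n)(w)), and these are continuous
because w(n) depends on finitely many values of w. It is therefore null measurable, whatever W is on
the exceptional set. For fixed w, exceptional or not, it is continuous in m. A map that is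
continuous in a separable metrizable variable and measurable in the other one is jointly measurable.

Existence and uniqueness of solutions are reduced to Davie's theory in Euclidean space. Inside a box
of a chart a solution cannot change plaque: a test function of the transverse variable alone has
zero expansion, and an increment bound with exponent 3α > 1 makes it constant along the solution
(`IsSol.snd_eq`). Within the plaque, coordinate test functions turn the definition into |y_t - y_s -
N_{s,t}(y_s)| ≤ C |t - s|^{3α} with N the second-order Euler increment (`IsSol.exists_davie_chart`).
Conversely, since the rough path is geometric, this estimate gives back the expansion of every
leafwise function (`exists_ito_bound`). The analytic heart is `exists_CB_euler_defect`: by Chen's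
relation, Euler steps over [s, u] and [u, t] compose to the step over [s, t] up to an error of order
3α, both in size and in Lipschitz constant. As 3α > 1, subdividing intervals contracts such errors.
This gives existence (`exists_davie_solution`, by compactness of the Euler schemes) and uniqueness
(`davie_unique`).

Compactness of M makes the time step and all constants uniform over starting points and over drivers
with a common Hölder constant, and local solutions are glued (`exists_solution`). Continuity of Φ
then needs no stability estimate: limits of solutions satisfy the limiting Davie estimates, hence
are the solution, by uniqueness (`tendsto_lyonsIto_apply`).

For the Brownian rough path, the approximations of levels n and n + 1 agree on the grid of level n,
and between grid points their areas differ by a sum of independent centred terms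
(`dyadicApprox_area_sub`). Exponential moments and Borel–Cantelli bound all grid quantities of level
n by 3(n + 1) times their natural scale. Interpolation between grid points (`GridClose.dist_le`)
gives distances of order n² 2^{-n(1/2 - α)}, which are summable, and the space of geometric rough
paths is complete. -/

namespace RoughFoliation

/-! ### Leafwise regularity, recursively -/

section LeafC

variable {E : Type} [NormedAddCommGroup E] [NormedSpace ℝ E] {Z : Type*} [TopologicalSpace Z]

/-- The leafwise derivative of a function on `E × Z`. -/
noncomputable def leafDeriv {F : Type} [NormedAddCommGroup F] [NormedSpace ℝ F] (f : E × Z → F)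
    (q : E × Z) : E →L[ℝ] F :=
  fderiv ℝ (fun y => f (y, q.2)) q.1

/-- The class `C_L^k`, defined by recursion on `k`. -/
def LeafC : ∀ (_ : ℕ) {F : Type} [NormedAddCommGroup F] [NormedSpace ℝ F] (_ : E × Z → F)
    (_ : Set (E × Z)), Prop
  | 0, _, _, _, f, U => ContinuousOn f U
  | k + 1, _, _, _, f, U => ContinuousOn f U ∧
      (∀ q ∈ U, DifferentiableAt ℝ (fun y => f (y, q.2)) q.1) ∧ LeafC k (leafDeriv f) U

variable {F G H : Type} [NormedAddCommGroup F] [NormedSpace ℝ F] [NormedAddCommGroup G]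
  [NormedSpace ℝ G] [NormedAddCommGroup H] [NormedSpace ℝ H]
  {f g : E × Z → F} {U U' : Set (E × Z)} {k l : ℕ}

theorem LeafC.continuousOn (h : LeafC k f U) : ContinuousOn f U := by
  cases k with
  | zero => exact h
  | succ k => exact h.1

theorem LeafC.hasFDerivAt (h : LeafC (k + 1) f U) {q : E × Z} (hq : q ∈ U) :
    HasFDerivAt (fun y => f (y, q.2)) (leafDeriv f q) q.1 := (h.2.1 q hq).hasFDerivAt

theorem LeafC.of_succ (h : LeafC (k + 1) f U) : LeafC k f U := by
  induction k generalizing F with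
  | zero => exact h.1
  | succ k ih => exact ⟨h.1, h.2.1, ih h.2.2⟩

theorem LeafC.of_le (h : LeafC k f U) (hl : l ≤ k) : LeafC l f U := by
  induction k, hl using Nat.le_induction with
  | base => exact h
  | succ k _ ih => exact ih h.of_succ

omit [NormedSpace ℝ E] in
theorem slice_mem_nhds (hU : IsOpen U) {q : E × Z} (hq : q ∈ U) :
    {y | (y, q.2) ∈ U} ∈ 𝓝 q.1 :=
  (by fun_prop : Continuous fun y : E => (y, q.2)).continuousAt.preimage_mem_nhds (hU.mem_nhds hq)

theorem leafDeriv_congr (hU : IsOpen U) (h : Set.EqOn f g U) :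
    Set.EqOn (leafDeriv f) (leafDeriv g) U := fun _ hq =>
  Filter.EventuallyEq.fderiv_eq (Filter.mem_of_superset (slice_mem_nhds hU hq) fun _ hy => h hy)

theorem LeafC.congr (hf : LeafC k f U) (hU : IsOpen U) (h : Set.EqOn g f U) : LeafC k g U := by
  induction k generalizing F with
  | zero => exact ContinuousOn.congr hf h
  | succ k ih =>
    exact ⟨hf.1.congr h, fun q hq => (hf.2.1 q hq).congr_of_eventuallyEq
      (Filter.mem_of_superset (slice_mem_nhds hU hq) fun _ hy => h hy),
      ih hf.2.2 (leafDeriv_congr hU h)⟩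

/-- All clauses of the definition concern germs at points of `U`. This serves functions given by
different formulas near different points, such as bumps extended by zero. -/
theorem LeafC.of_local (h : ∀ q ∈ U, ∃ U', IsOpen U' ∧ q ∈ U' ∧ LeafC k f U') :
    LeafC k f U := by
  have hc : ContinuousOn f U := fun q hq => by
    obtain ⟨U', h1, h2, h3⟩ := h q hq
    exact (h3.continuousOn.continuousAt (h1.mem_nhds h2)).continuousWithinAt
  induction k generalizing F with
  | zero => exact hc
  | succ k ih =>
    refine ⟨hc, fun q hq => ?_, ih (fun q hq => ?_) fun q hq => ?_⟩
    · obtain ⟨U', h1, h2, h3⟩ := h q hq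
      exact h3.2.1 q h2
    · obtain ⟨U', h1, h2, h3⟩ := h q hq
      exact ⟨U', h1, h2, h3.2.2⟩
    · obtain ⟨U', h1, h2, h3⟩ := h q hq
      exact (h3.2.2.continuousOn.continuousAt (h1.mem_nhds h2)).continuousWithinAt

theorem LeafC.add (hf : LeafC k f U) (hg : LeafC k g U) (hU : IsOpen U) :
    LeafC k (fun q => f q + g q) U := by
  induction k generalizing F with
  | zero => exact ContinuousOn.add hf hg
  | succ k ih =>
    refine ⟨hf.1.add hg.1, fun q hq => (hf.2.1 q hq).add (hg.2.1 q hq), ?_⟩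
    exact (ih hf.2.2 hg.2.2).congr hU fun q hq => fderiv_fun_add (hf.2.1 q hq) (hg.2.1 q hq)

/-- The product rule writes the leafwise derivative as a sum of two expressions of the same shape,
with `B` replaced by its `precompR` and `precompL`. The induction therefore runs over all target
spaces and all bilinear maps at once. Scalar multiples and evaluation of linear maps are special
cases. -/
theorem LeafC.bilin (B : F →L[ℝ] G →L[ℝ] H) {g : E × Z → G} (hf : LeafC k f U)
    (hg : LeafC k g U) (hU : IsOpen U) : LeafC k (fun q => B (f q) (g q)) U := by
  have hc : ∀ {F G H : Type} [NormedAddCommGroup F] [NormedSpace ℝ F] [NormedAddCommGroup G]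
      [NormedSpace ℝ G] [NormedAddCommGroup H] [NormedSpace ℝ H] (B : F →L[ℝ] G →L[ℝ] H)
      {f : E × Z → F} {g : E × Z → G}, ContinuousOn f U → ContinuousOn g U →
      ContinuousOn (fun q => B (f q) (g q)) U := fun B f g hf hg =>
    (B.continuous.comp_continuousOn hf).clm_apply hg
  induction k generalizing F G H with
  | zero => exact hc B hf hg
  | succ k ih =>
    refine ⟨hc B hf.1 hg.1, fun q hq =>
      (B.hasFDerivAt_of_bilinear (hf.hasFDerivAt hq) (hg.hasFDerivAt hq)).differentiableAt, ?_⟩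
    refine ((ih (ContinuousLinearMap.precompR E B) hf.of_succ hg.2.2).add
      (ih (ContinuousLinearMap.precompL E B) hf.2.2 hg.of_succ) hU).congr hU fun q hq => ?_
    exact B.fderiv_of_bilinear (hf.2.1 q hq) (hg.2.1 q hq)

theorem LeafC.smul {c : E × Z → ℝ} (hc : LeafC k c U) (hf : LeafC k f U) (hU : IsOpen U) :
    LeafC k (fun q => c q • f q) U :=
  hc.bilin (ContinuousLinearMap.lsmul ℝ ℝ) hf hU

theorem LeafC.clm_apply {c : E × Z → F →L[ℝ] G} (hc : LeafC k c U) (hf : LeafC k f U)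
    (hU : IsOpen U) : LeafC k (fun q => c q (f q)) U :=
  hc.bilin (ContinuousLinearMap.id ℝ _) hf hU

theorem LeafC.const_snd {χ : Z → F} (hχ : ContinuousOn χ (Prod.snd '' U)) :
    LeafC k (fun q : E × Z => χ q.2) U := by
  have h0 : ∀ {G : Type} [NormedAddCommGroup G] [NormedSpace ℝ G],
      LeafC k (fun _ : E × Z => (0 : G)) U := by
    induction k with
    | zero => exact continuousOn_const
    | succ k ih =>
      intro G _ _
      refine ⟨continuousOn_const, fun q _ => differentiableAt_const _, ?_⟩
      have : leafDeriv (fun _ : E × Z => (0 : G)) = fun _ => 0 := by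
        funext q; simp [leafDeriv]
      rw [this]
      exact ih
  have hc : ContinuousOn (fun q : E × Z => χ q.2) U :=
    hχ.comp continuous_snd.continuousOn fun q hq => ⟨q, hq, rfl⟩
  cases k with
  | zero => exact hc
  | succ k =>
    refine ⟨hc, fun q _ => differentiableAt_const (χ q.2), ?_⟩
    have : leafDeriv (fun q : E × Z => χ q.2) = fun _ => 0 := by
      funext q; simp [leafDeriv]
    rw [this]
    exact h0.of_succ

theorem LeafC.comp_smooth {b : F → G} (hb : ContDiff ℝ k b) (hf : LeafC k f U) (hU : IsOpen U) :
    LeafC k (fun q => b (f q)) U := by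
  induction k generalizing G with
  | zero => exact hb.continuous.comp_continuousOn hf
  | succ k ih =>
    have hd : Differentiable ℝ b := hb.differentiable (by simp)
    refine ⟨hb.continuous.comp_continuousOn hf.1, fun q hq =>
      (hd _).comp q.1 (hf.2.1 q hq), ?_⟩
    have h1 : LeafC k (fun q => fderiv ℝ b (f q)) U :=
      ih (hb.fderiv_right (by norm_cast)) hf.of_succ
    refine (h1.bilin (ContinuousLinearMap.compL ℝ E F G) hf.2.2 hU).congr hU fun q hq => ?_
    exact fderiv_comp q.1 (hd _) (hf.2.1 q hq)

theorem LeafC.of_fst {b : E → G} (hb : ContDiff ℝ k b) :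
    LeafC k (fun q : E × Z => b q.1) U := by
  induction k generalizing G with
  | zero => exact (hb.continuous.comp continuous_fst).continuousOn
  | succ k ih =>
    have hd : Differentiable ℝ b := hb.differentiable (by simp)
    exact ⟨(hb.continuous.comp continuous_fst).continuousOn, fun q _ => hd q.1,
      ih (hb.fderiv_right (by norm_cast))⟩

end LeafC

/-- Currying identifies isometrically the derivatives of order j + 1 of `f` with those of order j of
`leafDeriv f`, so the two notions satisfy the same recursion. The recursive form is the one in which
product and chain rules go by induction. -/
theorem isCL_iff_leafC {p : ℕ} {Z : Type*} [TopologicalSpace Z] {F : Type}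
    [NormedAddCommGroup F] [NormedSpace ℝ F] {k : ℕ} {f : EuclideanSpace ℝ (Fin p) × Z → F}
    {U : Set (EuclideanSpace ℝ (Fin p) × Z)} (hU : IsOpen U) : IsCL k f U ↔ LeafC k f U := by
  have h0 : ∀ {F : Type} [NormedAddCommGroup F] [NormedSpace ℝ F]
      (f : EuclideanSpace ℝ (Fin p) × Z → F), ContinuousOn (fun q : EuclideanSpace ℝ (Fin p) × Z =>
      iteratedFDeriv ℝ 0 (fun y => f (y, q.2)) q.1) U ↔ ContinuousOn f U := by
    intro F _ _ f
    have : (fun q : EuclideanSpace ℝ (Fin p) × Z => iteratedFDeriv ℝ 0 (fun y => f (y, q.2)) q.1)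
        = (continuousMultilinearCurryFin0 ℝ (EuclideanSpace ℝ (Fin p)) F).symm ∘ f := by
      funext q
      rw [iteratedFDeriv_zero_eq_comp]
      rfl
    rw [this]
    exact LinearIsometryEquiv.comp_continuousOn_iff _
  have hs : ∀ z, IsOpen {y : EuclideanSpace ℝ (Fin p) | (y, z) ∈ U} := fun z =>
    hU.preimage (by fun_prop : Continuous fun y : EuclideanSpace ℝ (Fin p) => (y, z))
  induction k generalizing F with
  | zero =>
    constructor
    · intro h
      exact (h0 f).1 (h.2 0 le_rfl)
    · intro h
      refine ⟨fun z => ?_, fun j hj => ?_⟩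
      · rw [Nat.cast_zero, contDiffOn_zero]
        exact ContinuousOn.comp h (by fun_prop) fun y hy => hy
      · obtain rfl := Nat.le_zero.1 hj
        exact (h0 f).2 h
  | succ k ih =>
    have hstep : IsCL (k + 1) f U ↔ ContinuousOn f U ∧
        (∀ q ∈ U, DifferentiableAt ℝ (fun y => f (y, q.2)) q.1) ∧ IsCL k (leafDeriv f) U := by
      have hj : ∀ j, ContinuousOn (fun q : EuclideanSpace ℝ (Fin p) × Z =>
          iteratedFDeriv ℝ (j + 1) (fun y => f (y, q.2)) q.1) U ↔
          ContinuousOn (fun q : EuclideanSpace ℝ (Fin p) × Z =>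
          iteratedFDeriv ℝ j (fun y => leafDeriv f (y, q.2)) q.1) U := by
        intro j
        have : (fun q : EuclideanSpace ℝ (Fin p) × Z =>
            iteratedFDeriv ℝ (j + 1) (fun y => f (y, q.2)) q.1) =
            (continuousMultilinearCurryRightEquiv' ℝ j (EuclideanSpace ℝ (Fin p)) F).symm ∘
            fun q => iteratedFDeriv ℝ j (fun y => leafDeriv f (y, q.2)) q.1 := by
          funext q
          rw [iteratedFDeriv_succ_eq_comp_right]
          rfl
        rw [this]
        exact LinearIsometryEquiv.comp_continuousOn_iff _
      constructor
      · rintro ⟨h1, h2⟩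
        have h3 := fun z => (contDiffOn_succ_iff_fderiv_of_isOpen (𝕜 := ℝ) (n := k) (hs z)).1
          (by exact_mod_cast h1 z)
        refine ⟨(h0 f).1 (h2 0 (Nat.zero_le _)), fun q hq => ?_, fun z => (h3 z).2.2, fun j hj' =>
          (hj j).1 (h2 (j + 1) (by omega))⟩
        exact ((h3 q.2).1 q.1 hq).differentiableAt ((hs q.2).mem_nhds hq)
      · rintro ⟨h1, h2, h3, h4⟩
        refine ⟨fun z => ?_, fun j hj' => ?_⟩
        · have := (contDiffOn_succ_iff_fderiv_of_isOpen (𝕜 := ℝ) (n := k)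
            (f := fun y => f (y, z)) (hs z)).2
            ⟨fun y hy => (h2 (y, z) hy).differentiableWithinAt, by simp, h3 z⟩
          exact_mod_cast this
        · cases j with
          | zero => exact (h0 f).2 h1
          | succ j => exact (hj j).2 (h4 j (by omega))
    exact hstep.trans (and_congr_right fun _ => and_congr_right fun _ => ih)

end RoughFoliation

namespace RoughFoliation

/-! ### Functions with bounded derivatives -/

section CB

variable {E : Type} [NormedAddCommGroup E] [NormedSpace ℝ E]

/-- `f` is `k` times differentiable and its derivatives of order at most `k` are bounded by `K`. -/
def CB : ∀ (_ : ℕ) (_ : ℝ) {F : Type} [NormedAddCommGroup F] [NormedSpace ℝ F] (_ : E → F), Prop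
  | 0, K, _, _, _, f => ∀ y, ‖f y‖ ≤ K
  | k + 1, K, _, _, _, f => (∀ y, ‖f y‖ ≤ K) ∧ Differentiable ℝ f ∧ CB k K (fderiv ℝ f)

variable {F G H : Type} [NormedAddCommGroup F] [NormedSpace ℝ F] [NormedAddCommGroup G]
  [NormedSpace ℝ G] [NormedAddCommGroup H] [NormedSpace ℝ H]
  {f g : E → F} {k l : ℕ} {K L : ℝ}

theorem CB.norm_le (h : CB k K f) (y : E) : ‖f y‖ ≤ K := by
  cases k with
  | zero => exact h y
  | succ k => exact h.1 y

theorem CB.nonneg (h : CB k K f) : 0 ≤ K := (norm_nonneg _).trans (h.norm_le 0)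

theorem CB.differentiable (h : CB (k + 1) K f) : Differentiable ℝ f := h.2.1

theorem CB.fderiv (h : CB (k + 1) K f) : CB k K (fderiv ℝ f) := h.2.2

theorem CB.mono (h : CB k K f) (hK : K ≤ L) : CB k L f := by
  induction k generalizing F with
  | zero => exact fun y => (h y).trans hK
  | succ k ih => exact ⟨fun y => (h.1 y).trans hK, h.2.1, ih h.2.2⟩

theorem CB.of_succ (h : CB (k + 1) K f) : CB k K f := by
  induction k generalizing F with
  | zero => exact h.1
  | succ k ih => exact ⟨h.1, h.2.1, ih h.2.2⟩

theorem CB.zero (hK : 0 ≤ K) : CB k K (fun _ : E => (0 : F)) := by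
  induction k generalizing F with
  | zero => intro y; simpa using hK
  | succ k ih =>
    refine ⟨fun y => by simpa using hK, differentiable_const _, ?_⟩
    have : _root_.fderiv ℝ (fun _ : E => (0 : F)) = fun _ => 0 := by
      funext y; exact fderiv_const_apply _
    rw [this]
    exact ih

theorem CB.add (hf : CB k K f) (hg : CB k L g) : CB k (K + L) (fun y => f y + g y) := by
  induction k generalizing F with
  | zero => exact fun y => (norm_add_le _ _).trans (add_le_add (hf y) (hg y))
  | succ k ih =>
    refine ⟨fun y => (norm_add_le _ _).trans (add_le_add (hf.1 y) (hg.1 y)), hf.2.1.add hg.2.1, ?_⟩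
    have : _root_.fderiv ℝ (fun y => f y + g y)
        = fun y => _root_.fderiv ℝ f y + _root_.fderiv ℝ g y := by
      funext y; exact fderiv_fun_add (hf.2.1 y) (hg.2.1 y)
    rw [this]
    exact ih hf.2.2 hg.2.2

theorem CB.const_smul (c : ℝ) (hf : CB k K f) : CB k (|c| * K) (fun y => c • f y) := by
  have hb : ∀ {x : F}, ‖x‖ ≤ K → ‖c • x‖ ≤ |c| * K := fun hx => by
    rw [norm_smul, Real.norm_eq_abs]; gcongr
  induction k generalizing F with
  | zero => exact fun y => by rw [norm_smul, Real.norm_eq_abs]; gcongr; exact hf y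
  | succ k ih =>
    refine ⟨fun y => hb (hf.1 y), hf.2.1.const_smul c, ?_⟩
    have : _root_.fderiv ℝ (fun y => c • f y) = fun y => c • _root_.fderiv ℝ f y := by
      funext y; exact fderiv_fun_const_smul (hf.2.1 y) c
    rw [this]
    refine ih hf.2.2 fun {x} hx => ?_
    rw [norm_smul, Real.norm_eq_abs]; gcongr

theorem CB.sum {ι : Type*} (s : Finset ι) {f : ι → E → F} {K : ι → ℝ}
    (h : ∀ i ∈ s, CB k (K i) (f i)) : CB k (∑ i ∈ s, K i) (fun y => ∑ i ∈ s, f i y) := by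
  induction s using Finset.cons_induction with
  | empty => simpa using CB.zero le_rfl
  | cons a s ha ih =>
    simp only [Finset.sum_cons]
    exact (h a (Finset.mem_cons_self a s)).add (ih fun i hi => h i (Finset.mem_cons_of_mem hi))

/-- Each differentiation doubles the number of terms, hence the factor 2^k. Passing to `precompR`
and `precompL` does not increase the norm of the bilinear map, so the same `N` serves at every
stage. -/
theorem CB.bilin (B : F →L[ℝ] G →L[ℝ] H) {g : E → G} {N : ℝ} (hB : ‖B‖ ≤ N) (hf : CB k K f)
    (hg : CB k L g) : CB k (2 ^ k * (N * K * L)) (fun y => B (f y) (g y)) := by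
  have hK := hf.nonneg
  have hN : 0 ≤ N := (norm_nonneg B).trans hB
  have hL := hg.nonneg
  have h0 : ∀ y, ‖B (f y) (g y)‖ ≤ N * K * L := fun y => by
    refine (B.le_opNorm₂ _ _).trans ?_
    have := hf.norm_le y
    have := hg.norm_le y
    gcongr
  induction k generalizing F G H N with
  | zero => rw [pow_zero, one_mul]; exact h0
  | succ k ih =>
    refine ⟨fun y => (h0 y).trans (le_mul_of_one_le_left (by positivity)
      (one_le_pow₀ one_le_two)), fun y =>
      (B.hasFDerivAt_of_bilinear (hf.2.1 y).hasFDerivAt (hg.2.1 y).hasFDerivAt).differentiableAt, ?_⟩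
    have : _root_.fderiv ℝ (fun y => B (f y) (g y)) = fun y =>
        B.precompR E (f y) (_root_.fderiv ℝ g y) + B.precompL E (_root_.fderiv ℝ f y) (g y) := by
      funext y; exact B.fderiv_of_bilinear (hf.2.1 y) (hg.2.1 y)
    rw [this]
    have hR := (B.norm_precompR_le E).trans hB
    have hL' := (B.norm_precompL_le E).trans hB
    have h1 := ih (B.precompR E) hR hf.of_succ hg.2.2 hN fun y => by
      refine (ContinuousLinearMap.le_opNorm₂ _ _ _).trans ?_
      have := hf.norm_le y
      have := hg.2.2.norm_le y
      gcongr
    have h2 := ih (B.precompL E) hL' hf.2.2 hg.of_succ hN fun y => by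
      refine (ContinuousLinearMap.le_opNorm₂ _ _ _).trans ?_
      have := hf.2.2.norm_le y
      have := hg.norm_le y
      gcongr
    refine (h1.add h2).mono (le_of_eq ?_)
    ring

theorem CB.clm_apply {c : E → F →L[ℝ] G} (hc : CB k K c) (hf : CB k L f) :
    CB k (2 ^ k * (K * L)) (fun y => c y (f y)) := by
  have := hc.bilin (ContinuousLinearMap.id ℝ (F →L[ℝ] G)) ContinuousLinearMap.norm_id_le hf
  simpa using this

theorem CB.lipschitz (h : CB (k + 1) K f) (x y : E) : ‖f x - f y‖ ≤ K * ‖x - y‖ :=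
  convex_univ.norm_image_sub_le_of_norm_fderiv_le (fun z _ => h.2.1 z)
    (fun z _ => h.2.2.norm_le z) (Set.mem_univ y) (Set.mem_univ x)

theorem CB.of_norm_le (h : ∀ y, ‖f y‖ ≤ K) (hd : ∀ y, ∃ f' : E →L[ℝ] F, HasFDerivAt f f' y ∧
    ‖f'‖ ≤ K) : CB 1 K f := by
  refine ⟨h, fun y => ?_, fun y => ?_⟩
  · obtain ⟨f', h1, _⟩ := hd y
    exact h1.differentiableAt
  · obtain ⟨f', h1, h2⟩ := hd y
    rwa [h1.fderiv]

/-- First-order Taylor estimate. -/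
theorem CB.taylor_one (h : CB 2 K f) (x y : E) :
    ‖f y - f x - _root_.fderiv ℝ f x (y - x)‖ ≤ K * ‖y - x‖ ^ 2 := by
  have h1 := (convex_closedBall x ‖y - x‖).norm_image_sub_le_of_norm_hasFDerivWithin_le'
    (f := f) (x := x) (y := y) (φ := _root_.fderiv ℝ f x) (C := K * ‖y - x‖)
    (fun z _ => (h.2.1 z).hasFDerivAt.hasFDerivWithinAt) (fun z hz => ?_)
    (Metric.mem_closedBall_self (norm_nonneg _)) (by simp [dist_eq_norm])
  · calc _ ≤ _ := h1
      _ = _ := by ring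
  · refine (h.2.2.lipschitz z x).trans ?_
    have := h.nonneg
    rw [Metric.mem_closedBall, dist_eq_norm] at hz
    gcongr

/-- Increments of `f` along a small displacement. -/
theorem CB.comp_id_add_sub {N : E → E} {a : ℝ} (h : CB 2 K f) (hN : CB 1 a N) :
    CB 1 (2 * (K * a)) (fun y => f (y + N y) - f y) := by
  have hK := h.nonneg
  have ha := hN.nonneg
  refine CB.of_norm_le (fun y => ?_) fun y => ?_
  · refine (h.lipschitz _ _).trans ?_
    rw [add_sub_cancel_left]
    have := hN.norm_le y
    nlinarith [mul_nonneg hK ha]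
  · have h1 : HasFDerivAt (fun y => y + N y) (ContinuousLinearMap.id ℝ E + _root_.fderiv ℝ N y) y :=
      (hasFDerivAt_id y).add (hN.2.1 y).hasFDerivAt
    refine ⟨_, ((h.2.1 (y + N y)).hasFDerivAt.comp y h1).sub (h.2.1 y).hasFDerivAt, ?_⟩
    rw [ContinuousLinearMap.comp_add, ContinuousLinearMap.comp_id, add_sub_right_comm, two_mul]
    refine (norm_add_le _ _).trans (add_le_add ?_ ?_)
    · refine (h.2.2.lipschitz _ _).trans ?_
      rw [add_sub_cancel_left]
      have := hN.norm_le y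
      gcongr
    · refine (ContinuousLinearMap.opNorm_comp_le _ _).trans ?_
      have := h.2.2.norm_le (y + N y)
      have := hN.2.2 y
      gcongr

/-- First-order Taylor remainders of `f` along a small displacement. -/
theorem CB.comp_id_add_sub_sub {N : E → E} {a : ℝ} (h : CB 3 K f) (hN : CB 1 a N) :
    CB 1 (2 * (K * a ^ 2)) (fun y => f (y + N y) - f y - _root_.fderiv ℝ f y (N y)) := by
  have hK := h.nonneg
  have ha := hN.nonneg
  refine CB.of_norm_le (fun y => ?_) fun y => ?_
  · have h1 := h.of_succ.taylor_one y (y + N y)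
    rw [add_sub_cancel_left] at h1
    refine h1.trans ?_
    have h2 : ‖N y‖ ^ 2 ≤ a ^ 2 := by have := hN.norm_le y; gcongr
    nlinarith [mul_le_mul_of_nonneg_left h2 hK, mul_nonneg hK (sq_nonneg a)]
  · have h1 : HasFDerivAt (fun y => y + N y) (ContinuousLinearMap.id ℝ E + _root_.fderiv ℝ N y) y :=
      (hasFDerivAt_id y).add (hN.2.1 y).hasFDerivAt
    have h2 := (h.2.2.2.1 y).hasFDerivAt.clm_apply (hN.2.1 y).hasFDerivAt
    refine ⟨_, (((h.2.1 (y + N y)).hasFDerivAt.comp y h1).sub (h.2.1 y).hasFDerivAt).sub h2, ?_⟩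
    refine ContinuousLinearMap.opNorm_le_bound _ (by positivity) fun v => ?_
    -- Differentiating y ↦ Df(y)(N y) in direction v produces D²f(y)(v, N y). Symmetry turns this
    -- into D²f(y)(N y, v), which combines with Df(y + N y) - Df(y) to a first-order Taylor
    -- remainder of Df.
    have hsym : _root_.fderiv ℝ (_root_.fderiv ℝ f) y v (N y)
        = _root_.fderiv ℝ (_root_.fderiv ℝ f) y (N y) v :=
      second_derivative_symmetric (fun z => (h.2.1 z).hasFDerivAt) (h.2.2.2.1 y).hasFDerivAt _ _
    have e : ((_root_.fderiv ℝ f (y + N y)).comp (ContinuousLinearMap.id ℝ E + _root_.fderiv ℝ N y)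
        - _root_.fderiv ℝ f y - ((_root_.fderiv ℝ f y).comp (_root_.fderiv ℝ N y)
        + (_root_.fderiv ℝ (_root_.fderiv ℝ f) y).flip (N y))) v
        = (_root_.fderiv ℝ f (y + N y) - _root_.fderiv ℝ f y
          - _root_.fderiv ℝ (_root_.fderiv ℝ f) y (N y)) v
        + (_root_.fderiv ℝ f (y + N y) - _root_.fderiv ℝ f y) (_root_.fderiv ℝ N y v) := by
      simp [hsym]
      abel
    have h3 := h.2.2.taylor_one y (y + N y)
    have h4 := h.2.2.lipschitz (y + N y) y
    rw [add_sub_cancel_left] at h3 h4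
    have h5 := hN.norm_le y
    have h6 := hN.2.2 y
    rw [e]
    calc _ ≤ K * a ^ 2 * ‖v‖ + K * a * (a * ‖v‖) := by
          refine (norm_add_le _ _).trans (add_le_add ?_ ?_)
          · refine (ContinuousLinearMap.le_opNorm _ _).trans ?_
            gcongr
            exact h3.trans (by gcongr)
          · refine (ContinuousLinearMap.le_opNorm _ _).trans ?_
            gcongr
            · exact h4.trans (by gcongr)
            · exact (ContinuousLinearMap.le_opNorm _ _).trans (by gcongr)
      _ = _ := by ring

/-- The four-point estimate. -/
theorem CB.four_point (h : CB 2 K f) (p p' j j' : E) :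
    ‖f (p + j) - f p - (f (p' + j') - f p')‖ ≤ K * ‖j - j'‖ + K * ‖j'‖ * ‖p - p'‖ := by
  have h1 : ‖f (p + j) - f (p + j')‖ ≤ K * ‖j - j'‖ := by
    simpa using h.lipschitz (p + j) (p + j')
  have h2 : ‖(f (p + j') - f p) - (f (p' + j') - f p')‖ ≤ K * ‖j'‖ * ‖p - p'‖ := by
    have hd : ∀ q, HasFDerivAt (fun q => f (q + j') - f q)
        (_root_.fderiv ℝ f (q + j') - _root_.fderiv ℝ f q) q := fun q => by
      have h3 : HasFDerivAt (fun q => f (q + j')) (_root_.fderiv ℝ f (q + j')) q := by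
        have := (h.2.1 (q + j')).hasFDerivAt.comp q ((hasFDerivAt_id q).add_const j')
        simpa [Function.comp_def] using this
      exact h3.sub (h.2.1 q).hasFDerivAt
    refine convex_univ.norm_image_sub_le_of_norm_hasFDerivWithin_le
      (f := fun q => f (q + j') - f q) (fun q _ => (hd q).hasFDerivWithinAt) (fun q _ => ?_)
      (Set.mem_univ p') (Set.mem_univ p)
    simpa using h.2.2.lipschitz (q + j') q
  calc _ = ‖(f (p + j) - f (p + j')) + ((f (p + j') - f p) - (f (p' + j') - f p'))‖ := by
        congr 1; abel
    _ ≤ _ := (norm_add_le _ _).trans (add_le_add h1 h2)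

/-- A leafwise function that vanishes off a compact set in the leaf direction has bounded
derivatives, uniformly over compact transverse sets. -/
theorem LeafC.exists_CB {Z : Type*} [TopologicalSpace Z] {O C : Set Z} {S : Set E}
    {f : E × Z → F} (hf : LeafC k f (Set.univ ×ˢ O)) (hC : IsCompact C) (hCO : C ⊆ O)
    (hS : IsCompact S) (h0 : ∀ y ∉ S, ∀ z ∈ O, f (y, z) = 0) :
    ∃ K, 0 ≤ K ∧ ∀ z ∈ C, CB k K (fun y => f (y, z)) := by
  have hb : ∀ {F : Type} [NormedAddCommGroup F] [NormedSpace ℝ F] {f : E × Z → F},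
      ContinuousOn f (Set.univ ×ˢ O) → (∀ y ∉ S, ∀ z ∈ O, f (y, z) = 0) →
      ∃ K, 0 ≤ K ∧ ∀ z ∈ C, ∀ y, ‖f (y, z)‖ ≤ K := by
    intro F _ _ f hf h0
    obtain ⟨K, hK⟩ := (hS.prod hC).exists_bound_of_continuousOn
      (hf.mono (Set.prod_mono (Set.subset_univ _) hCO))
    refine ⟨max K 0, le_max_right _ _, fun z hz y => ?_⟩
    by_cases hy : y ∈ S
    · exact (hK (y, z) ⟨hy, hz⟩).trans (le_max_left _ _)
    · rw [h0 y hy z (hCO hz), norm_zero]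
      exact le_max_right _ _
  induction k generalizing F with
  | zero => exact hb hf h0
  | succ k ih =>
    obtain ⟨K, hK0, hK⟩ := hb hf.1 h0
    obtain ⟨L, hL0, hL⟩ := ih hf.2.2 fun y hy z hz => by
      have : (fun y => f (y, z)) =ᶠ[𝓝 y] fun _ => 0 :=
        Filter.mem_of_superset (hS.isClosed.isOpen_compl.mem_nhds hy) fun y' hy' => h0 y' hy' z hz
      exact this.fderiv_eq.trans (fderiv_const_apply _)
    refine ⟨max K L, hK0.trans (le_max_left _ _), fun z hz =>
      ⟨fun y => (hK z hz y).trans (le_max_left _ _), fun y =>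
        hf.2.1 (y, z) ⟨Set.mem_univ _, hCO hz⟩, (hL z hz).mono (le_max_right _ _)⟩⟩

end CB

end RoughFoliation

namespace RoughFoliation

/-! ### Rough drivers and the Euler scheme -/

/-- The two levels of a rough path, as functions of pairs of times. -/
structure Driver (d : ℕ) where
  X1 : ℝ → ℝ → Fin d → ℝ
  X2 : ℝ → ℝ → Fin d → Fin d → ℝ

/-- The defining properties of a geometric `α`-Hölder rough path with Hölder constant `R`. -/
structure Driver.IsRough {d : ℕ} (X : Driver d) (α R : ℝ) : Prop where
  chen1 : ∀ s u t, s ≤ u → u ≤ t → ∀ i, X.X1 s t i = X.X1 s u i + X.X1 u t i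
  chen2 : ∀ s u t, s ≤ u → u ≤ t → ∀ i j,
    X.X2 s t i j = X.X2 s u i j + X.X2 u t i j + X.X1 s u i * X.X1 u t j
  bound1 : ∀ s t, s ≤ t → ∀ i, |X.X1 s t i| ≤ R * (t - s) ^ α
  bound2 : ∀ s t, s ≤ t → ∀ i j, |X.X2 s t i j| ≤ R * (t - s) ^ (2 * α)
  geom : ∀ s t, s ≤ t → ∀ i j, X.X2 s t i j + X.X2 s t j i = X.X1 s t i * X.X1 s t j
  cont1 : ∀ i, ContinuousOn (fun q : ℝ × ℝ => X.X1 q.1 q.2 i) {q | q.1 ≤ q.2}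
  cont2 : ∀ i j, ContinuousOn (fun q : ℝ × ℝ => X.X2 q.1 q.2 i j) {q | q.1 ≤ q.2}

theorem rpow_two_mul_eq {h α : ℝ} (hh : 0 ≤ h) : h ^ (2 * α) = (h ^ α) ^ 2 := by
  rw [mul_comm, Real.rpow_mul hh, Real.rpow_two]

theorem rpow_three_mul_eq {h α : ℝ} (hh : 0 ≤ h) : h ^ (3 * α) = (h ^ α) ^ 3 := by
  rw [mul_comm, Real.rpow_mul hh]
  exact_mod_cast Real.rpow_natCast _ 3

/-- Step sizes are chosen through this lemma. As c may vanish, the division is by c + 1. -/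
theorem exists_delta {c ε α : ℝ} (hc : 0 ≤ c) (hε : 0 < ε) (hα : 0 < α) :
    ∃ δ, 0 < δ ∧ δ ≤ 1 ∧ c * δ ^ α ≤ ε := by
  have h1 : (0 : ℝ) < ε / (c + 1) := by positivity
  refine ⟨min 1 ((ε / (c + 1)) ^ α⁻¹), lt_min one_pos (by positivity), min_le_left _ _, ?_⟩
  have h2 : (min 1 ((ε / (c + 1)) ^ α⁻¹)) ^ α ≤ ε / (c + 1) := by
    calc _ ≤ ((ε / (c + 1)) ^ α⁻¹) ^ α :=
          Real.rpow_le_rpow (le_min zero_le_one (by positivity)) (min_le_right _ _) hα.le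
      _ = _ := by rw [← Real.rpow_mul h1.le, inv_mul_cancel₀ hα.ne', Real.rpow_one]
  calc _ ≤ c * (ε / (c + 1)) := by gcongr
    _ = (c / (c + 1)) * ε := by ring
    _ ≤ 1 * ε := by
      gcongr
      rw [div_le_one (by positivity)]
      linarith
    _ = ε := one_mul ε

section Euler

variable {E : Type} [NormedAddCommGroup E] [NormedSpace ℝ E] {d : ℕ}
  {V : Fin d → E → E} {V₀ : E → E} {X : Driver d} {α R K : ℝ}

/-- The increment of one step of the second-order Euler scheme. -/
noncomputable def eulerIncr (V : Fin d → E → E) (V₀ : E → E) (X : Driver d) (s t : ℝ) (y : E) : E :=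
  ∑ i, X.X1 s t i • V i y + ∑ j, ∑ k, X.X2 s t j k • fderiv ℝ (V k) y (V j y) + (t - s) • V₀ y

/-- The part of the Euler increment of order `2α`. -/
noncomputable def eulerIncr₂ (V : Fin d → E → E) (V₀ : E → E) (X : Driver d) (s t : ℝ) (y : E) :
    E :=
  ∑ j, ∑ k, X.X2 s t j k • fderiv ℝ (V k) y (V j y) + (t - s) • V₀ y

theorem eulerIncr_eq (s t : ℝ) (y : E) :
    eulerIncr V V₀ X s t y = ∑ i, X.X1 s t i • V i y + eulerIncr₂ V V₀ X s t y := by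
  rw [eulerIncr, eulerIncr₂, add_assoc]

theorem CB_fderiv_apply (hV : ∀ i, CB 3 K (V i)) (j k : Fin d) :
    CB 2 (4 * K ^ 2) (fun y => fderiv ℝ (V k) y (V j y)) :=
  ((hV k).fderiv.clm_apply (hV j).of_succ).mono (le_of_eq (by ring))

/-- The constant in the bound of the part of order `2α` of the Euler increment. -/
def eulerConst₂ (d : ℕ) (K R : ℝ) : ℝ := d * (d * (R * (4 * K ^ 2))) + K

/-- The constant in the bound of the Euler increment. -/
def eulerConst (d : ℕ) (K R : ℝ) : ℝ := d * (R * K) + eulerConst₂ d K R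

theorem eulerConst₂_nonneg (hK : 0 ≤ K) (hR : 0 ≤ R) : 0 ≤ eulerConst₂ d K R := by
  unfold eulerConst₂; positivity

theorem eulerConst_nonneg (hK : 0 ≤ K) (hR : 0 ≤ R) : 0 ≤ eulerConst d K R := by
  have := eulerConst₂_nonneg (d := d) hK hR
  unfold eulerConst; positivity

/-- The second level is of order h^{2α}. The drift is of order h, and h ≤ h^{2α} because h ≤ 1 and
2α ≤ 1, so it is absorbed into the same order. -/
theorem CB_eulerIncr₂ (hα : 0 < α) (hα' : α ≤ 1 / 2) (hV : ∀ i, CB 3 K (V i)) (hV₀ : CB 3 K V₀)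
    (hX : X.IsRough α R) {s t h : ℝ} (hst : s ≤ t) (hh : t - s ≤ h) (h1 : h ≤ 1) :
    CB 2 (eulerConst₂ d K R * (h ^ α) ^ 2) (eulerIncr₂ V V₀ X s t) := by
  have hK := hV₀.nonneg
  have h0 : 0 ≤ t - s := sub_nonneg.2 hst
  have h0' := h0.trans hh
  have hA := Real.rpow_nonneg h0' α
  by_cases hd : d = 0
  · subst hd
    have h2 := (hV₀.of_succ.const_smul (t - s))
    have e : eulerIncr₂ V V₀ X s t = fun y => (t - s) • V₀ y := by
      funext y; simp [eulerIncr₂]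
    rw [e]
    refine h2.mono ?_
    rw [abs_of_nonneg h0, eulerConst₂, ← rpow_two_mul_eq h0']
    have : t - s ≤ h ^ (2 * α) := hh.trans (by
      simpa using Real.rpow_le_rpow_of_exponent_ge_of_imp h0' h1 (by linarith : 2 * α ≤ 1)
        (by intro _ h; linarith))
    simp only [CharP.cast_eq_zero, zero_mul, zero_add]
    rw [mul_comm]
    gcongr
  · have hd' : (0 : ℕ) < d := Nat.pos_of_ne_zero hd
    have hA2 : t - s ≤ h ^ (2 * α) := hh.trans (by
      simpa using Real.rpow_le_rpow_of_exponent_ge_of_imp h0' h1 (by linarith : 2 * α ≤ 1)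
        (by intro _ h; linarith))
    have hb : ∀ i j, |X.X2 s t i j| ≤ R * h ^ (2 * α) := fun i j => by
      have hR : 0 ≤ R * (t - s) ^ (2 * α) := (abs_nonneg _).trans (hX.bound2 s t hst i j)
      have hR' : 0 ≤ R := by
        have := (abs_nonneg _).trans (hX.bound2 0 1 zero_le_one i j)
        simpa using this
      refine (hX.bound2 s t hst i j).trans ?_
      have : 0 ≤ 2 * α := by linarith
      gcongr
    have h2 : CB 2 (∑ _j : Fin d, ∑ _k : Fin d, R * h ^ (2 * α) * (4 * K ^ 2)) fun y =>
        ∑ j, ∑ k, X.X2 s t j k • fderiv ℝ (V k) y (V j y) :=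
      CB.sum _ fun j _ => CB.sum _ fun k _ => ((CB_fderiv_apply hV j k).const_smul _).mono (by
        have := hb j k
        gcongr)
    refine (h2.add (hV₀.of_succ.const_smul (t - s))).mono ?_
    rw [abs_of_nonneg h0, eulerConst₂, ← rpow_two_mul_eq h0']
    simp only [Finset.sum_const, Finset.card_univ, Fintype.card_fin, nsmul_eq_mul]
    nlinarith [mul_le_mul_of_nonneg_left hA2 hK]

theorem Driver.IsRough.abs_X1_le (hα : 0 < α) (hX : X.IsRough α R) {s t h : ℝ} (hst : s ≤ t)
    (hh : t - s ≤ h) (i : Fin d) : |X.X1 s t i| ≤ R * h ^ α := by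
  have h0 : 0 ≤ t - s := sub_nonneg.2 hst
  have hR' : 0 ≤ R := by
    have := (abs_nonneg _).trans (hX.bound1 0 1 zero_le_one i)
    simpa using this
  refine (hX.bound1 s t hst i).trans ?_
  gcongr

theorem Driver.IsRough.abs_X2_le (hα : 0 < α) (hX : X.IsRough α R) {s t h : ℝ} (hst : s ≤ t)
    (hh : t - s ≤ h) (i j : Fin d) : |X.X2 s t i j| ≤ R * (h ^ α) ^ 2 := by
  have h0 : 0 ≤ t - s := sub_nonneg.2 hst
  have hR' : 0 ≤ R := by
    have := (abs_nonneg _).trans (hX.bound2 0 1 zero_le_one i j)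
    simpa using this
  rw [← rpow_two_mul_eq (h0.trans hh)]
  refine (hX.bound2 s t hst i j).trans ?_
  gcongr

theorem CB_eulerIncr (hα : 0 < α) (hα' : α ≤ 1 / 2) (hV : ∀ i, CB 3 K (V i)) (hV₀ : CB 3 K V₀)
    (hR : 0 ≤ R) (hX : X.IsRough α R) {s t h : ℝ} (hst : s ≤ t) (hh : t - s ≤ h) (h1 : h ≤ 1) :
    CB 2 (eulerConst d K R * h ^ α) (eulerIncr V V₀ X s t) := by
  have hK := hV₀.nonneg
  have h0 : 0 ≤ h := (sub_nonneg.2 hst).trans hh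
  have hA := Real.rpow_nonneg h0 α
  have hA1 : h ^ α ≤ 1 := Real.rpow_le_one h0 h1 hα.le
  have e : eulerIncr V V₀ X s t = fun y => ∑ i, X.X1 s t i • V i y + eulerIncr₂ V V₀ X s t y :=
    funext fun y => eulerIncr_eq s t y
  have h2 : CB 2 (∑ _j : Fin d, R * h ^ α * K) fun y => ∑ i, X.X1 s t i • V i y :=
    CB.sum _ fun i _ => ((hV i).of_succ.const_smul _).mono (by
      have := hX.abs_X1_le hα hst hh i
      gcongr)
  rw [e]
  refine (h2.add (CB_eulerIncr₂ hα hα' hV hV₀ hX hst hh h1)).mono ?_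
  simp only [Finset.sum_const, Finset.card_univ, Fintype.card_fin, nsmul_eq_mul, eulerConst]
  have := eulerConst₂_nonneg (d := d) hK hR
  have : eulerConst₂ d K R * (h ^ α) ^ 2 ≤ eulerConst₂ d K R * h ^ α := by
    gcongr
    nlinarith
  linarith

/-- The Euler defect, in terms of Taylor remainders. -/
theorem eulerIncr_chen (hX : X.IsRough α R) {s u t : ℝ} (hsu : s ≤ u) (hut : u ≤ t) (y : E) :
    eulerIncr V V₀ X u t (y + eulerIncr V V₀ X s u y) + eulerIncr V V₀ X s u y
      - eulerIncr V V₀ X s t y =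
    ∑ k, X.X1 u t k • (V k (y + eulerIncr V V₀ X s u y) - V k y
        - fderiv ℝ (V k) y (eulerIncr V V₀ X s u y))
      + ∑ k, X.X1 u t k • fderiv ℝ (V k) y (eulerIncr₂ V V₀ X s u y)
      + ∑ j, ∑ k, X.X2 u t j k • (fderiv ℝ (V k) (y + eulerIncr V V₀ X s u y)
          (V j (y + eulerIncr V V₀ X s u y)) - fderiv ℝ (V k) y (V j y))
      + (t - u) • (V₀ (y + eulerIncr V V₀ X s u y) - V₀ y) := by
  have e1 : ∀ k, fderiv ℝ (V k) y (eulerIncr V V₀ X s u y)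
      = ∑ j, X.X1 s u j • fderiv ℝ (V k) y (V j y)
        + fderiv ℝ (V k) y (eulerIncr₂ V V₀ X s u y) := fun k => by
    rw [eulerIncr_eq, map_add, map_sum]
    simp only [map_smul]
  simp only [e1]
  have e2 : eulerIncr V V₀ X s u y = ∑ i, X.X1 s u i • V i y
      + ∑ j, ∑ k, X.X2 s u j k • fderiv ℝ (V k) y (V j y) + (u - s) • V₀ y := rfl
  have e3 : eulerIncr V V₀ X s t y = (∑ i, X.X1 s u i • V i y + ∑ i, X.X1 u t i • V i y)
      + (∑ j, ∑ k, X.X2 s u j k • fderiv ℝ (V k) y (V j y)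
        + ∑ j, ∑ k, X.X2 u t j k • fderiv ℝ (V k) y (V j y)
        + ∑ k, X.X1 u t k • ∑ j, X.X1 s u j • fderiv ℝ (V k) y (V j y)) + (t - s) • V₀ y := by
    -- The cross term in Chen's relation for the second level is exactly the first-order Taylor term
    -- of the fields V_k along the first-level part of the first step. This cancellation raises the
    -- order of the defect from 2α to 3α.
    have e4 : ∑ k, X.X1 u t k • ∑ j, X.X1 s u j • fderiv ℝ (V k) y (V j y)
        = ∑ j, ∑ k, (X.X1 s u j * X.X1 u t k) • fderiv ℝ (V k) y (V j y) := by
      rw [Finset.sum_comm]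
      refine Finset.sum_congr rfl fun k _ => ?_
      rw [Finset.smul_sum]
      exact Finset.sum_congr rfl fun j _ => by rw [smul_smul, mul_comm]
    rw [e4, eulerIncr]
    simp only [hX.chen1 s u t hsu hut, hX.chen2 s u t hsu hut, add_smul, Finset.sum_add_distrib]
  generalize hz : y + eulerIncr V V₀ X s u y = z
  rw [e3, e2, eulerIncr]
  simp only [smul_sub, smul_add, Finset.sum_add_distrib, Finset.sum_sub_distrib, sub_smul]
  abel

/-- The Euler scheme is an approximate flow. -/
theorem exists_CB_euler_defect (hα : 0 < α) (hα' : α ≤ 1 / 2) (hK : 0 ≤ K) (hR : 0 ≤ R) (d : ℕ) :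
    ∃ c, 0 ≤ c ∧ ∀ {E : Type} [NormedAddCommGroup E] [NormedSpace ℝ E] {V : Fin d → E → E}
      {V₀ : E → E} {X : Driver d} (_ : ∀ i, CB 3 K (V i)) (_ : CB 3 K V₀) (_ : X.IsRough α R)
      {s u t h : ℝ} (_ : s ≤ u) (_ : u ≤ t) (_ : t - s ≤ h) (_ : h ≤ 1),
      CB 1 (c * (h ^ α) ^ 3) (fun y => eulerIncr V V₀ X u t (y + eulerIncr V V₀ X s u y)
        + eulerIncr V V₀ X s u y - eulerIncr V V₀ X s t y) := by
  set c₁ := eulerConst d K R with hc₁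
  set c₂ := eulerConst₂ d K R with hc₂
  have h1 : 0 ≤ c₁ := eulerConst_nonneg hK hR
  have h2 : 0 ≤ c₂ := eulerConst₂_nonneg hK hR
  refine ⟨d * (R * (2 * (K * c₁ ^ 2))) + d * (R * (2 * (K * c₂)))
    + d * (d * (R * (2 * (4 * K ^ 2 * c₁)))) + 2 * (K * c₁), by positivity, ?_⟩
  intro E _ _ V V₀ X hV hV₀ hX s u t h hsu hut hh hh1
  have h0 : 0 ≤ h := (sub_nonneg.2 (hsu.trans hut)).trans hh
  have hsu' : u - s ≤ h := by linarith
  have hut' : t - u ≤ h := by linarith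
  have hA := Real.rpow_nonneg h0 α
  set A := h ^ α with hAdef
  have hN : CB 1 (c₁ * A) (eulerIncr V V₀ X s u) :=
    (CB_eulerIncr hα hα' hV hV₀ hR hX hsu hsu' hh1).of_succ
  have hP : CB 1 (c₂ * A ^ 2) (eulerIncr₂ V V₀ X s u) :=
    (CB_eulerIncr₂ hα hα' hV hV₀ hX hsu hsu' hh1).of_succ
  have hA2 : |t - u| ≤ A ^ 2 := by
    rw [abs_of_nonneg (sub_nonneg.2 hut), ← rpow_two_mul_eq h0]
    refine hut'.trans ?_
    simpa using Real.rpow_le_rpow_of_exponent_ge_of_imp h0 hh1 (by linarith : 2 * α ≤ 1)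
        (by intro _ h; linarith)
  -- The four groups of terms are each of order A³, where A = h^α: a first level (A) times a Taylor
  -- remainder (A²), a first level times the 2α-part of the step (A²), a second level (A²) times an
  -- increment (A), and the drift (A²) times an increment (A). The bounds hold in `CB 1`, so the
  -- Lipschitz constant of the defect, needed for uniqueness, is of the same order.
  have T1 : CB 1 (∑ _k : Fin d, R * A * (2 * (K * (c₁ * A) ^ 2))) fun y =>
      ∑ k, X.X1 u t k • (V k (y + eulerIncr V V₀ X s u y) - V k y
        - fderiv ℝ (V k) y (eulerIncr V V₀ X s u y)) :=
    CB.sum _ fun k _ => (((hV k).comp_id_add_sub_sub hN).const_smul _).mono (by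
      have := hX.abs_X1_le hα hut hut' k
      gcongr)
  have T2 : CB 1 (∑ _k : Fin d, R * A * (2 ^ 1 * (K * (c₂ * A ^ 2)))) fun y =>
      ∑ k, X.X1 u t k • fderiv ℝ (V k) y (eulerIncr₂ V V₀ X s u y) :=
    CB.sum _ fun k _ => (((hV k).fderiv.of_succ.clm_apply hP).const_smul _).mono (by
      have := hX.abs_X1_le hα hut hut' k
      gcongr)
  have T3 : CB 1 (∑ _j : Fin d, ∑ _k : Fin d, R * A ^ 2 * (2 * (4 * K ^ 2 * (c₁ * A)))) fun y =>
      ∑ j, ∑ k, X.X2 u t j k • (fderiv ℝ (V k) (y + eulerIncr V V₀ X s u y)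
          (V j (y + eulerIncr V V₀ X s u y)) - fderiv ℝ (V k) y (V j y)) :=
    CB.sum _ fun j _ => CB.sum _ fun k _ =>
      (((CB_fderiv_apply hV j k).comp_id_add_sub hN).const_smul _).mono (by
        have := hX.abs_X2_le hα hut hut' j k
        gcongr)
  have T4 := ((hV₀.of_succ.comp_id_add_sub hN).const_smul (t - u)).mono
    (mul_le_mul_of_nonneg_right hA2 (by positivity))
  have e := funext fun y => eulerIncr_chen (V := V) (V₀ := V₀) hX hsu hut y
  rw [e]
  refine (((T1.add T2).add T3).add T4).mono (le_of_eq ?_)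
  simp only [Finset.sum_const, Finset.card_univ, Fintype.card_fin, nsmul_eq_mul]
  ring

/-- The gain of the sewing argument: for an exponent above 1, cutting an interval into two pieces
that are both at most the fraction θ of it contracts the sum of powers by θ^(a - 1). -/
theorem rpow_add_rpow_le_of_le {a x y S θ : ℝ} (ha : 1 < a) (hx : 0 ≤ x) (hy : 0 ≤ y)
    (hS : x + y = S) (hθ : 0 ≤ θ) (hxS : x ≤ θ * S) (hyS : y ≤ θ * S) :
    x ^ a + y ^ a ≤ θ ^ (a - 1) * S ^ a := by
  have hS0 : 0 ≤ S := hS ▸ add_nonneg hx hy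
  have key : ∀ {z}, 0 ≤ z → z ≤ θ * S → z ^ a ≤ z * (θ ^ (a - 1) * S ^ (a - 1)) := by
    intro z hz hzS
    have : z ^ a = z * z ^ (a - 1) := by
      have h := Real.rpow_add_of_nonneg hz zero_le_one (sub_nonneg.2 ha.le)
      rwa [Real.rpow_one, add_sub_cancel] at h
    rw [this, ← Real.mul_rpow hθ hS0]
    have := Real.rpow_le_rpow hz hzS (sub_nonneg.2 ha.le)
    gcongr
  have hSa : S ^ a = S * S ^ (a - 1) := by
    have h := Real.rpow_add_of_nonneg hS0 zero_le_one (sub_nonneg.2 ha.le)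
    rwa [Real.rpow_one, add_sub_cancel] at h
  calc _ ≤ x * (θ ^ (a - 1) * S ^ (a - 1)) + y * (θ ^ (a - 1) * S ^ (a - 1)) :=
        add_le_add (key hx hxS) (key hy hyS)
    _ = θ ^ (a - 1) * ((x + y) * S ^ (a - 1)) := by ring
    _ = _ := by rw [hS, ← hSa]

/-- Propagation of the Euler defect of a path over two adjacent intervals. -/
theorem norm_defect_le {N₁ N₂ N₃ : E → E} {κ c : ℝ} (h2 : CB 1 κ N₂)
    (hc : ∀ y, ‖N₂ (y + N₁ y) + N₁ y - N₃ y‖ ≤ c) (ys yu yt : E) :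
    ‖yt - ys - N₃ ys‖ ≤ ‖yt - yu - N₂ yu‖ + (1 + κ) * ‖yu - ys - N₁ ys‖ + c := by
  have e : yt - ys - N₃ ys = (yt - yu - N₂ yu) + (yu - ys - N₁ ys)
      + (N₂ yu - N₂ (ys + N₁ ys)) + (N₂ (ys + N₁ ys) + N₁ ys - N₃ ys) := by abel
  have h3 := h2.lipschitz yu (ys + N₁ ys)
  rw [← sub_sub] at h3
  rw [e]
  refine (norm_add_le _ _).trans ?_
  have h4 := norm_add₃_le (a := yt - yu - N₂ yu) (b := yu - ys - N₁ ys)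
    (c := N₂ yu - N₂ (ys + N₁ ys))
  have h5 := hc ys
  linarith

end Euler

end RoughFoliation

/-! ### Uniform estimates for the Euler scheme and existence in Euclidean space -/

namespace RoughFoliation

/-- A non-principal ultrafilter on ℕ. Along it the Euler schemes converge at uncountably many times
simultaneously, without extraction of subsequences or equicontinuity. -/
theorem exists_filter_forall_compact (X : Type*) [TopologicalSpace X] :
    ∃ 𝒰 : Filter ℕ, 𝒰.NeBot ∧ 𝒰 ≤ atTop ∧ ∀ (u : ℕ → X) (S : Set X), IsCompact S →
      (∀ n, u n ∈ S) → ∃ z, Tendsto u 𝒰 (𝓝 z) := by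
  refine ⟨(hyperfilter ℕ : Ultrafilter ℕ), inferInstance, ?_, fun u S hS hu => ?_⟩
  · rw [← Nat.cofinite_eq_atTop]
    exact hyperfilter_le_cofinite
  · obtain ⟨z, -, hz⟩ := hS.ultrafilter_le_nhds' ((hyperfilter ℕ).map u)
      (Filter.mem_map.2 (Filter.univ_mem' hu))
    exact ⟨z, hz⟩

section EulerLimit

variable {E : Type} [NormedAddCommGroup E] [NormedSpace ℝ E] {d : ℕ}
  {V : Fin d → E → E} {V₀ : E → E} {X : Driver d} {α R K : ℝ}

theorem eulerIncr_self (hα : 0 < α) (hX : X.IsRough α R) (s : ℝ) (y : E) :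
    eulerIncr V V₀ X s s y = 0 := by
  have h1 : ∀ i, X.X1 s s i = 0 := fun i => by
    have := hX.bound1 s s le_rfl i
    rw [sub_self, Real.zero_rpow hα.ne', mul_zero] at this
    exact abs_nonpos_iff.1 this
  have h2 : ∀ i j, X.X2 s s i j = 0 := fun i j => by
    have := hX.bound2 s s le_rfl i j
    rw [sub_self, Real.zero_rpow (by positivity), mul_zero] at this
    exact abs_nonpos_iff.1 this
  simp [eulerIncr, h1, h2]

/-- The Euler scheme along the time grid `τ`. -/
noncomputable def eulerScheme (V : Fin d → E → E) (V₀ : E → E) (X : Driver d) (τ : ℕ → ℝ)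
    (y₀ : E) : ℕ → E
  | 0 => y₀
  | i + 1 => eulerScheme V V₀ X τ y₀ i
      + eulerIncr V V₀ X (τ i) (τ (i + 1)) (eulerScheme V V₀ X τ y₀ i)

/-- The Euler scheme on a uniform grid satisfies the Davie estimate, uniformly in the mesh. -/
theorem exists_eulerScheme_bound (hα : 1 / 3 < α) (hα' : α ≤ 1 / 2) (hK : 0 ≤ K) (hR : 0 ≤ R)
    (d : ℕ) : ∃ δ L, 0 < δ ∧ δ ≤ 1 ∧ 0 ≤ L ∧ ∀ {E : Type} [NormedAddCommGroup E] [NormedSpace ℝ E]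
      {V : Fin d → E → E} {V₀ : E → E} {X : Driver d} (_ : ∀ i, CB 3 K (V i)) (_ : CB 3 K V₀)
      (_ : X.IsRough α R) (a h : ℝ) (_ : 0 ≤ h) (y₀ : E) (i k : ℕ) (_ : k * h ≤ δ),
      ‖eulerScheme V V₀ X (fun i => a + i * h) y₀ (i + k)
        - eulerScheme V V₀ X (fun i => a + i * h) y₀ i
        - eulerIncr V V₀ X (a + i * h) (a + (i + k : ℕ) * h)
          (eulerScheme V V₀ X (fun i => a + i * h) y₀ i)‖ ≤ L * (k * h) ^ (3 * α) := by
  have hα0 : 0 < α := by linarith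
  obtain ⟨c, hc0, hc⟩ := exists_CB_euler_defect hα0 hα' hK hR d
  -- The factor 2/3 comes from splitting k steps into two nearly equal blocks, each of at most 2k/3
  -- steps once k ≥ 2. The number θ is the resulting contraction, below 1 because 3α > 1.
  set θ : ℝ := (2 / 3) ^ (3 * α - 1) with hθ
  have hθ0 : 0 ≤ θ := by positivity
  have hθ1 : θ < 1 := Real.rpow_lt_one (by norm_num) (by norm_num) (by linarith)
  have hC := eulerConst_nonneg (d := d) hK hR
  obtain ⟨δ, hδ0, hδ1, hδ⟩ := exists_delta hC (by linarith : 0 < (1 - θ) / 2) hα0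
  have hL0 : 0 ≤ 2 * c / (1 - θ) := div_nonneg (by positivity) (by linarith)
  -- With Lipschitz constant at most (1 - θ)/2 for one Euler increment, merging two blocks
  -- multiplies the old constant by at most (1 + θ)/2 and adds c. The constant L = 2c/(1 - θ) is the
  -- fixed point of L ↦ L(1 + θ)/2 + c, so the induction closes.
  refine ⟨δ, 2 * c / (1 - θ), hδ0, hδ1, hL0, ?_⟩
  intro E _ _ V V₀ X hV hV₀ hX a h hh y₀ i k
  set Y := eulerScheme V V₀ X (fun i => a + i * h) y₀ with hY
  induction k using Nat.strong_induction_on generalizing i with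
  | _ k ih =>
    intro hk
    rcases Nat.lt_or_ge k 2 with hk2 | hk2
    -- Zero steps or a single step of the scheme have no defect.
    · have : ∀ x : E, x = 0 → ‖x‖ ≤ 2 * c / (1 - θ) * (k * h) ^ (3 * α) := by
        rintro x rfl
        rw [norm_zero]
        positivity
      apply this
      interval_cases k
      · rw [add_zero, eulerIncr_self hα0 hX]
        simp
      · have : Y (i + 1) = Y i + eulerIncr V V₀ X (a + i * h) (a + (i + 1 : ℕ) * h) (Y i) := rfl
        rw [this]
        abel
    · have hk1 : k / 2 < k := Nat.div_lt_self (by omega) one_lt_two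
      have hk3 : k - k / 2 < k := by omega
      have hsum : k / 2 + (k - k / 2) = k := by omega
      have hsumR : ((k / 2 : ℕ) : ℝ) + ((k - k / 2 : ℕ) : ℝ) = k := by exact_mod_cast hsum
      have hb1 : ((k / 2 : ℕ) : ℝ) ≤ 2 / 3 * k := by
        have : 3 * (k / 2) ≤ 2 * k := by omega
        have : (3 : ℝ) * (k / 2 : ℕ) ≤ 2 * k := by exact_mod_cast this
        linarith
      have hb2 : ((k - k / 2 : ℕ) : ℝ) ≤ 2 / 3 * k := by
        have : 3 * (k - k / 2) ≤ 2 * k := by omega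
        have : (3 : ℝ) * (k - k / 2 : ℕ) ≤ 2 * k := by exact_mod_cast this
        linarith
      set k₁ := k / 2
      set k₂ := k - k / 2
      have hk1h : (k₁ : ℝ) * h ≤ δ := le_trans (by gcongr) hk
      have hk2h : (k₂ : ℝ) * h ≤ δ := le_trans (by gcongr) hk
      have i1 := ih k₁ hk1 i hk1h
      have i2 := ih k₂ hk3 (i + k₁) hk2h
      rw [add_assoc, hsum] at i2
      have hkh : (k : ℝ) * h ≤ 1 := hk.trans hδ1
      have ht1 : a + (i : ℝ) * h ≤ a + ((i + k₁ : ℕ) : ℝ) * h := by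
        push_cast; nlinarith [mul_nonneg (Nat.cast_nonneg (α := ℝ) k₁) hh]
      have ht2 : a + ((i + k₁ : ℕ) : ℝ) * h ≤ a + ((i + k : ℕ) : ℝ) * h := by
        have : ((i + k₁ : ℕ) : ℝ) ≤ ((i + k : ℕ) : ℝ) := by
          exact_mod_cast Nat.add_le_add_left hk1.le i
        gcongr
      have hd3 : a + ((i + k : ℕ) : ℝ) * h - (a + (i : ℝ) * h) ≤ k * h := by
        push_cast; linarith
      have hN2 : CB 1 ((1 - θ) / 2) (eulerIncr V V₀ X (a + ((i + k₁ : ℕ) : ℝ) * h)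
          (a + ((i + k : ℕ) : ℝ) * h)) := by
        refine ((CB_eulerIncr hα0 hα' hV hV₀ hR hX ht2 (h := k * h) (by linarith) hkh).of_succ).mono
          (le_trans ?_ hδ)
        gcongr
      have hdef := fun y => (hc hV hV₀ hX ht1 ht2 hd3 hkh).norm_le y
      have key := norm_defect_le hN2 hdef (Y i) (Y (i + k₁)) (Y (i + k))
      refine key.trans ?_
      have hp := rpow_add_rpow_le_of_le (a := 3 * α) (θ := 2 / 3) (by linarith)
        (by positivity : 0 ≤ (k₁ : ℝ) * h) (by positivity : 0 ≤ (k₂ : ℝ) * h)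
        (by rw [← add_mul, hsumR]) (by norm_num) (by nlinarith) (by nlinarith)
      rw [← rpow_three_mul_eq (by positivity), ← hθ] at *
      set P := ((k : ℝ) * h) ^ (3 * α)
      have hP : 0 ≤ P := by positivity
      have hP1 : 0 ≤ ((k₁ : ℝ) * h) ^ (3 * α) := by positivity
      have hP2 : 0 ≤ ((k₂ : ℝ) * h) ^ (3 * α) := by positivity
      set L := 2 * c / (1 - θ) with hL
      have hcL : c = L * ((1 - θ) / 2) := by
        rw [hL]
        have : (1 - θ) ≠ 0 := by linarith
        field_simp
      have hfac : (1 + (1 - θ) / 2) * θ ≤ (1 + θ) / 2 := by nlinarith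
      calc _ ≤ (1 + (1 - θ) / 2) * (L * ((k₂ : ℝ) * h) ^ (3 * α))
            + (1 + (1 - θ) / 2) * (L * ((k₁ : ℝ) * h) ^ (3 * α)) + c * P := by
            have h1 : ‖Y (i + k) - Y (i + k₁) - eulerIncr V V₀ X (a + ((i + k₁ : ℕ) : ℝ) * h)
                (a + ((i + k : ℕ) : ℝ) * h) (Y (i + k₁))‖
                ≤ (1 + (1 - θ) / 2) * (L * ((k₂ : ℝ) * h) ^ (3 * α)) := by
              refine i2.trans (le_mul_of_one_le_left (by positivity) (by linarith))
            have h2 : 0 ≤ 1 + (1 - θ) / 2 := by linarith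
            gcongr
        _ = (1 + (1 - θ) / 2) * L * (((k₁ : ℝ) * h) ^ (3 * α) + ((k₂ : ℝ) * h) ^ (3 * α))
            + c * P := by ring
        _ ≤ (1 + (1 - θ) / 2) * L * (θ * P) + c * P := by
            have h2 : 0 ≤ 1 + (1 - θ) / 2 := by linarith
            gcongr
        _ = ((1 + (1 - θ) / 2) * θ) * (L * P) + c * P := by ring
        _ ≤ (1 + θ) / 2 * (L * P) + c * P := by gcongr
        _ = L * P := by rw [hcL]; ring

theorem continuousOn_eulerIncr [FiniteDimensional ℝ E] (hV : ∀ i, CB 3 K (V i)) (hV₀ : CB 3 K V₀)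
    (hX : X.IsRough α R) :
    ContinuousOn (fun q : (ℝ × ℝ) × E => eulerIncr V V₀ X q.1.1 q.1.2 q.2)
      ({q | q.1 ≤ q.2} ×ˢ Set.univ) := by
  have h1 : ∀ i, ContinuousOn (fun q : (ℝ × ℝ) × E => X.X1 q.1.1 q.1.2 i)
      ({q | q.1 ≤ q.2} ×ˢ Set.univ) := fun i =>
    (hX.cont1 i).comp continuous_fst.continuousOn fun q hq => hq.1
  have h2 : ∀ i j, ContinuousOn (fun q : (ℝ × ℝ) × E => X.X2 q.1.1 q.1.2 i j)
      ({q | q.1 ≤ q.2} ×ˢ Set.univ) := fun i j =>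
    (hX.cont2 i j).comp continuous_fst.continuousOn fun q hq => hq.1
  have h3 : ∀ i, Continuous (V i) := fun i => (hV i).differentiable.continuous
  have h4 : Continuous V₀ := hV₀.differentiable.continuous
  have h5 : ∀ i j, Continuous fun y => fderiv ℝ (V i) y (V j y) := fun i j =>
    (CB_fderiv_apply hV j i).differentiable.continuous
  unfold eulerIncr
  refine ((continuousOn_finsetSum _ fun i _ => (h1 i).smul
    ((h3 i).comp continuous_snd).continuousOn).add (continuousOn_finsetSum _ fun i _ =>
    continuousOn_finsetSum _ fun j _ => (h2 i j).smul
      ((h5 j i).comp continuous_snd).continuousOn)).add ?_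
  exact (Continuous.smul (by fun_prop) (h4.comp continuous_snd)).continuousOn

theorem tendsto_eulerIncr [FiniteDimensional ℝ E] (hV : ∀ i, CB 3 K (V i)) (hV₀ : CB 3 K V₀)
    (hX : X.IsRough α R) {𝒰 : Filter ℕ} {σ τ : ℕ → ℝ} {u : ℕ → E} {s t : ℝ} {y : E}
    (hσ : Tendsto σ 𝒰 (𝓝 s)) (hτ : Tendsto τ 𝒰 (𝓝 t)) (hu : Tendsto u 𝒰 (𝓝 y)) (hst : s ≤ t)
    (hle : ∀ n, σ n ≤ τ n) : Tendsto (fun n => eulerIncr V V₀ X (σ n) (τ n) (u n)) 𝒰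
      (𝓝 (eulerIncr V V₀ X s t y)) := by
  have hm : ∀ {s t : ℝ} {y : E}, s ≤ t →
      ((s, t), y) ∈ ({q : ℝ × ℝ | q.1 ≤ q.2} ×ˢ Set.univ : Set ((ℝ × ℝ) × E)) := fun h => by
    simpa using h
  have hc := (continuousOn_eulerIncr hV hV₀ hX).continuousWithinAt (hm (y := y) hst)
  have hq : Tendsto (fun n => ((σ n, τ n), u n)) 𝒰
      (𝓝[({q : ℝ × ℝ | q.1 ≤ q.2} ×ˢ Set.univ : Set ((ℝ × ℝ) × E))] ((s, t), y)) :=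
    tendsto_nhdsWithin_iff.2 ⟨(hσ.prodMk_nhds hτ).prodMk_nhds hu,
      Filter.Eventually.of_forall fun n => hm (hle n)⟩
  have := hc.tendsto.comp hq
  simpa only [Function.comp_def] using this

set_option maxHeartbeats 400000 in
/-- Local existence for rough differential equations with bounded coefficients. -/
theorem exists_davie_solution (hα : 1 / 3 < α) (hα' : α ≤ 1 / 2) (hK : 0 ≤ K) (hR : 0 ≤ R)
    (d : ℕ) : ∃ δ L, 0 < δ ∧ δ ≤ 1 ∧ 0 ≤ L ∧ ∀ {E : Type} [NormedAddCommGroup E] [NormedSpace ℝ E]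
      [FiniteDimensional ℝ E]
      {V : Fin d → E → E} {V₀ : E → E} {X : Driver d} (_ : ∀ i, CB 3 K (V i)) (_ : CB 3 K V₀)
      (_ : X.IsRough α R) (a : ℝ) (y₀ : E), ∃ y : ℝ → E, y a = y₀ ∧
      ∀ s t, a ≤ s → s ≤ t → t ≤ a + δ →
        ‖y t - y s - eulerIncr V V₀ X s t (y s)‖ ≤ L * (t - s) ^ (3 * α) := by
  have hα0 : 0 < α := by linarith
  obtain ⟨δ, L, hδ0, hδ1, hL0, H⟩ := exists_eulerScheme_bound hα hα' hK hR d
  refine ⟨δ, L, hδ0, hδ1, hL0, ?_⟩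
  intro E _ _ _ V V₀ X hV hV₀ hX a y₀
  set h : ℕ → ℝ := fun n => δ / (n + 1) with hh
  have hhpos : ∀ n, 0 < h n := fun n => by simp only [hh]; positivity
  have hh0 : Tendsto h atTop (𝓝 0) := by
    have := (tendsto_one_div_add_atTop_nhds_zero_nat (𝕜 := ℝ)).const_mul δ
    rw [mul_zero] at this
    exact this.congr fun n => by simp only [hh]; ring
  set Y : ℕ → ℕ → E := fun n => eulerScheme V V₀ X (fun i => a + i * h n) y₀ with hY
  -- The index of the last grid point before t. Truncating t at a + δ keeps every index in the range
  -- where the uniform estimate applies.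
  set I : ℕ → ℝ → ℕ := fun n t => ⌊(min t (a + δ) - a) / h n⌋₊ with hI
  have hIle : ∀ n t, I n t * h n ≤ δ := by
    intro n t
    by_cases ht : a ≤ min t (a + δ)
    · have : (I n t : ℝ) ≤ (min t (a + δ) - a) / h n :=
        Nat.floor_le (div_nonneg (by linarith) (hhpos n).le)
      rw [le_div_iff₀ (hhpos n)] at this
      have := min_le_right t (a + δ)
      linarith
    · have : I n t = 0 := Nat.floor_of_nonpos (div_nonpos_of_nonpos_of_nonneg (by linarith)
        (hhpos n).le)
      rw [this]
      simpa using hδ0.le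
  have hbd : ∀ n t, Y n (I n t) ∈ Metric.closedBall y₀ (L + eulerConst d K R) := by
    intro n t
    have h1 := H hV hV₀ hX a (h n) (hhpos n).le y₀ 0 (I n t) (hIle n t)
    rw [zero_add] at h1
    have h2 := (CB_eulerIncr hα0 hα' hV hV₀ hR hX (s := a + (0 : ℕ) * h n)
      (t := a + (I n t : ℝ) * h n) (h := 1) (by
        have := hhpos n; push_cast; nlinarith [mul_nonneg (Nat.cast_nonneg (α := ℝ) (I n t)) this.le])
      (by have := hIle n t; push_cast; linarith) le_rfl).norm_le y₀
    rw [Real.one_rpow, mul_one] at h2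
    have h3 : ((I n t : ℝ) * h n) ^ (3 * α) ≤ 1 :=
      Real.rpow_le_one (by have := hhpos n; positivity) ((hIle n t).trans hδ1) (by positivity)
    rw [Metric.mem_closedBall, dist_eq_norm]
    calc _ = ‖(Y n (I n t) - Y n 0 - eulerIncr V V₀ X (a + (0 : ℕ) * h n)
              (a + (I n t : ℝ) * h n) (Y n 0)) + eulerIncr V V₀ X (a + (0 : ℕ) * h n)
              (a + (I n t : ℝ) * h n) y₀‖ := by
            rw [show Y n 0 = y₀ from rfl, sub_add_cancel]
      _ ≤ L * ((I n t : ℝ) * h n) ^ (3 * α) + eulerConst d K R :=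
            (norm_add_le _ _).trans (add_le_add h1 h2)
      _ ≤ L * 1 + eulerConst d K R := by gcongr
      _ = _ := by rw [mul_one]
  have : ProperSpace E := FiniteDimensional.proper ℝ E
  -- The schemes stay in a fixed closed ball, which is compact in finite dimension, so their values
  -- at every time converge along the ultrafilter. The estimate, uniform in the mesh, survives in
  -- the limit because the rounded times converge and the Euler increment is continuous.
  obtain ⟨𝒰, h𝒰, hle, hcpt⟩ := exists_filter_forall_compact E
  have hlim : ∀ t, ∃ z, Tendsto (fun n => Y n (I n t)) 𝒰 (𝓝 z) := fun t =>
    hcpt _ _ (isCompact_closedBall y₀ (L + eulerConst d K R)) fun n => hbd n t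
  choose y hy using hlim
  have htime : ∀ t, a ≤ t → t ≤ a + δ →
      Tendsto (fun n => a + (I n t : ℝ) * h n) 𝒰 (𝓝 t) := by
    intro t hat hta
    refine Tendsto.mono_left ?_ hle
    have hmin : min t (a + δ) = t := min_eq_left hta
    have hlow : Tendsto (fun n => t - h n) atTop (𝓝 t) := by
      simpa using (tendsto_const_nhds (x := t)).sub hh0
    refine tendsto_of_tendsto_of_tendsto_of_le_of_le hlow tendsto_const_nhds (fun n => ?_) fun n => ?_
    · have := Nat.lt_floor_add_one ((min t (a + δ) - a) / h n)
      rw [hmin, div_lt_iff₀ (hhpos n)] at this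
      simp only [hI, hmin]
      linarith
    · have := Nat.floor_le (div_nonneg (by linarith : 0 ≤ min t (a + δ) - a) (hhpos n).le)
      rw [hmin, le_div_iff₀ (hhpos n)] at this
      simp only [hI, hmin]
      linarith
  refine ⟨y, ?_, fun s t has hst hta => ?_⟩
  · refine tendsto_nhds_unique (hy a) ?_
    have : ∀ n, Y n (I n a) = y₀ := fun n => by
      have : I n a = 0 := by simp [hI, hδ0.le]
      rw [this]
      rfl
    simp only [this]
    exact tendsto_const_nhds
  · have hmono : ∀ n, I n s ≤ I n t := fun n => Nat.floor_le_floor (by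
      have := min_le_min_right (a + δ) hst
      have := (hhpos n).le
      gcongr)
    have hs := htime s has (hst.trans hta)
    have ht := htime t (has.trans hst) hta
    have H' : ∀ n i k : ℕ, (k : ℝ) * h n ≤ δ → ‖Y n (i + k) - Y n i
        - eulerIncr V V₀ X (a + i * h n) (a + (i + k : ℕ) * h n) (Y n i)‖
        ≤ L * (k * h n) ^ (3 * α) := fun n i k => H hV hV₀ hX a (h n) (hhpos n).le y₀ i k
    clear_value Y I h
    have hest : ∀ n, ‖Y n (I n t) - Y n (I n s) - eulerIncr V V₀ X (a + (I n s : ℝ) * h n)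
        (a + (I n t : ℝ) * h n) (Y n (I n s))‖
        ≤ L * ((a + (I n t : ℝ) * h n) - (a + (I n s : ℝ) * h n)) ^ (3 * α) := by
      intro n
      obtain ⟨k, hk⟩ := Nat.exists_eq_add_of_le (hmono n)
      have hkR : (I n t : ℝ) = I n s + k := by exact_mod_cast hk
      have h1 := hIle n t
      have h2 := mul_nonneg (Nat.cast_nonneg (α := ℝ) (I n s)) (hhpos n).le
      have := H' n (I n s) k (by rw [hkR] at h1; linarith)
      rw [← hk] at this
      refine this.trans (le_of_eq ?_)
      congr 2
      rw [hkR]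
      ring
    have hN := tendsto_eulerIncr hV hV₀ hX hs ht (hy s) hst fun n => by
      have h1 : (I n s : ℝ) ≤ I n t := by exact_mod_cast hmono n
      have h2 := (hhpos n).le
      gcongr
    have hl : Tendsto (fun n => ‖Y n (I n t) - Y n (I n s) - eulerIncr V V₀ X
        (a + (I n s : ℝ) * h n) (a + (I n t : ℝ) * h n) (Y n (I n s))‖) 𝒰
        (𝓝 ‖y t - y s - eulerIncr V V₀ X s t (y s)‖) :=
      Tendsto.norm (Tendsto.sub (Tendsto.sub (hy t) (hy s)) hN)
    have hr : Tendsto (fun n => L * ((a + (I n t : ℝ) * h n) - (a + (I n s : ℝ) * h n)) ^ (3 * α))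
        𝒰 (𝓝 (L * (t - s) ^ (3 * α))) :=
      Tendsto.const_mul L (Tendsto.rpow_const (Tendsto.sub ht hs) (Or.inr (by linarith)))
    exact le_of_tendsto_of_tendsto' hl hr hest

end EulerLimit

end RoughFoliation

/-! ### Uniqueness and change of variables in Euclidean space -/

namespace RoughFoliation

section Davie

variable {E : Type} [NormedAddCommGroup E] [NormedSpace ℝ E] {d : ℕ}
  {V : Fin d → E → E} {V₀ : E → E} {X : Driver d} {α R K : ℝ}

/-- Propagation of the difference of two Euler defects over two adjacent intervals. -/
theorem norm_defect_sub_le {N₁ N₂ N₃ : E → E} {κ κ₁ c C : ℝ} (h1 : CB 1 κ₁ N₁) (h2 : CB 2 κ N₂)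
    (hc : CB 1 c (fun y => N₂ (y + N₁ y) + N₁ y - N₃ y)) (hC : 0 ≤ C)
    {ys yu yt zs zu zt : E} (hz : ‖zu - zs - N₁ zs‖ ≤ C) :
    ‖(yt - ys - N₃ ys) - (zt - zs - N₃ zs)‖ ≤ ‖(yt - yu - N₂ yu) - (zt - zu - N₂ zu)‖
      + (1 + κ) * ‖(yu - ys - N₁ ys) - (zu - zs - N₁ zs)‖
      + (κ * C * (1 + κ₁) + c) * ‖ys - zs‖ := by
  -- The point yu is the Euler point ys + N₁ ys displaced by the defect of the first half, and
  -- likewise for z. The four-point estimate compares the effects of the two displacements on N₂ in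
  -- terms of the difference of defects and the distance of base points.
  have h3 := h2.four_point (ys + N₁ ys) (zs + N₁ zs) (yu - ys - N₁ ys) (zu - zs - N₁ zs)
  have h4 := hc.lipschitz ys zs
  have h5 : ‖(ys + N₁ ys) - (zs + N₁ zs)‖ ≤ (1 + κ₁) * ‖ys - zs‖ := by
    have := h1.lipschitz ys zs
    calc _ = ‖(ys - zs) + (N₁ ys - N₁ zs)‖ := by congr 1; abel
      _ ≤ ‖ys - zs‖ + κ₁ * ‖ys - zs‖ := (norm_add_le _ _).trans (by gcongr)
      _ = _ := by ring
  have hκ := h2.nonneg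
  have e : (yt - ys - N₃ ys) - (zt - zs - N₃ zs)
      = ((yt - yu - N₂ yu) - (zt - zu - N₂ zu)) + ((yu - ys - N₁ ys) - (zu - zs - N₁ zs))
        + (N₂ (ys + N₁ ys + (yu - ys - N₁ ys)) - N₂ (ys + N₁ ys)
          - (N₂ (zs + N₁ zs + (zu - zs - N₁ zs)) - N₂ (zs + N₁ zs)))
        + ((N₂ (ys + N₁ ys) + N₁ ys - N₃ ys) - (N₂ (zs + N₁ zs) + N₁ zs - N₃ zs)) := by
    have e1 : ys + N₁ ys + (yu - ys - N₁ ys) = yu := by abel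
    have e2 : zs + N₁ zs + (zu - zs - N₁ zs) = zu := by abel
    rw [e1, e2]
    abel
  have h6 : κ * ‖zu - zs - N₁ zs‖ * ‖(ys + N₁ ys) - (zs + N₁ zs)‖
      ≤ κ * C * ((1 + κ₁) * ‖ys - zs‖) := by gcongr
  rw [e]
  refine (norm_add_le _ _).trans ?_
  refine (add_le_add (norm_add₃_le) le_rfl).trans ?_
  linarith

set_option maxHeartbeats 1000000 in
/-- Local uniqueness for rough differential equations with bounded coefficients. -/
theorem davie_unique (hα : 1 / 3 < α) (hα' : α ≤ 1 / 2) (hK : 0 ≤ K) (hR : 0 ≤ R) (d : ℕ)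
    {C : ℝ} (hC : 0 ≤ C) :
    ∃ δ, 0 < δ ∧ δ ≤ 1 ∧ ∀ {E : Type} [NormedAddCommGroup E] [NormedSpace ℝ E]
      {V : Fin d → E → E} {V₀ : E → E} {X : Driver d} (_ : ∀ i, CB 3 K (V i)) (_ : CB 3 K V₀)
      (_ : X.IsRough α R) (a b : ℝ) (_ : b ≤ a + δ) (y z : ℝ → E) (_ : y a = z a)
      (_ : ∀ s t, a ≤ s → s ≤ t → t ≤ b →
        ‖y t - y s - eulerIncr V V₀ X s t (y s)‖ ≤ C * (t - s) ^ (3 * α))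
      (_ : ∀ s t, a ≤ s → s ≤ t → t ≤ b →
        ‖z t - z s - eulerIncr V V₀ X s t (z s)‖ ≤ C * (t - s) ^ (3 * α)),
      ∀ t, a ≤ t → t ≤ b → y t = z t := by
  have hα0 : 0 < α := by linarith
  obtain ⟨c, hc0, hc⟩ := exists_CB_euler_defect hα0 hα' hK hR d
  set c₁ := eulerConst d K R with hc₁def
  have hc₁ : 0 ≤ c₁ := eulerConst_nonneg hK hR
  set θ : ℝ := (1 / 2) ^ (3 * α - 1) with hθ
  have hθ0 : 0 ≤ θ := by positivity
  have hθ1 : θ < 1 := Real.rpow_lt_one (by norm_num) (by norm_num) (by linarith)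
  have hhalf : (1 / 2 : ℝ) ^ (3 * α) = θ / 2 := by
    have := Real.rpow_add_one (by norm_num : (1 / 2 : ℝ) ≠ 0) (3 * α - 1)
    rw [sub_add_cancel] at this
    rw [this, hθ]
    ring
  set c₂ := c₁ * C * (1 + c₁) + c with hc₂
  have hc₂0 : 0 ≤ c₂ := by positivity
  set D := 2 * c₂ / (1 - θ) with hD
  have hD0 : 0 ≤ D := div_nonneg (by positivity) (by linarith)
  -- The bound 1 - θ lets the merging of two halves contract, and the bound 1/2 makes each round of
  -- the final iteration halve the distance of the two solutions.
  obtain ⟨δ, hδ0, hδ1, hδ⟩ := exists_delta (add_nonneg hc₁ hD0)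
    (lt_min (by linarith : 0 < 1 - θ) (by norm_num : (0 : ℝ) < 1 / 2)) hα0
  have hδα := Real.rpow_nonneg hδ0.le α
  have hδ1' : c₁ * δ ^ α ≤ 1 - θ := by
    nlinarith [hδ.trans (min_le_left _ _), mul_nonneg hD0 hδα]
  have hδ2' : D * δ ^ α ≤ 1 / 2 := by
    nlinarith [hδ.trans (min_le_right _ _), mul_nonneg hc₁ hδα]
  refine ⟨δ, hδ0, hδ1, ?_⟩
  intro E _ _ V V₀ X hV hV₀ hX a b hb y z hyz hy hz
  set N := eulerIncr V V₀ X with hN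
  have hNCB : ∀ {s t}, s ≤ t → t - s ≤ δ → CB 2 (c₁ * δ ^ α) (N s t) := fun hst hts =>
    CB_eulerIncr hα0 hα' hV hV₀ hR hX hst hts hδ1
  have hc₁δ : c₁ * δ ^ α ≤ c₁ := mul_le_of_le_one_right hc₁ (Real.rpow_le_one hδ0.le hδ1 hα0.le)
  -- refinement of the defects along midpoints
  have hJ : ∀ M, 0 ≤ M → (∀ t, a ≤ t → t ≤ b → ‖y t - z t‖ ≤ M) → ∀ s t, a ≤ s → s ≤ t → t ≤ b →
      ‖(y t - y s - N s t (y s)) - (z t - z s - N s t (z s))‖ ≤ D * M * (t - s) ^ (3 * α) := by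
    intro M hM0 hM
    -- Each halving multiplies the constant by at most (1 + θ)/2 and adds c₂ M. The choice D = 2
    -- c₂/(1 - θ) makes D M a fixed point of this, while the crude initial contribution 2C, from the
    -- two separate estimates, decays geometrically.
    have hn : ∀ n : ℕ, ∀ s t, a ≤ s → s ≤ t → t ≤ b →
        ‖(y t - y s - N s t (y s)) - (z t - z s - N s t (z s))‖
          ≤ (2 * C * ((1 + θ) / 2) ^ n + D * M) * (t - s) ^ (3 * α) := by
      intro n
      induction n with
      | zero =>
        intro s t has hst htb
        refine (norm_sub_le _ _).trans ((add_le_add (hy s t has hst htb)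
          (hz s t has hst htb)).trans ?_)
        have : 0 ≤ D * M * (t - s) ^ (3 * α) :=
          mul_nonneg (mul_nonneg hD0 hM0) (Real.rpow_nonneg (sub_nonneg.2 hst) _)
        rw [pow_zero]
        linarith
      | succ n ih =>
        intro s t has hst htb
        have hts : 0 ≤ t - s := sub_nonneg.2 hst
        set u := (s + t) / 2 with hu
        have hsu : s ≤ u := by rw [hu]; linarith
        have hut : u ≤ t := by rw [hu]; linarith
        have e1 : u - s = 1 / 2 * (t - s) := by rw [hu]; ring
        have e2 : t - u = 1 / 2 * (t - s) := by rw [hu]; ring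
        have hP := Real.rpow_nonneg hts (3 * α)
        have i1 := ih s u has hsu (hut.trans htb)
        have i2 := ih u t (has.trans hsu) hut htb
        rw [e1, Real.mul_rpow (by norm_num) hts, hhalf] at i1
        rw [e2, Real.mul_rpow (by norm_num) hts, hhalf] at i2
        have hz' : ‖z u - z s - N s u (z s)‖ ≤ C * (t - s) ^ (3 * α) := by
          refine (hz s u has hsu (hut.trans htb)).trans ?_
          have : u - s ≤ t - s := by linarith
          have : 0 ≤ u - s := by linarith
          gcongr
        have hdef := hc hV hV₀ hX hsu hut le_rfl (by linarith : t - s ≤ 1)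
        rw [← rpow_three_mul_eq hts] at hdef
        have key := norm_defect_sub_le (ys := y s) (yu := y u) (yt := y t) (zs := z s) (zu := z u)
          (zt := z t) (hNCB hsu (by linarith)).of_succ (hNCB hut (by linarith)) hdef
          (by positivity) hz'
        have hM' := hM s has (hst.trans htb)
        set P := (t - s) ^ (3 * α)
        set ρ := ((1 + θ) / 2) with hρ
        set B := 2 * C * ρ ^ n + D * M with hB
        have hB0 : 0 ≤ B := by positivity
        have hcon : (c₁ * δ ^ α * (C * P) * (1 + c₁ * δ ^ α) + c * P) * ‖y s - z s‖
            ≤ c₂ * P * M := by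
          have : c₁ * δ ^ α * (C * P) * (1 + c₁ * δ ^ α) + c * P ≤ c₂ * P := by
            rw [hc₂]
            calc _ ≤ c₁ * (C * P) * (1 + c₁) + c * P := by gcongr
              _ = _ := by ring
          gcongr
        have hDc : c₂ = D * ((1 - θ) / 2) := by
          rw [hD]
          have : (1 - θ) ≠ 0 := by linarith
          field_simp
        calc _ ≤ B * (θ / 2 * P) + (1 + (1 - θ)) * (B * (θ / 2 * P)) + c₂ * P * M := by
              refine key.trans (add_le_add (add_le_add i2 ?_) hcon)
              have : 0 ≤ 1 + c₁ * δ ^ α := by positivity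
              gcongr
          _ = (1 + (1 - θ) / 2) * θ * (B * P) + c₂ * P * M := by ring
          _ ≤ ρ * (B * P) + c₂ * P * M := by
              have : (1 + (1 - θ) / 2) * θ ≤ ρ := by rw [hρ]; nlinarith
              gcongr
          _ = _ := by rw [hDc, hB, pow_succ, hρ]; ring
    intro s t has hst htb
    have hlim : Tendsto (fun n : ℕ => (2 * C * ((1 + θ) / 2) ^ n + D * M) * (t - s) ^ (3 * α))
        atTop (𝓝 ((2 * C * 0 + D * M) * (t - s) ^ (3 * α))) :=
      (((tendsto_pow_atTop_nhds_zero_of_lt_one (by linarith) (by linarith)).const_mul _).add_const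
        _).mul_const _
    rw [mul_zero, zero_add] at hlim
    exact ge_of_tendsto' hlim fun n => hn n s t has hst htb
  -- Since y and z start together, y t - z t equals the difference of their defects over [a, t]. A
  -- bound M for the distance therefore improves to D M δ^α ≤ M/2, and iteration gives zero.
  have hM : ∀ n : ℕ, ∀ t, a ≤ t → t ≤ b → ‖y t - z t‖ ≤ 2 * C * (1 / 2) ^ n := by
    intro n
    induction n with
    | zero =>
      intro t hat htb
      have h1 := hy a t le_rfl hat htb
      have h2 := hz a t le_rfl hat htb
      have h3 : (t - a) ^ (3 * α) ≤ 1 :=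
        Real.rpow_le_one (by linarith) (by linarith) (by positivity)
      calc ‖y t - z t‖ = ‖(y t - y a - N a t (y a)) - (z t - z a - N a t (z a))‖ := by
            rw [hyz]; congr 1; abel
        _ ≤ C * (t - a) ^ (3 * α) + C * (t - a) ^ (3 * α) :=
            (norm_sub_le _ _).trans (add_le_add h1 h2)
        _ ≤ C * 1 + C * 1 := by gcongr
        _ = _ := by ring
    | succ n ih =>
      intro t hat htb
      have h0 : 0 ≤ 2 * C * (1 / 2) ^ n := by positivity
      have h1 := hJ _ h0 ih a t le_rfl hat htb
      have h3 : (t - a) ^ (3 * α) ≤ δ ^ α := by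
        refine (Real.rpow_le_rpow (by linarith) (by linarith : t - a ≤ δ) (by positivity)).trans ?_
        exact Real.rpow_le_rpow_of_exponent_ge hδ0 hδ1 (by linarith)
      calc ‖y t - z t‖ = ‖(y t - y a - N a t (y a)) - (z t - z a - N a t (z a))‖ := by
            rw [hyz]; congr 1; abel
        _ ≤ D * (2 * C * (1 / 2) ^ n) * δ ^ α := h1.trans (by gcongr)
        _ = (D * δ ^ α) * (2 * C * (1 / 2) ^ n) := by ring
        _ ≤ 1 / 2 * (2 * C * (1 / 2) ^ n) := by gcongr
        _ = _ := by rw [pow_succ]; ring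
  intro t hat htb
  have hlim : Tendsto (fun n : ℕ => 2 * C * (1 / 2 : ℝ) ^ n) atTop (𝓝 (2 * C * 0)) :=
    (tendsto_pow_atTop_nhds_zero_of_lt_one (by norm_num) (by norm_num)).const_mul _
  rw [mul_zero] at hlim
  have := ge_of_tendsto' hlim fun n => hM n t hat htb
  exact sub_eq_zero.1 (norm_le_zero_iff.1 this)

variable {F : Type} [NormedAddCommGroup F] [NormedSpace ℝ F]

/-- Second-order Taylor estimate. -/
theorem CB.taylor_two {f : E → F} (h : CB 3 K f) (x y : E) :
    ‖f y - f x - _root_.fderiv ℝ f x (y - x)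
      - (1 / 2 : ℝ) • _root_.fderiv ℝ (_root_.fderiv ℝ f) x (y - x) (y - x)‖ ≤ K * ‖y - x‖ ^ 3 := by
  set D := _root_.fderiv ℝ (_root_.fderiv ℝ f) x with hD
  have hsym : ∀ v w, D v w = D w v := fun v w =>
    second_derivative_symmetric (fun z => (h.2.1 z).hasFDerivAt) (h.2.2.2.1 x).hasFDerivAt v w
  -- The mean value inequality is applied to f minus its quadratic Taylor term at x. The derivative
  -- of this difference, compared with Df(x), is the first-order Taylor remainder of Df.
  have hd : ∀ q, HasFDerivAt (fun q => f q - (1 / 2 : ℝ) • D (q - x) (q - x))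
      (_root_.fderiv ℝ f q - D (q - x)) q := by
    intro q
    have h1 : HasFDerivAt (fun q : E => q - x) (ContinuousLinearMap.id ℝ E) q :=
      (hasFDerivAt_id q).sub_const x
    have h2 : HasFDerivAt (fun q : E => D (q - x)) D q := by
      simpa [Function.comp_def] using (D.hasFDerivAt (x := q - x)).comp q h1
    have h3 := (h.2.1 q).hasFDerivAt.sub ((h2.clm_apply h1).const_smul (1 / 2 : ℝ))
    refine h3.congr_fderiv ?_
    ext v
    simp only [ContinuousLinearMap.comp_id, sub_apply,
      smul_apply, add_apply, ContinuousLinearMap.flip_apply,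
      hsym v (q - x), sub_right_inj]
    rw [← two_smul ℝ, smul_smul]
    norm_num
  have h1 := (convex_closedBall x ‖y - x‖).norm_image_sub_le_of_norm_hasFDerivWithin_le'
    (x := x) (y := y) (φ := _root_.fderiv ℝ f x) (C := K * ‖y - x‖ ^ 2)
    (fun z _ => (hd z).hasFDerivWithinAt) (fun z hz => ?_)
    (Metric.mem_closedBall_self (norm_nonneg _)) (by simp [dist_eq_norm])
  · simp only [sub_self, map_zero, smul_zero, sub_zero] at h1
    calc _ = ‖f y - (1 / 2 : ℝ) • D (y - x) (y - x) - f x - _root_.fderiv ℝ f x (y - x)‖ := by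
          congr 1; abel
      _ ≤ _ := h1
      _ = _ := by ring
  · have := h.2.2.taylor_one x z
    rw [Metric.mem_closedBall, dist_eq_norm] at hz
    have hK := h.nonneg
    calc _ = ‖_root_.fderiv ℝ f z - _root_.fderiv ℝ f x - D (z - x)‖ := by congr 1; abel
      _ ≤ K * ‖z - x‖ ^ 2 := this
      _ ≤ _ := by gcongr

/-- The second-order terms of the change of variables formula, for a geometric rough path. -/
theorem sum_second_order {g : E → F} (hV : ∀ i, CB 3 K (V i)) {K' : ℝ} (hg : CB 3 K' g)
    (hX : X.IsRough α R) {s t : ℝ} (hst : s ≤ t) (y : E) :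
    ∑ j, ∑ k, X.X2 s t j k • fderiv ℝ (fun y => fderiv ℝ g y (V k y)) y (V j y)
      = fderiv ℝ g y (∑ j, ∑ k, X.X2 s t j k • fderiv ℝ (V k) y (V j y))
        + (1 / 2 : ℝ) • fderiv ℝ (fderiv ℝ g) y (∑ i, X.X1 s t i • V i y)
          (∑ i, X.X1 s t i • V i y) := by
  set D := fderiv ℝ (fderiv ℝ g) y with hD
  have hsym : ∀ v w, D v w = D w v := fun v w =>
    second_derivative_symmetric (fun z => (hg.2.1 z).hasFDerivAt) (hg.2.2.2.1 y).hasFDerivAt v w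
  have e1 : ∀ j k, fderiv ℝ (fun y => fderiv ℝ g y (V k y)) y (V j y)
      = fderiv ℝ g y (fderiv ℝ (V k) y (V j y)) + D (V j y) (V k y) := fun j k => by
    have := (hg.2.2.2.1 y).hasFDerivAt.clm_apply ((hV k).2.1 y).hasFDerivAt
    rw [this.fderiv]
    simp [hD]
  -- Here geometricity enters: the product of first levels is the symmetrisation of the second
  -- level. As D is symmetric, it sees only the symmetric part, so the quadratic Taylor term is
  -- expressed by the second level alone.
  have e2 : D (∑ i, X.X1 s t i • V i y) (∑ i, X.X1 s t i • V i y)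
      = ∑ j, ∑ k, (X.X2 s t j k + X.X2 s t k j) • D (V j y) (V k y) := by
    simp only [map_sum, map_smul, sum_apply, smul_apply,
      Finset.smul_sum, smul_smul, hX.geom s t hst]
    rw [Finset.sum_comm]
    exact Finset.sum_congr rfl fun j _ => Finset.sum_congr rfl fun k _ => by rw [hsym, mul_comm]
  have e3 : ∑ j, ∑ k, X.X2 s t k j • D (V j y) (V k y)
      = ∑ j, ∑ k, X.X2 s t j k • D (V j y) (V k y) := by
    rw [Finset.sum_comm]
    exact Finset.sum_congr rfl fun j _ => Finset.sum_congr rfl fun k _ => by rw [hsym]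
  rw [e2]
  simp only [e1, smul_add, add_smul, Finset.sum_add_distrib, map_sum, map_smul]
  rw [e3, ← smul_add, ← two_smul ℝ, smul_smul]
  norm_num

/-- The change of variables formula along solutions driven by a geometric rough path. -/
theorem exists_ito_bound (hα : 0 < α) (hα' : α ≤ 1 / 2) (hK : 0 ≤ K) (hR : 0 ≤ R) (d : ℕ)
    {K' L : ℝ} (hK' : 0 ≤ K') (hL : 0 ≤ L) :
    ∃ L', 0 ≤ L' ∧ ∀ {E : Type} [NormedAddCommGroup E] [NormedSpace ℝ E]
      {V : Fin d → E → E} {V₀ : E → E} {X : Driver d} (_ : ∀ i, CB 3 K (V i)) (_ : CB 3 K V₀)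
      (_ : X.IsRough α R) {g : E → ℝ} (_ : CB 3 K' g) {s t : ℝ} (_ : s ≤ t) (_ : t - s ≤ 1)
      {y z : E} (_ : ‖z - y - eulerIncr V V₀ X s t y‖ ≤ L * (t - s) ^ (3 * α)),
      |g z - g y - (∑ i, fderiv ℝ g y (V i y) * X.X1 s t i
        + ∑ j, ∑ k, fderiv ℝ (fun y => fderiv ℝ g y (V k y)) y (V j y) * X.X2 s t j k
        + fderiv ℝ g y (V₀ y) * (t - s))| ≤ L' * (t - s) ^ (3 * α) := by
  set c₁ := eulerConst d K R with hc₁def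
  set c₂ := eulerConst₂ d K R with hc₂def
  have hc₁ : 0 ≤ c₁ := eulerConst_nonneg hK hR
  have hc₂ : 0 ≤ c₂ := eulerConst₂_nonneg hK hR
  set c₃ := (d : ℝ) * (R * K) with hc₃
  have hc₃0 : 0 ≤ c₃ := by positivity
  refine ⟨K' * (c₁ + L) ^ 3 + K' * L + K' * ((c₂ + L) * (c₁ + L) + c₃ * (c₂ + L)),
    by positivity, ?_⟩
  intro E _ _ V V₀ X hV hV₀ hX g hg s t hst hts y z hz
  have h0 : 0 ≤ t - s := sub_nonneg.2 hst
  rw [rpow_three_mul_eq h0] at *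
  have hA := Real.rpow_nonneg h0 α
  have hA1 : (t - s) ^ α ≤ 1 := Real.rpow_le_one h0 hts hα.le
  have hN := (CB_eulerIncr hα hα' hV hV₀ hR hX hst le_rfl hts).norm_le y
  have hP := (CB_eulerIncr₂ hα hα' hV hV₀ hX hst le_rfl hts).norm_le y
  have hX1 : ∀ i, |X.X1 s t i| ≤ R * (t - s) ^ α := hX.bound1 s t hst
  set A := (t - s) ^ α with hAdef
  set v := ∑ i, X.X1 s t i • V i y with hv
  have hvn : ‖v‖ ≤ c₃ * A := by
    calc _ ≤ ∑ _i : Fin d, R * A * K := norm_sum_le_of_le _ fun i _ => by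
          rw [norm_smul, Real.norm_eq_abs]
          have := hX1 i
          have := (hV i).norm_le y
          gcongr
      _ = _ := by
          simp only [Finset.sum_const, Finset.card_univ, Fintype.card_fin, nsmul_eq_mul, hc₃]
          ring
  set Δ := z - y with hΔ
  set N := eulerIncr V V₀ X s t y with hNdef
  have hA3 : A ^ 3 ≤ A := by nlinarith [pow_le_one₀ hA hA1 (n := 2)]
  have hA32 : A ^ 3 ≤ A ^ 2 := by nlinarith [pow_nonneg hA 2]
  have hΔn : ‖Δ‖ ≤ (c₁ + L) * A := by
    calc _ = ‖(Δ - N) + N‖ := by rw [sub_add_cancel]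
      _ ≤ L * A ^ 3 + c₁ * A := (norm_add_le _ _).trans (add_le_add hz hN)
      _ ≤ L * A + c₁ * A := by gcongr
      _ = _ := by ring
  have hΔv : ‖Δ - v‖ ≤ (c₂ + L) * A ^ 2 := by
    have e : Δ - v = (Δ - N) + eulerIncr₂ V V₀ X s t y := by
      rw [hNdef, eulerIncr_eq, hv]; abel
    calc _ ≤ L * A ^ 3 + c₂ * A ^ 2 := by rw [e]; exact (norm_add_le _ _).trans (add_le_add hz hP)
      _ ≤ L * A ^ 2 + c₂ * A ^ 2 := by gcongr
      _ = _ := by ring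
  set D := fderiv ℝ (fderiv ℝ g) y with hD
  have hDn : ‖D‖ ≤ K' := hg.2.2.2.2.norm_le y
  have hT := hg.taylor_two y z
  have hsec := sum_second_order hV hg hX hst y
  rw [← hv, ← hD] at hsec
  simp only [smul_eq_mul] at hsec
  have h1 : |g z - g y - fderiv ℝ g y Δ - 1 / 2 * D Δ Δ| ≤ K' * (c₁ + L) ^ 3 * A ^ 3 := by
    calc _ ≤ K' * ‖Δ‖ ^ 3 := by rw [Real.norm_eq_abs, smul_eq_mul] at hT; exact hT
      _ ≤ K' * ((c₁ + L) * A) ^ 3 := by gcongr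
      _ = _ := by ring
  have h2 : |fderiv ℝ g y (Δ - N)| ≤ K' * L * A ^ 3 := by
    calc _ ≤ ‖fderiv ℝ g y‖ * ‖Δ - N‖ := (fderiv ℝ g y).le_opNorm _
      _ ≤ K' * (L * A ^ 3) := by
          have := hg.2.2.norm_le y
          gcongr
      _ = _ := by ring
  have h3 : |D Δ Δ - D v v| ≤ K' * ((c₂ + L) * (c₁ + L) + c₃ * (c₂ + L)) * A ^ 3 := by
    have e : D Δ Δ - D v v = D (Δ - v) Δ + D v (Δ - v) := by simp
    have b1 : |D (Δ - v) Δ| ≤ K' * ((c₂ + L) * A ^ 2) * ((c₁ + L) * A) :=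
      (D.le_opNorm₂ _ _).trans (by gcongr)
    have b2 : |D v (Δ - v)| ≤ K' * (c₃ * A) * ((c₂ + L) * A ^ 2) :=
      (D.le_opNorm₂ _ _).trans (by gcongr)
    rw [e]
    refine (abs_add_le _ _).trans ((add_le_add b1 b2).trans (le_of_eq (by ring)))
  -- Three errors of order 3α: the cubic Taylor remainder along the true increment Δ, the
  -- replacement of Δ by the Euler increment N in the linear term, and its replacement by the
  -- first-level part v in the quadratic term. The last suffices because Δ - v is of order 2α and Δ,
  -- v are of order α.
  have e : g z - g y - (∑ i, fderiv ℝ g y (V i y) * X.X1 s t i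
        + ∑ j, ∑ k, fderiv ℝ (fun y => fderiv ℝ g y (V k y)) y (V j y) * X.X2 s t j k
        + fderiv ℝ g y (V₀ y) * (t - s))
      = (g z - g y - fderiv ℝ g y Δ - 1 / 2 * D Δ Δ) + fderiv ℝ g y (Δ - N)
        + 1 / 2 * (D Δ Δ - D v v) := by
    have e1 : ∑ j, ∑ k, fderiv ℝ (fun y => fderiv ℝ g y (V k y)) y (V j y) * X.X2 s t j k
        = fderiv ℝ g y (∑ j, ∑ k, X.X2 s t j k • fderiv ℝ (V k) y (V j y)) + 1 / 2 * D v v := by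
      rw [← hsec]
      simp only [mul_comm]
    have e2 : fderiv ℝ g y N = ∑ i, fderiv ℝ g y (V i y) * X.X1 s t i
        + fderiv ℝ g y (∑ j, ∑ k, X.X2 s t j k • fderiv ℝ (V k) y (V j y))
        + fderiv ℝ g y (V₀ y) * (t - s) := by
      rw [hNdef, eulerIncr, map_add, map_add, map_smul, map_sum]
      simp only [map_smul, smul_eq_mul]
      rw [mul_comm (t - s)]
      simp only [mul_comm (X.X1 s t _)]
    rw [e1, (fderiv ℝ g y).map_sub Δ N, e2]
    ring
  rw [e]
  refine (abs_add_three _ _ _).trans ?_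
  rw [abs_mul, abs_of_pos (by norm_num : (0 : ℝ) < 1 / 2)]
  have := abs_nonneg (D Δ Δ - D v v)
  linarith

end Davie

end RoughFoliation

/-! ### Calculus in foliated charts and leafwise test functions -/

namespace RoughFoliation

section Charts

variable {p : ℕ} {M Z : Type*} [TopologicalSpace M] [TopologicalSpace Z] {A : FoliatedAtlas p M Z}

theorem isLeafwiseFunction_iff {k : ℕ} {f : M → ℝ} : A.IsLeafwiseFunction k f ↔
    ∀ φ ∈ A.charts, LeafC k (fun q => f (φ.symm q)) φ.target :=
  forall₂_congr fun φ _ => isCL_iff_leafC φ.open_target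

theorem leafC_comp (V : A.LeafwiseVectorField 3) {φ} (hφ : φ ∈ A.charts) :
    LeafC 3 (fun q => V.comp φ (φ.symm q)) φ.target :=
  (isCL_iff_leafC φ.open_target).1 (V.isCL φ hφ)

/-- Transition maps are locally of product form in the transverse direction. -/
theorem exists_transition {φ ψ} (hφ : φ ∈ A.charts) (hψ : ψ ∈ A.charts) (k : ℕ) {x : M}
    (hx : x ∈ φ.source) (hx' : x ∈ ψ.source) : ∃ U, IsOpen U ∧ φ x ∈ U ∧
      U ⊆ φ.target ∩ φ.symm ⁻¹' ψ.source ∧ LeafC k (fun q => (ψ (φ.symm q)).1) U ∧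
      ∃ f₂ : Z → Z, ContinuousOn f₂ (Prod.snd '' U) ∧ ∀ q ∈ U, (ψ (φ.symm q)).2 = f₂ q.2 := by
  obtain ⟨U, hUsub, hU, hq, h1, f₂, hf₂, h2⟩ := A.compatible φ hφ ψ hψ k (φ x)
    ⟨φ.map_source hx, by simpa [φ.left_inv hx] using hx'⟩
  exact ⟨U, hU, hq, hUsub, (isCL_iff_leafC hU).1 h1, f₂, hf₂, h2⟩

/-- The derivative along a leafwise vector field can be computed in any chart. -/
theorem apply_eq (V : A.LeafwiseVectorField 3) {f : M → ℝ} (hf : A.IsLeafwiseFunction 1 f)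
    {φ} (hφ : φ ∈ A.charts) {x : M} (hx : x ∈ φ.source) :
    V.apply f x = leafDeriv (fun q => f (φ.symm q)) (φ x) (V.comp φ x) := by
  have hψ : A.chartAt x ∈ A.charts := (A.cover x).choose_spec.1
  have hxψ : x ∈ (A.chartAt x).source := (A.cover x).choose_spec.2
  rw [FoliatedAtlas.LeafwiseVectorField.apply]
  set ψ := A.chartAt x
  obtain ⟨U, hU, hqU, hUsub, h1, f₂, -, h2⟩ := exists_transition hψ hφ 1 hxψ hx
  have h3 := h1.hasFDerivAt hqU
  have h4 := (isLeafwiseFunction_iff.1 hf φ hφ).hasFDerivAt (φ.map_source hx)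
  rw [V.comp_eq ψ hψ φ hφ x ⟨hxψ, hx⟩]
  have e0 : φ (ψ.symm ((ψ x).1, (ψ x).2)) = φ x := by rw [Prod.mk.eta, ψ.left_inv hxψ]
  have h5 : HasFDerivAt (fun y => f (ψ.symm (y, (ψ x).2)))
      ((leafDeriv (fun q => f (φ.symm q)) (φ x)).comp
        (leafDeriv (fun q => (φ (ψ.symm q)).1) (ψ x))) (ψ x).1 := by
    rw [← e0] at h4
    refine (HasFDerivAt.comp (ψ x).1 (g := fun y => f (φ.symm (y, (φ x).2))) ?_ h3).congr_of_eventuallyEq ?_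
    · rw [e0] at h4
      rw [e0]
      exact h4
    · filter_upwards [slice_mem_nhds hU hqU] with y hy
      have e1 := h2 _ hy
      have e2 := h2 _ hqU
      rw [ψ.left_inv hxψ] at e2
      -- By the product form of transition maps, the transverse coordinate in φ does not move while
      -- y varies in the slice of ψ. Slices are thus mapped into slices, and the chain rule applies
      -- to functions of y alone.
      have e3 : ((φ (ψ.symm (y, (ψ x).2))).1, (φ x).2) = φ (ψ.symm (y, (ψ x).2)) := by
        ext1
        · rfl
        · exact e2.trans e1.symm
      simp only [Function.comp_apply]
      rw [e3, φ.left_inv (hUsub hy).2]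
  rw [h5.fderiv]
  rfl

theorem IsLeafwiseFunction.of_le {k l : ℕ} {f : M → ℝ} (hf : A.IsLeafwiseFunction k f)
    (h : l ≤ k) : A.IsLeafwiseFunction l f :=
  isLeafwiseFunction_iff.2 fun φ hφ => (isLeafwiseFunction_iff.1 hf φ hφ).of_le h

theorem apply_symm_eq (V : A.LeafwiseVectorField 3) {f : M → ℝ} (hf : A.IsLeafwiseFunction 1 f)
    {φ} (hφ : φ ∈ A.charts) {q : EuclideanSpace ℝ (Fin p) × Z} (hq : q ∈ φ.target) :
    V.apply f (φ.symm q)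
      = leafDeriv (fun q => f (φ.symm q)) q (V.comp φ (φ.symm q)) := by
  rw [apply_eq V hf hφ (φ.map_target hq), φ.right_inv hq]

theorem isLeafwiseFunction_apply (V : A.LeafwiseVectorField 3) {k : ℕ} (hk : k ≤ 3) {f : M → ℝ}
    (hf : A.IsLeafwiseFunction (k + 1) f) : A.IsLeafwiseFunction k (V.apply f) := by
  refine isLeafwiseFunction_iff.2 fun φ hφ => ?_
  refine ((isLeafwiseFunction_iff.1 hf φ hφ).2.2.clm_apply ((leafC_comp V hφ).of_le hk)
    φ.open_target).congr φ.open_target fun q hq => ?_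
  exact apply_symm_eq V (IsLeafwiseFunction.of_le hf (by omega)) hφ hq

theorem IsLeafwiseFunction.continuous {k : ℕ} {f : M → ℝ} (hf : A.IsLeafwiseFunction k f) :
    Continuous f := by
  refine continuous_iff_continuousAt.2 fun x => ?_
  obtain ⟨φ, hφ, hx⟩ := A.cover x
  have h1 := ((isLeafwiseFunction_iff.1 hf φ hφ).continuousOn.continuousAt
    (φ.open_target.mem_nhds (φ.map_source hx))).comp (φ.continuousAt hx)
  refine h1.congr ?_
  filter_upwards [φ.open_source.mem_nhds hx] with y hy
  simp [φ.left_inv hy]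

/-- A leafwise function supported in a chart, of product form. -/
theorem exists_leafwise_bump [T2Space M] {φ} (hφ : φ ∈ A.charts)
    {b : EuclideanSpace ℝ (Fin p) → ℝ} (hb : ContDiff ℝ 3 b) {χ : Z → ℝ} (hχ : Continuous χ)
    {S : Set (EuclideanSpace ℝ (Fin p))} {C : Set Z} (hS : IsCompact S) (hC : IsCompact C)
    (hSC : S ×ˢ C ⊆ φ.target) (hbS : ∀ y ∉ S, b y = 0) (hχC : ∀ z ∉ C, χ z = 0) :
    ∃ f : M → ℝ, A.IsLeafwiseFunction 3 f ∧ (∀ x ∈ φ.source, f x = b (φ x).1 * χ (φ x).2) ∧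
      ∀ x ∉ φ.source, f x = 0 := by
  classical
  refine ⟨fun x => if x ∈ φ.source then b (φ x).1 * χ (φ x).2 else 0, ?_,
    fun x hx => if_pos hx, fun x hx => if_neg hx⟩
  refine isLeafwiseFunction_iff.2 fun ψ hψ => LeafC.of_local fun q hq => ?_
  by_cases hx : ψ.symm q ∈ φ.source
  · obtain ⟨U, hU, hqU, hUsub, h1, f₂, hf₂, h2⟩ := exists_transition hψ hφ 3 (ψ.map_target hq) hx
    rw [ψ.right_inv hq] at hqU
    refine ⟨U, hU, hqU, ?_⟩
    have h3 : LeafC 3 (fun q : EuclideanSpace ℝ (Fin p) × Z => χ (f₂ q.2)) U :=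
      LeafC.const_snd (χ := fun z => χ (f₂ z)) (hχ.comp_continuousOn hf₂)
    refine ((h1.comp_smooth hb hU).smul h3 hU).congr hU fun r hr => ?_
    rw [if_pos (show ψ.symm r ∈ φ.source from (hUsub hr).2), h2 r hr]
    rfl
  -- The support of the bump lies in the image of S × C, which is compact and hence closed in the
  -- Hausdorff space M. Off the domain of φ the extension by zero therefore vanishes on a whole
  -- neighbourhood.
  · have hK : IsCompact (φ.symm '' (S ×ˢ C)) :=
      (hS.prod hC).image_of_continuousOn (φ.symm.continuousOn.mono hSC)
    have hzero : ∀ x ∉ φ.symm '' (S ×ˢ C),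
        (if x ∈ φ.source then b (φ x).1 * χ (φ x).2 else 0) = 0 := by
      intro x hx
      split_ifs with hxs
      · have : φ x ∉ S ×ˢ C := fun h => hx ⟨φ x, h, φ.left_inv hxs⟩
        by_cases h1 : (φ x).1 ∈ S
        · rw [hχC _ fun h2 => this ⟨h1, h2⟩, mul_zero]
        · rw [hbS _ h1, zero_mul]
      · rfl
    have hU : IsOpen (ψ.target ∩ ψ.symm ⁻¹' (φ.symm '' (S ×ˢ C))ᶜ) :=
      ψ.symm.isOpen_inter_preimage hK.isClosed.isOpen_compl
    refine ⟨_, hU, ⟨hq, fun ⟨r, hr, hr'⟩ => hx (hr' ▸ φ.map_target (hSC hr))⟩, ?_⟩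
    exact (LeafC.const_snd (χ := fun _ => (0 : ℝ)) continuousOn_const).congr hU fun r hr =>
      hzero _ hr.2

/-- A product box inside the target of a foliated chart. -/
theorem exists_box [LocallyCompactSpace Z] {φ} (hφ : φ ∈ A.charts) {x : M} (hx : x ∈ φ.source) :
    ∃ (B₁ : Set (EuclideanSpace ℝ (Fin p))) (B₂ C : Set Z) (r : ℝ), IsOpen B₁ ∧ IsOpen B₂ ∧
      φ.target = B₁ ×ˢ B₂ ∧ 0 < r ∧ Metric.closedBall (φ x).1 (3 * r) ⊆ B₁ ∧ IsCompact C ∧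
      C ⊆ B₂ ∧ C ∈ 𝓝 (φ x).2 := by
  obtain ⟨B₁, B₂, h1, -, h2, h3⟩ := A.target_eq_prod φ hφ
  have hq := φ.map_source hx
  rw [h3] at hq
  obtain ⟨ε, hε, hεB⟩ := Metric.isOpen_iff.1 h1 _ hq.1
  obtain ⟨C, hC, hzC, hCB⟩ := exists_compact_subset h2 hq.2
  refine ⟨B₁, B₂, C, ε / 6, h1, h2, h3, by positivity, fun y hy => hεB ?_, hC, hCB,
    mem_interior_iff_mem_nhds.1 hzC⟩
  rw [Metric.mem_closedBall] at hy
  rw [Metric.mem_ball]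
  linarith

theorem closedBall_subset_of_nhds [LocallyCompactSpace Z] {U : Set (EuclideanSpace ℝ (Fin p) × Z)}
    {q : EuclideanSpace ℝ (Fin p) × Z} (hU : U ∈ 𝓝 q) : ∃ (r : ℝ) (C : Set Z), 0 < r ∧
      IsCompact C ∧ C ∈ 𝓝 q.2 ∧ Metric.closedBall q.1 r ×ˢ C ⊆ U := by
  rw [nhds_prod_eq] at hU
  obtain ⟨u, hu, v, hv, huv⟩ := Filter.mem_prod_iff.1 hU
  obtain ⟨r, hr, hru⟩ := Metric.nhds_basis_closedBall.mem_iff.1 hu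
  obtain ⟨C, hC, hCv, hCc⟩ := local_compact_nhds hv
  exact ⟨r, C, hr, hCc, hC, (Set.prod_mono hru hCv).trans huv⟩

/-- Leafwise functions detect neighbourhoods. -/
theorem exists_leafwise_one [T2Space M] [LocallyCompactSpace Z] [T2Space Z] {x : M} {U : Set M}
    (hU : U ∈ 𝓝 x) : ∃ f, A.IsLeafwiseFunction 3 f ∧ f x = 1 ∧ ∀ x' ∉ U, f x' = 0 := by
  obtain ⟨φ, hφ, hx⟩ := A.cover x
  have h1 : φ.target ∩ φ.symm ⁻¹' U ∈ 𝓝 (φ x) :=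
    Filter.inter_mem (φ.open_target.mem_nhds (φ.map_source hx)) <|
      (φ.continuousAt_symm (φ.map_source hx)).preimage_mem_nhds (by rwa [φ.left_inv hx])
  obtain ⟨r, C, hr, hC, hCn, hsub⟩ := closedBall_subset_of_nhds h1
  let b : ContDiffBump (φ x).1 := ⟨r / 2, r, by positivity, by linarith⟩
  obtain ⟨χ, hχ1, -, hχs, -⟩ := exists_continuousMap_one_of_isCompact_subset_isOpen
    (isCompact_singleton (x := (φ x).2)) isOpen_interior
    (Set.singleton_subset_iff.2 (mem_interior_iff_mem_nhds.2 hCn))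
  have hb0 : ∀ y ∉ Metric.closedBall (φ x).1 r, b y = 0 := fun y hy => by
    refine b.zero_of_le_dist ?_
    rw [Metric.mem_closedBall, not_le] at hy
    exact hy.le
  have hχ0 : ∀ z ∉ C, χ z = 0 := fun z hz => by
    by_contra h
    exact hz (interior_subset (hχs (subset_tsupport _ h)))
  obtain ⟨f, hf, hf1, hf2⟩ := exists_leafwise_bump hφ (b.contDiff (n := 3)) χ.continuous
    (isCompact_closedBall _ _) hC (hsub.trans Set.inter_subset_left) hb0 hχ0
  refine ⟨f, hf, ?_, fun x' hx' => ?_⟩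
  · rw [hf1 x hx, hχ1 rfl, b.one_of_mem_closedBall (Metric.mem_closedBall_self (half_pos hr).le)]
    simp
  · by_cases hs : x' ∈ φ.source
    · rw [hf1 x' hs]
      have : φ x' ∉ Metric.closedBall (φ x).1 r ×ˢ C := fun h => hx' (by
        simpa [φ.left_inv hs] using (hsub h).2)
      by_cases h1 : (φ x').1 ∈ Metric.closedBall (φ x).1 r
      · rw [hχ0 _ fun h2 => this ⟨h1, h2⟩, mul_zero]
      · rw [hb0 _ h1, zero_mul]
    · exact hf2 x' hs

/-- Convergence in `M` is tested by leafwise functions. -/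
theorem tendsto_of_leafwise [T2Space M] [LocallyCompactSpace Z] [T2Space Z] {ι : Type*}
    {l : Filter ι} {u : ι → M} {x : M}
    (h : ∀ f, A.IsLeafwiseFunction 3 f → Tendsto (fun i => f (u i)) l (𝓝 (f x))) :
    Tendsto u l (𝓝 x) := by
  intro U hU
  obtain ⟨f, hf, hfx, hf0⟩ := exists_leafwise_one (A := A) hU
  have := (h f hf).eventually (lt_mem_nhds (by rw [hfx]; exact zero_lt_one))
  refine Filter.mem_map.2 ?_
  filter_upwards [this] with i hi
  by_contra hiU
  rw [hf0 _ hiU] at hi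
  exact lt_irrefl _ hi

/-- Cutting off a leafwise function in the leaf direction. -/
theorem LeafC.cutoff {F : Type} [NormedAddCommGroup F] [NormedSpace ℝ F] {k : ℕ}
    {f : EuclideanSpace ℝ (Fin p) × Z → F} {B₁ : Set (EuclideanSpace ℝ (Fin p))} {B₂ : Set Z}
    (hB₁ : IsOpen B₁) (hB₂ : IsOpen B₂) (hf : LeafC k f (B₁ ×ˢ B₂))
    {b : EuclideanSpace ℝ (Fin p) → ℝ} (hb : ContDiff ℝ k b)
    {S : Set (EuclideanSpace ℝ (Fin p))} (hS : IsClosed S) (hSB : S ⊆ B₁) (hbS : ∀ y ∉ S, b y = 0) :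
    LeafC k (fun q => b q.1 • f q) (Set.univ ×ˢ B₂) := by
  refine LeafC.of_local fun q hq => ?_
  by_cases h : q.1 ∈ S
  · exact ⟨B₁ ×ˢ B₂, hB₁.prod hB₂, ⟨hSB h, hq.2⟩,
      (LeafC.of_fst hb).smul hf (hB₁.prod hB₂)⟩
  · have hU : IsOpen (Sᶜ ×ˢ (Set.univ : Set Z)) := hS.isOpen_compl.prod isOpen_univ
    refine ⟨_, hU, ⟨h, Set.mem_univ _⟩, ?_⟩
    exact (LeafC.const_snd (χ := fun _ => (0 : F)) continuousOn_const).congr hU fun r hr => by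
      simp only [hbS r.1 hr.1, zero_smul]

end Charts

end RoughFoliation

namespace RoughFoliation

/-! ### Solutions on the foliated space -/

section Solutions

variable {p d : ℕ} {M Z : Type*} [TopologicalSpace M] [TopologicalSpace Z] {A : FoliatedAtlas p M Z}

/-- The second-order expansion of `f` along the driver. -/
noncomputable def davieExp (V : Fin (d + 1) → A.LeafwiseVectorField 3) (X : Driver d) (f : M → ℝ)
    (s t : ℝ) (x : M) : ℝ :=
  ∑ i : Fin d, (V i.succ).apply f x * X.X1 s t i
    + ∑ j : Fin d, ∑ k : Fin d, (V j.succ).apply ((V k.succ).apply f) x * X.X2 s t j k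
    + (V 0).apply f x * (t - s)

/-- The Davie estimate for the function `f`, with constant `C`, on the interval `[a, b]`. -/
def DavieEstimate (V : Fin (d + 1) → A.LeafwiseVectorField 3) (X : Driver d) (α : ℝ) (x : ℝ → M)
    (f : M → ℝ) (C a b : ℝ) : Prop :=
  ∀ s t, a ≤ s → s ≤ t → t ≤ b →
    |f (x t) - f (x s) - davieExp V X f s t (x s)| ≤ C * (t - s) ^ (3 * α)

/-- Solutions of the rough differential equation on `[a, b]`. -/
def IsSol (V : Fin (d + 1) → A.LeafwiseVectorField 3) (X : Driver d) (α a b : ℝ)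
    (x : ℝ → M) : Prop :=
  ∀ f, A.IsLeafwiseFunction 3 f → ∃ C, DavieEstimate V X α x f C a b

variable {V : Fin (d + 1) → A.LeafwiseVectorField 3} {X : Driver d} {α R : ℝ}

theorem DavieEstimate.mono {x : ℝ → M} {f : M → ℝ} {C C' a b a' b' : ℝ}
    (h : DavieEstimate V X α x f C a b) (hC : C ≤ C') (ha : a ≤ a') (hb : b' ≤ b) :
    DavieEstimate V X α x f C' a' b' := fun s t has hst htb =>
  (h s t (ha.trans has) hst (htb.trans hb)).trans
    (mul_le_mul_of_nonneg_right hC (Real.rpow_nonneg (sub_nonneg.2 hst) _))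

theorem IsSol.mono {x : ℝ → M} {a b a' b' : ℝ} (h : IsSol V X α a b x) (ha : a ≤ a')
    (hb : b' ≤ b) : IsSol V X α a' b' x := fun f hf =>
  (h f hf).imp fun _ hC => hC.mono le_rfl ha hb

theorem apply_symm_eq_fderiv (W : A.LeafwiseVectorField 3) {f : M → ℝ}
    (hf : A.IsLeafwiseFunction 1 f) {φ} (hφ : φ ∈ A.charts) {y : EuclideanSpace ℝ (Fin p)} {z : Z}
    (hq : (y, z) ∈ φ.target) {g : EuclideanSpace ℝ (Fin p) → ℝ}
    (hg : g =ᶠ[𝓝 y] fun y => f (φ.symm (y, z))) :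
    W.apply f (φ.symm (y, z)) = fderiv ℝ g y (W.comp φ (φ.symm (y, z))) := by
  rw [apply_symm_eq W hf hφ hq, hg.fderiv_eq]
  rfl

/-- The expansion of a leafwise function, computed in a chart. -/
theorem davieExp_symm {f : M → ℝ} (hf : A.IsLeafwiseFunction 3 f) {φ} (hφ : φ ∈ A.charts)
    {B : Set (EuclideanSpace ℝ (Fin p))} {z : Z} (hB : IsOpen B) (hBz : ∀ y ∈ B, (y, z) ∈ φ.target)
    {W : Fin (d + 1) → EuclideanSpace ℝ (Fin p) → EuclideanSpace ℝ (Fin p)}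
    (hW : ∀ i, ∀ y ∈ B, W i y = (V i).comp φ (φ.symm (y, z)))
    {g : EuclideanSpace ℝ (Fin p) → ℝ} (hg : ∀ y ∈ B, g y = f (φ.symm (y, z)))
    {y : EuclideanSpace ℝ (Fin p)} (hy : y ∈ B) (s t : ℝ) :
    davieExp V X f s t (φ.symm (y, z)) = ∑ i : Fin d, fderiv ℝ g y (W i.succ y) * X.X1 s t i
      + ∑ j : Fin d, ∑ k : Fin d,
          fderiv ℝ (fun y => fderiv ℝ g y (W k.succ y)) y (W j.succ y) * X.X2 s t j k
      + fderiv ℝ g y (W 0 y) * (t - s) := by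
  have h1 : ∀ i, ∀ y ∈ B, fderiv ℝ g y (W i y) = (V i).apply f (φ.symm (y, z)) := by
    intro i y hy
    rw [apply_symm_eq_fderiv (V i) (IsLeafwiseFunction.of_le hf (by norm_num)) hφ (hBz y hy)
      (Filter.mem_of_superset (hB.mem_nhds hy) fun y' hy' => hg y' hy'), hW i y hy]
  have h2 : ∀ j k, fderiv ℝ (fun y => fderiv ℝ g y (W k y)) y (W j y)
      = (V j).apply ((V k).apply f) (φ.symm (y, z)) := by
    intro j k
    rw [apply_symm_eq_fderiv (V j) (IsLeafwiseFunction.of_le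
      (isLeafwiseFunction_apply (V k) (k := 2) (by norm_num) hf) (by norm_num)) hφ (hBz y hy)
      (Filter.mem_of_superset (hB.mem_nhds hy) fun y' hy' => h1 k y' hy'), hW j y hy]
  rw [davieExp]
  simp only [h1 _ y hy, h2]

/-- The expansion is bounded, uniformly over the space. -/
theorem exists_davieExp_bound [CompactSpace M] (V : Fin (d + 1) → A.LeafwiseVectorField 3)
    {f : M → ℝ} (hf : A.IsLeafwiseFunction 3 f) (hR : 0 ≤ R) :
    ∃ B, 0 ≤ B ∧ ∀ X : Driver d, X.IsRough α R → ∀ s t x, s ≤ t →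
      |davieExp V X f s t x| ≤ B * ((t - s) ^ α + (t - s) ^ (2 * α) + (t - s)) := by
  have hb : ∀ g : M → ℝ, Continuous g → ∃ C, 0 ≤ C ∧ ∀ x, |g x| ≤ C := by
    intro g hg
    obtain ⟨C, hC⟩ := isCompact_univ.exists_bound_of_continuousOn hg.continuousOn
    exact ⟨max C 0, le_max_right _ _, fun x => (hC x (Set.mem_univ x)).trans (le_max_left _ _)⟩
  have h1 : ∀ i, A.IsLeafwiseFunction 2 ((V i).apply f) := fun i =>
    isLeafwiseFunction_apply (V i) (by norm_num) hf
  have h2 : ∀ i j, A.IsLeafwiseFunction 1 ((V i).apply ((V j).apply f)) := fun i j =>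
    isLeafwiseFunction_apply (V i) (by norm_num) (h1 j)
  choose C1 hC10 hC1 using fun i => hb _ (IsLeafwiseFunction.continuous (h1 i))
  choose C2 hC20 hC2 using fun i j => hb _ (IsLeafwiseFunction.continuous (h2 i j))
  have hS1 : 0 ≤ ∑ i : Fin d, C1 i.succ * R := Finset.sum_nonneg fun i _ => mul_nonneg (hC10 _) hR
  have hS2 : 0 ≤ ∑ j : Fin d, ∑ k : Fin d, C2 j.succ k.succ * R :=
    Finset.sum_nonneg fun j _ => Finset.sum_nonneg fun k _ => mul_nonneg (hC20 _ _) hR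
  refine ⟨∑ i : Fin d, C1 i.succ * R + ∑ j : Fin d, ∑ k : Fin d, C2 j.succ k.succ * R + C1 0,
    by have := hC10 0; positivity, ?_⟩
  intro X hX s t x hst
  have h0 : 0 ≤ t - s := sub_nonneg.2 hst
  have hA1 := Real.rpow_nonneg h0 α
  have hA2 := Real.rpow_nonneg h0 (2 * α)
  have b1 : |∑ i : Fin d, (V i.succ).apply f x * X.X1 s t i|
      ≤ (∑ i : Fin d, C1 i.succ * R) * (t - s) ^ α := by
    rw [Finset.sum_mul]
    refine (Finset.abs_sum_le_sum_abs _ _).trans (Finset.sum_le_sum fun i _ => ?_)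
    rw [abs_mul, mul_assoc]
    exact mul_le_mul (hC1 _ x) (hX.bound1 s t hst i) (abs_nonneg _) (hC10 _)
  have b2 : |∑ j : Fin d, ∑ k : Fin d, (V j.succ).apply ((V k.succ).apply f) x * X.X2 s t j k|
      ≤ (∑ j : Fin d, ∑ k : Fin d, C2 j.succ k.succ * R) * (t - s) ^ (2 * α) := by
    rw [Finset.sum_mul]
    refine (Finset.abs_sum_le_sum_abs _ _).trans (Finset.sum_le_sum fun j _ => ?_)
    rw [Finset.sum_mul]
    refine (Finset.abs_sum_le_sum_abs _ _).trans (Finset.sum_le_sum fun k _ => ?_)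
    rw [abs_mul, mul_assoc]
    exact mul_le_mul (hC2 _ _ x) (hX.bound2 s t hst j k) (abs_nonneg _) (hC20 _ _)
  have b3 : |(V 0).apply f x * (t - s)| ≤ C1 0 * (t - s) := by
    rw [abs_mul, abs_of_nonneg h0]
    exact mul_le_mul_of_nonneg_right (hC1 0 x) h0
  have h10 := hC10 0
  refine (abs_add_three _ _ _).trans ((add_le_add_three b1 b2 b3).trans ?_)
  generalize (∑ i : Fin d, C1 i.succ * R) = S1 at *
  generalize (∑ j : Fin d, ∑ k : Fin d, C2 j.succ k.succ * R) = S2 at *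
  nlinarith [mul_nonneg hS1 hA2, mul_nonneg hS1 h0, mul_nonneg hS2 hA1, mul_nonneg hS2 h0,
    mul_nonneg h10 hA1, mul_nonneg h10 hA2]

/-- Functions of a solution are Hölder continuous, with constants that depend only on those
of the Davie estimates. -/
theorem exists_holder_of_davie [CompactSpace M] (V : Fin (d + 1) → A.LeafwiseVectorField 3)
    {f : M → ℝ} (hf : A.IsLeafwiseFunction 3 f) (hα : 0 < α) (hα' : α ≤ 1 / 2) (hR : 0 ≤ R)
    (C : ℝ) : ∃ B, 0 ≤ B ∧ ∀ X : Driver d, X.IsRough α R → ∀ (x : ℝ → M) (a b : ℝ),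
      DavieEstimate V X α x f C a b → ∀ s t, s ∈ Set.Icc a b → t ∈ Set.Icc a b → |t - s| ≤ 1 →
      |f (x t) - f (x s)| ≤ B * |t - s| ^ α := by
  obtain ⟨B, hB0, hB⟩ := exists_davieExp_bound (α := α) V hf hR
  refine ⟨3 * B + |C|, by positivity, fun X hX x a b hx => ?_⟩
  have key : ∀ s t, s ∈ Set.Icc a b → t ∈ Set.Icc a b → s ≤ t → |t - s| ≤ 1 →
      |f (x t) - f (x s)| ≤ (3 * B + |C|) * |t - s| ^ α := by
    intro s t hs ht hst hts
    have h0 : 0 ≤ t - s := sub_nonneg.2 hst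
    rw [abs_of_nonneg h0] at hts ⊢
    have h1 := hx s t hs.1 hst ht.2
    have h2 := hB X hX s t (x s) hst
    have h3 : ∀ β, α ≤ β → (t - s) ^ β ≤ (t - s) ^ α := fun β hβ =>
      Real.rpow_le_rpow_of_exponent_ge_of_imp h0 hts hβ (by intro _ h; linarith)
    have h4 := h3 (2 * α) (by linarith)
    have h5 := h3 1 (by linarith)
    have h6 := h3 (3 * α) (by linarith)
    rw [Real.rpow_one] at h5
    have hA := Real.rpow_nonneg h0 α
    have h8 : C * (t - s) ^ (3 * α) ≤ |C| * (t - s) ^ α :=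
      (mul_le_mul_of_nonneg_right (le_abs_self C) (Real.rpow_nonneg h0 _)).trans
        (mul_le_mul_of_nonneg_left h6 (abs_nonneg C))
    have h9 : |f (x t) - f (x s)| ≤ |f (x t) - f (x s) - davieExp V X f s t (x s)|
        + |davieExp V X f s t (x s)| := by
      simpa using abs_add_le (f (x t) - f (x s) - davieExp V X f s t (x s))
        (davieExp V X f s t (x s))
    nlinarith [mul_le_mul_of_nonneg_left h4 hB0, mul_le_mul_of_nonneg_left h5 hB0]
  intro s t hs ht hts
  rcases le_total s t with h | h
  · exact key s t hs ht h hts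
  · have := key t s ht hs h (by rwa [abs_sub_comm])
    rwa [abs_sub_comm (f (x s)), abs_sub_comm s] at this

variable [CompactSpace M] [T2Space M] [LocallyCompactSpace Z] [T2Space Z]

theorem tendsto_const_mul_abs_sub_rpow {B s : ℝ} (hα : 0 < α) :
    Tendsto (fun t => B * |t - s| ^ α) (𝓝 s) (𝓝 0) := by
  have h1 : Tendsto (fun t => |t - s|) (𝓝 s) (𝓝 0) := by
    have : Tendsto (fun t => |t - s|) (𝓝 s) (𝓝 |s - s|) :=
      (by fun_prop : Continuous fun t => |t - s|).tendsto s
    simpa using this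
  have h2 := (h1.rpow_const (p := α) (Or.inr hα.le)).const_mul B
  simpa [Real.zero_rpow hα.ne'] using h2

/-- Continuity is automatic: every leafwise function is Hölder along a solution, and leafwise
functions determine the topology of M. Limits of solutions are thus known to be continuous as soon
as they satisfy Davie estimates. -/
theorem IsSol.continuousOn (hα : 0 < α) (hα' : α ≤ 1 / 2) (hR : 0 ≤ R) (hX : X.IsRough α R)
    {a b : ℝ} {x : ℝ → M} (hx : IsSol V X α a b x) : ContinuousOn x (Set.Icc a b) := by
  intro s hs
  refine tendsto_of_leafwise (A := A) fun f hf => ?_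
  obtain ⟨C, hC⟩ := hx f hf
  obtain ⟨B, hB0, hB⟩ := exists_holder_of_davie V hf hα hα' hR C
  rw [tendsto_iff_dist_tendsto_zero]
  refine squeeze_zero' (Filter.Eventually.of_forall fun _ => dist_nonneg) ?_
    ((tendsto_const_mul_abs_sub_rpow (B := B) (s := s) hα).mono_left nhdsWithin_le_nhds)
  have h1 : ∀ᶠ t in 𝓝[Set.Icc a b] s, |t - s| < 1 := by
    refine nhdsWithin_le_nhds ?_
    have := Metric.ball_mem_nhds s one_pos
    filter_upwards [this] with t ht
    rwa [Metric.mem_ball, Real.dist_eq] at ht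
  filter_upwards [h1, self_mem_nhdsWithin] with t ht hts
  rw [Real.dist_eq]
  exact hB X hX x a b hC s t hs hts ht.le

/-- A function of one real variable that is Hölder continuous with exponent above `1`
is constant. -/
theorem eq_of_abs_sub_le_rpow {h : ℝ → ℝ} {C β a b : ℝ} (hβ : 1 < β)
    (hh : ∀ s t, a ≤ s → s ≤ t → t ≤ b → |h t - h s| ≤ C * (t - s) ^ β) {t : ℝ} (hat : a ≤ t)
    (htb : t ≤ b) : h t = h a := by
  have hρ : (1 / 2 : ℝ) ^ β = (1 / 2) ^ (β - 1) * (1 / 2) := by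
    have := Real.rpow_add_one (by norm_num : (1 / 2 : ℝ) ≠ 0) (β - 1)
    rwa [sub_add_cancel] at this
  have hρ1 : (1 / 2 : ℝ) ^ (β - 1) < 1 :=
    Real.rpow_lt_one (by norm_num) (by norm_num) (by linarith)
  set ρ := (1 / 2 : ℝ) ^ (β - 1)
  have hρ0 : 0 ≤ ρ := Real.rpow_nonneg (by norm_num) _
  -- Bisection at the midpoint improves the constant by the factor ρ = 2^(1 - β) < 1 each time.
  have hn : ∀ n : ℕ, ∀ s t, a ≤ s → s ≤ t → t ≤ b → |h t - h s| ≤ C * ρ ^ n * (t - s) ^ β := by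
    intro n
    induction n with
    | zero => simpa using hh
    | succ n ih =>
      intro s t has hst htb
      have i1 := ih s ((s + t) / 2) has (by linarith) (by linarith)
      have i2 := ih ((s + t) / 2) t (by linarith) (by linarith) htb
      rw [show (s + t) / 2 - s = 1 / 2 * (t - s) by ring,
        Real.mul_rpow (by norm_num) (sub_nonneg.2 hst), hρ] at i1
      rw [show t - (s + t) / 2 = 1 / 2 * (t - s) by ring,
        Real.mul_rpow (by norm_num) (sub_nonneg.2 hst), hρ] at i2
      have := abs_sub_le (h t) (h ((s + t) / 2)) (h s)
      calc _ ≤ _ := this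
        _ ≤ _ := add_le_add i2 i1
        _ = _ := by ring
  have hlim : Tendsto (fun n : ℕ => C * ρ ^ n * (t - a) ^ β) atTop (𝓝 (C * 0 * (t - a) ^ β)) :=
    ((tendsto_pow_atTop_nhds_zero_of_lt_one hρ0 hρ1).const_mul _).mul_const _
  rw [mul_zero, zero_mul] at hlim
  have := ge_of_tendsto' hlim fun n => hn n a t le_rfl hat htb
  exact sub_eq_zero.1 (abs_nonpos_iff.1 this)

end Solutions

end RoughFoliation

/-! ### Local existence, and reduction of solutions to Euclidean space in a chart -/

namespace RoughFoliation

section LocalSolutions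

variable {p d : ℕ} {M Z : Type*} [TopologicalSpace M] [TopologicalSpace Z] {A : FoliatedAtlas p M Z}
  {X : Driver d} {α R : ℝ}

/-- In a box of a foliated chart, vector fields and functions extend in the leaf direction to
globally defined ones with uniformly bounded derivatives. -/
theorem exists_local_fields [LocallyCompactSpace Z] (V : Fin (d + 1) → A.LeafwiseVectorField 3)
    (x₀ : M) : ∃ φ ∈ A.charts, x₀ ∈ φ.source ∧ ∃ (B₂ C : Set Z) (r K : ℝ)
      (W : Z → Fin (d + 1) → EuclideanSpace ℝ (Fin p) → EuclideanSpace ℝ (Fin p)),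
      IsOpen B₂ ∧ 0 < r ∧ Metric.closedBall (φ x₀).1 (3 * r) ×ˢ B₂ ⊆ φ.target ∧ IsCompact C ∧
      C ⊆ B₂ ∧ C ∈ 𝓝 (φ x₀).2 ∧ 0 ≤ K ∧ (∀ z ∈ C, ∀ i, CB 3 K (W z i)) ∧
      (∀ z, ∀ i, ∀ y ∈ Metric.ball (φ x₀).1 (2 * r), W z i y = (V i).comp φ (φ.symm (y, z))) ∧
      ∀ f, A.IsLeafwiseFunction 3 f → ∃ K' : ℝ, 0 ≤ K' ∧ ∀ z ∈ C,
        ∃ g : EuclideanSpace ℝ (Fin p) → ℝ, CB 3 K' g ∧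
        ∀ y ∈ Metric.ball (φ x₀).1 (2 * r), g y = f (φ.symm (y, z)) := by
  obtain ⟨φ, hφ, hx⟩ := A.cover x₀
  obtain ⟨B₁, B₂, C, r, hB₁, hB₂, htar, hr, hball, hC, hCB, hCn⟩ := exists_box hφ hx
  -- The cutoff acts in the leaf direction only: it is 1 on the ball of radius 2r, where the fields
  -- are left unchanged, and vanishes off the ball of radius 3r, which still lies in the chart.
  -- Compactness of C makes the bounds uniform over the plaques.
  let b : ContDiffBump (φ x₀).1 := ⟨2 * r, 3 * r, by positivity, by linarith⟩
  have hb0 : ∀ y ∉ Metric.closedBall (φ x₀).1 (3 * r), b y = 0 := fun y hy => by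
    refine b.zero_of_le_dist ?_
    rw [Metric.mem_closedBall, not_le] at hy
    exact hy.le
  have hb1 : ∀ y ∈ Metric.ball (φ x₀).1 (2 * r), b y = 1 := fun y hy =>
    b.one_of_mem_closedBall (Metric.ball_subset_closedBall hy)
  have key : ∀ {F : Type} [NormedAddCommGroup F] [NormedSpace ℝ F]
      {f : EuclideanSpace ℝ (Fin p) × Z → F}, LeafC 3 f φ.target →
      ∃ K, 0 ≤ K ∧ ∀ z ∈ C, CB 3 K (fun y => b y • f (y, z)) := by
    intro F _ _ f hf
    rw [htar] at hf
    exact (LeafC.cutoff hB₁ hB₂ hf (b.contDiff (n := 3)) Metric.isClosed_closedBall hball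
      hb0).exists_CB hC hCB (isCompact_closedBall (φ x₀).1 (3 * r)) fun y hy z _ => by
        rw [hb0 y hy, zero_smul]
  choose K hK0 hK using fun i => key (leafC_comp (V i) hφ)
  refine ⟨φ, hφ, hx, B₂, C, r, ∑ i, K i, fun z i y => b y • (V i).comp φ (φ.symm (y, z)), hB₂, hr,
    htar ▸ Set.prod_mono hball le_rfl, hC, hCB, hCn, Finset.sum_nonneg fun i _ => hK0 i,
    fun z hz i => (hK i z hz).mono (Finset.single_le_sum (fun i _ => hK0 i) (Finset.mem_univ i)),
    fun z i y hy => by simp only [hb1 y hy, one_smul], fun f hf => ?_⟩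
  obtain ⟨K', hK'0, hK'⟩ := key (isLeafwiseFunction_iff.1 hf φ hφ)
  exact ⟨K', hK'0, fun z hz => ⟨_, hK' z hz, fun y hy => by simp only [hb1 y hy, one_smul]⟩⟩

/-- Local existence, with constants that are uniform over the driver, the starting time and the
starting point. -/
theorem exists_local_solution [LocallyCompactSpace Z] (hα : 1 / 3 < α) (hα' : α ≤ 1 / 2)
    (hR : 0 ≤ R) (V : Fin (d + 1) → A.LeafwiseVectorField 3) (x₀ : M) :
    ∃ U ∈ 𝓝 x₀, ∃ δ, 0 < δ ∧ δ ≤ 1 ∧ ∃ Cf : (M → ℝ) → ℝ, ∀ X : Driver d, X.IsRough α R →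
      ∀ (a : ℝ), ∀ m ∈ U, ∃ x : ℝ → M, x a = m ∧ (∀ t ∈ Set.Icc a (a + δ), x t ∈ A.leaf m) ∧
        ∀ f, A.IsLeafwiseFunction 3 f → DavieEstimate V X α x f (Cf f) a (a + δ) := by
  have hα0 : 0 < α := by linarith
  obtain ⟨φ, hφ, hx₀, B₂, C, r, K, W, hB₂, hr, hbox, hC, hCB, hCn, hK0, hK, hW, hf⟩ :=
    exists_local_fields V x₀
  obtain ⟨δ₀, L, hδ₀, hδ₀1, hL0, hsol⟩ := exists_davie_solution hα hα' hK0 hR d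
  have hc₁ := eulerConst_nonneg (d := d) hK0 hR
  -- Within time δ₁ a Davie solution moves by at most r. Started in the ball of radius r, it remains
  -- in the ball of radius 2r, where the cut-off fields agree with the given ones.
  obtain ⟨δ₁, hδ₁, hδ₁1, hδ₁r⟩ := exists_delta (add_nonneg hc₁ hL0) hr hα0
  have hCf : ∀ f, ∃ L', A.IsLeafwiseFunction 3 f → ∀ X : Driver d, X.IsRough α R → ∀ z ∈ C,
      ∀ s t, s ≤ t → t - s ≤ 1 → ∀ y y', y ∈ Metric.ball (φ x₀).1 (2 * r) →
      y' ∈ Metric.ball (φ x₀).1 (2 * r) →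
      ‖y' - y - eulerIncr (fun i => W z i.succ) (W z 0) X s t y‖ ≤ L * (t - s) ^ (3 * α) →
      |f (φ.symm (y', z)) - f (φ.symm (y, z)) - davieExp V X f s t (φ.symm (y, z))|
        ≤ L' * (t - s) ^ (3 * α) := by
    intro f
    by_cases hff : A.IsLeafwiseFunction 3 f
    · obtain ⟨K', hK'0, hK'⟩ := hf f hff
      obtain ⟨L', hL'0, hL'⟩ := exists_ito_bound hα0 hα' hK0 hR d hK'0 hL0
      refine ⟨L', fun _ X hX z hz s t hst hts y y' hy hy' hyy => ?_⟩
      obtain ⟨g, hg, hgf⟩ := hK' z hz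
      rw [davieExp_symm hff hφ Metric.isOpen_ball (fun y hy => hbox ⟨?_, hCB hz⟩) (hW z) hgf hy,
        ← hgf y hy, ← hgf y' hy']
      · exact hL' (fun i => hK z hz i.succ) (hK z hz 0) hX hg hst hts hyy
      · rw [Metric.mem_ball] at hy
        rw [Metric.mem_closedBall]
        linarith
    · exact ⟨0, fun h => absurd h hff⟩
  choose Cf hCf using hCf
  refine ⟨φ.source ∩ φ ⁻¹' (Metric.ball (φ x₀).1 r ×ˢ C), ?_, min δ₀ δ₁, lt_min hδ₀ hδ₁,
    (min_le_left _ _).trans hδ₀1, Cf, ?_⟩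
  · refine Filter.inter_mem (φ.open_source.mem_nhds hx₀) ((φ.continuousAt hx₀).preimage_mem_nhds ?_)
    exact prod_mem_nhds (Metric.ball_mem_nhds _ hr) hCn
  · rintro X hX a m ⟨hms, hmb, hmC⟩
    set z := (φ m).2 with hz
    obtain ⟨y, hya, hy⟩ := hsol (fun i : Fin d => hK z hmC i.succ) (hK z hmC 0) hX a (φ m).1
    have hball : ∀ t ∈ Set.Icc a (a + min δ₀ δ₁), y t ∈ Metric.ball (φ x₀).1 (2 * r) := by
      intro t ht
      have h1 := hy a t le_rfl ht.1 (ht.2.trans (by gcongr; exact min_le_left _ _))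
      have hta : t - a ≤ δ₁ := by have := min_le_right δ₀ δ₁; linarith [ht.2]
      have h0 : 0 ≤ t - a := sub_nonneg.2 ht.1
      have h2 := (CB_eulerIncr hα0 hα' (fun i : Fin d => hK z hmC i.succ) (hK z hmC 0) hR hX ht.1
        hta hδ₁1).norm_le (y a)
      have h3 : (t - a) ^ (3 * α) ≤ δ₁ ^ α := by
        refine (Real.rpow_le_rpow h0 hta (by positivity)).trans ?_
        exact Real.rpow_le_rpow_of_exponent_ge hδ₁ hδ₁1 (by linarith)
      have h4 : ‖y t - y a‖ ≤ r := by
        calc _ = ‖(y t - y a - eulerIncr (fun i => W z i.succ) (W z 0) X a t (y a))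
              + eulerIncr (fun i => W z i.succ) (W z 0) X a t (y a)‖ := by rw [sub_add_cancel]
          _ ≤ L * δ₁ ^ α + eulerConst d K R * δ₁ ^ α :=
              (norm_add_le _ _).trans (add_le_add (h1.trans (by gcongr)) h2)
          _ ≤ r := by linarith
      rw [Metric.mem_ball] at hmb ⊢
      have h5 := dist_triangle (y t) (y a) (φ x₀).1
      rw [dist_eq_norm (y t) (y a)] at h5
      rw [← hya] at hmb
      linarith
    have htar : ∀ t ∈ Set.Icc a (a + min δ₀ δ₁), (y t, z) ∈ φ.target := fun t ht => by
      have := hball t ht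
      rw [Metric.mem_ball] at this
      exact hbox ⟨Metric.mem_closedBall.2 (by linarith), hCB hmC⟩
    refine ⟨fun t => φ.symm (y t, z), ?_, fun t ht => ?_, fun f hff s t has hst hta => ?_⟩
    · simp only [hya, hz, Prod.mk.eta]
      exact φ.left_inv hms
    · refine Relation.TransGen.single ⟨{x | x ∈ φ.source ∧ (φ x).2 = z}, ⟨φ, hφ, z, rfl⟩,
        ⟨hms, rfl⟩, φ.map_target (htar t ht), ?_⟩
      rw [φ.right_inv (htar t ht)]
    · refine hCf f hff X hX z hmC s t hst ?_ (y s) (y t) (hball s ⟨has, hst.trans hta⟩)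
        (hball t ⟨has.trans hst, hta⟩) (hy s t has hst (hta.trans (by gcongr; exact min_le_left _ _)))
      have := (min_le_left δ₀ δ₁).trans hδ₀1
      linarith

variable [CompactSpace M] [T2Space M] [LocallyCompactSpace Z] [T2Space Z]
  {V : Fin (d + 1) → A.LeafwiseVectorField 3}

omit [CompactSpace M] in
/-- A solution that remains in a box of a chart moves in a single plaque. -/
theorem IsSol.snd_eq (hα : 1 / 3 < α) {φ} (hφ : φ ∈ A.charts) {y₀ : EuclideanSpace ℝ (Fin p)}
    {B₂ : Set Z} {r : ℝ} (hr : 0 < r) (hB₂ : IsOpen B₂)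
    (hbox : Metric.closedBall y₀ (3 * r) ×ˢ B₂ ⊆ φ.target) {a b : ℝ} {x : ℝ → M}
    (hx : IsSol V X α a b x) (hxs : ∀ t ∈ Set.Icc a b, x t ∈ φ.source)
    (hxb : ∀ t ∈ Set.Icc a b, φ (x t) ∈ Metric.ball y₀ r ×ˢ B₂) {t : ℝ} (ht : t ∈ Set.Icc a b) :
    (φ (x t)).2 = (φ (x a)).2 := by
  have ha : a ∈ Set.Icc a b := ⟨le_rfl, ht.1.trans ht.2⟩
  by_contra hne
  -- A transverse cutoff that is 1 on the initial plaque and vanishes on the plaque supposedly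
  -- reached at time t.
  obtain ⟨χ, hχ1, hχc, hχs, -⟩ := exists_continuousMap_one_of_isCompact_subset_isOpen
    (isCompact_singleton (x := (φ (x a)).2)) (hB₂.inter (isOpen_compl_singleton (x := (φ (x t)).2)))
    (Set.singleton_subset_iff.2 ⟨(hxb a ha).2, fun h => hne h.symm⟩)
  let b' : ContDiffBump y₀ := ⟨r, 2 * r, hr, by linarith⟩
  have hb0 : ∀ y ∉ Metric.closedBall y₀ (2 * r), b' y = 0 := fun y hy => by
    refine b'.zero_of_le_dist ?_
    rw [Metric.mem_closedBall, not_le] at hy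
    exact hy.le
  have hb1 : ∀ y ∈ Metric.ball y₀ r, b' y = 1 := fun y hy =>
    b'.one_of_mem_closedBall (Metric.ball_subset_closedBall hy)
  have hχ0 : ∀ z ∉ tsupport χ, χ z = 0 := fun z hz => image_eq_zero_of_notMem_tsupport hz
  obtain ⟨f, hf, hf1, -⟩ := exists_leafwise_bump hφ (b'.contDiff (n := 3)) χ.continuous
    (isCompact_closedBall y₀ (2 * r)) hχc ((Set.prod_mono (Metric.closedBall_subset_closedBall
      (by linarith)) (hχs.trans Set.inter_subset_left)).trans hbox) hb0 hχ0
  have hfx : ∀ s ∈ Set.Icc a b, f (x s) = χ (φ (x s)).2 := fun s hs => by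
    rw [hf1 _ (hxs s hs), hb1 _ (hxb s hs).1, one_mul]
  -- Near the solution the test function depends on the transverse variable only, so all its
  -- leafwise derivatives vanish and the Davie estimate becomes an increment bound with exponent 3α
  -- > 1.
  have hexp : ∀ s ∈ Set.Icc a b, ∀ t, davieExp V X f s t (x s) = 0 := by
    intro s hs t
    have h1 : x s = φ.symm ((φ (x s)).1, (φ (x s)).2) := by
      rw [Prod.mk.eta, φ.left_inv (hxs s hs)]
    have htar : ∀ y ∈ Metric.ball y₀ r, (y, (φ (x s)).2) ∈ φ.target := fun y hy =>
      hbox ⟨Metric.mem_closedBall.2 (by rw [Metric.mem_ball] at hy; linarith), (hxb s hs).2⟩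
    rw [h1, davieExp_symm hf hφ Metric.isOpen_ball htar (W := fun i y => (V i).comp φ
      (φ.symm (y, (φ (x s)).2))) (fun _ _ _ => rfl) (g := fun _ => χ (φ (x s)).2) (fun y hy => ?_)
      (hxb s hs).1]
    · simp
    · rw [hf1 _ (φ.map_target (htar y hy)), φ.right_inv (htar y hy), hb1 y hy, one_mul]
  obtain ⟨C, hC⟩ := hx f hf
  have h2 := eq_of_abs_sub_le_rpow (h := fun t => f (x t)) (C := C) (β := 3 * α) (a := a) (b := b)
    (by linarith) (fun s t has hst htb => by
      have := hC s t has hst htb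
      rwa [hexp s ⟨has, hst.trans htb⟩, sub_zero] at this) ht.1 ht.2
  simp only [hfx t ht, hfx a ha] at h2
  rw [hχ1 rfl, hχ0 _ fun h => (hχs h).2 rfl] at h2
  exact zero_ne_one h2

omit [CompactSpace M] in
/-- In a chart, solutions satisfy the Davie estimate in Euclidean space. -/
theorem IsSol.exists_davie_chart (hα : 1 / 3 < α) {φ} (hφ : φ ∈ A.charts)
    {y₀ : EuclideanSpace ℝ (Fin p)} {B₂ : Set Z} {r : ℝ} (hr : 0 < r) (hB₂ : IsOpen B₂)
    (hbox : Metric.closedBall y₀ (3 * r) ×ˢ B₂ ⊆ φ.target) {a b : ℝ} {x : ℝ → M}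
    (hx : IsSol V X α a b x) (hxs : ∀ t ∈ Set.Icc a b, x t ∈ φ.source)
    (hxb : ∀ t ∈ Set.Icc a b, φ (x t) ∈ Metric.ball y₀ r ×ˢ B₂)
    {W : Fin (d + 1) → EuclideanSpace ℝ (Fin p) → EuclideanSpace ℝ (Fin p)}
    (hWd : ∀ i, Differentiable ℝ (W i))
    (hW : ∀ i, ∀ y ∈ Metric.ball y₀ r, W i y = (V i).comp φ (φ.symm (y, (φ (x a)).2))) :
    ∃ C, 0 ≤ C ∧ ∀ s t, a ≤ s → s ≤ t → t ≤ b → ‖(φ (x t)).1 - (φ (x s)).1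
      - eulerIncr (fun i => W i.succ) (W 0) X s t (φ (x s)).1‖ ≤ C * (t - s) ^ (3 * α) := by
  by_cases hab : a ≤ b
  swap
  · exact ⟨0, le_rfl, fun s t h1 h2 h3 => absurd (h1.trans (h2.trans h3)) hab⟩
  have ha : a ∈ Set.Icc a b := ⟨le_rfl, hab⟩
  set z := (φ (x a)).2 with hz
  have hsnd : ∀ t ∈ Set.Icc a b, (φ (x t)).2 = z := fun t ht =>
    hx.snd_eq hα hφ hr hB₂ hbox hxs hxb ht
  obtain ⟨χ, hχ1, hχc, hχs, -⟩ := exists_continuousMap_one_of_isCompact_subset_isOpen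
    (isCompact_singleton (x := z)) hB₂ (Set.singleton_subset_iff.2 (hxb a ha).2)
  let b' : ContDiffBump y₀ := ⟨r, 2 * r, hr, by linarith⟩
  have hb0 : ∀ y ∉ Metric.closedBall y₀ (2 * r), b' y = 0 := fun y hy => by
    refine b'.zero_of_le_dist ?_
    rw [Metric.mem_closedBall, not_le] at hy
    exact hy.le
  have hb1 : ∀ y ∈ Metric.ball y₀ r, b' y = 1 := fun y hy =>
    b'.one_of_mem_closedBall (Metric.ball_subset_closedBall hy)
  have hχ0 : ∀ z ∉ tsupport χ, χ z = 0 := fun z hz => image_eq_zero_of_notMem_tsupport hz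
  have htar : ∀ y ∈ Metric.ball y₀ r, (y, z) ∈ φ.target := fun y hy =>
    hbox ⟨Metric.mem_closedBall.2 (by rw [Metric.mem_ball] at hy; linarith), (hxb a ha).2⟩
  have hl : ∀ l : Fin p, ∃ C, ∀ s t, a ≤ s → s ≤ t → t ≤ b → |((φ (x t)).1 - (φ (x s)).1
      - eulerIncr (fun i => W i.succ) (W 0) X s t (φ (x s)).1) l| ≤ C * (t - s) ^ (3 * α) := by
    intro l
    let π : EuclideanSpace ℝ (Fin p) →L[ℝ] ℝ := EuclideanSpace.proj l
    have hπ : ∀ y, π y = y l := fun y => rfl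
    -- The test function is the l-th leaf coordinate, cut off in both directions. On the plaque of
    -- the solution, inside the ball of radius r, it equals the linear form π, so its expansion is
    -- the l-th component of the Euler increment.
    obtain ⟨f, hf, hf1, -⟩ := exists_leafwise_bump hφ (b := fun y => b' y * π y)
      ((b'.contDiff (n := 3)).mul π.contDiff) χ.continuous
      (isCompact_closedBall y₀ (2 * r)) hχc ((Set.prod_mono (Metric.closedBall_subset_closedBall
        (by linarith)) hχs).trans hbox) (fun y hy => by rw [hb0 y hy, zero_mul]) hχ0
    obtain ⟨C, hC⟩ := hx f hf
    refine ⟨C, fun s t has hst htb => ?_⟩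
    have hs : s ∈ Set.Icc a b := ⟨has, hst.trans htb⟩
    have ht : t ∈ Set.Icc a b := ⟨has.trans hst, htb⟩
    have hfx : ∀ s ∈ Set.Icc a b, f (x s) = π (φ (x s)).1 := fun s hs => by
      rw [hf1 _ (hxs s hs), hb1 _ (hxb s hs).1, hsnd s hs, hχ1 rfl]
      simp
    have h1 : x s = φ.symm ((φ (x s)).1, z) := by
      rw [← hsnd s hs, Prod.mk.eta, φ.left_inv (hxs s hs)]
    have hexp : davieExp V X f s t (x s)
        = π (eulerIncr (fun i => W i.succ) (W 0) X s t (φ (x s)).1) := by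
      conv_lhs => rw [h1]
      rw [davieExp_symm hf hφ Metric.isOpen_ball htar hW (g := fun y => π y) (fun y hy => ?_)
        (hxb s hs).1]
      · have e1 : ∀ y, fderiv ℝ (fun y => π y) y = π := fun y => π.fderiv
        have e2 : ∀ k y, fderiv ℝ (fun y => π (W k y)) y = π.comp (fderiv ℝ (W k) y) := fun k y =>
          (π.hasFDerivAt.comp y (hWd k y).hasFDerivAt).fderiv
        simp only [e1, e2, eulerIncr, map_add, map_sum, map_smul, smul_eq_mul,
          ContinuousLinearMap.comp_apply, mul_comm]
      · rw [hf1 _ (φ.map_target (htar y hy)), φ.right_inv (htar y hy), hb1 y hy, hχ1 rfl]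
        simp
    have h2 := hC s t has hst htb
    rw [hexp, hfx t ht, hfx s hs, ← map_sub, ← map_sub] at h2
    exact h2
  choose C hC using hl
  refine ⟨∑ l, |C l|, Finset.sum_nonneg fun _ _ => abs_nonneg _, fun s t has hst htb => ?_⟩
  have hP := Real.rpow_nonneg (sub_nonneg.2 hst) (3 * α)
  rw [Finset.sum_mul]
  refine le_trans ?_ (Finset.sum_le_sum fun l _ => (hC l s t has hst htb).trans
    (mul_le_mul_of_nonneg_right (le_abs_self _) hP))
  rw [EuclideanSpace.norm_eq]
  refine Real.sqrt_le_iff.2 ⟨Finset.sum_nonneg fun _ _ => abs_nonneg _, ?_⟩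
  simpa using Finset.sum_sq_le_sq_sum_of_nonneg (s := Finset.univ) (f := fun l => |((φ (x t)).1
    - (φ (x s)).1 - eulerIncr (fun i => W i.succ) (W 0) X s t (φ (x s)).1) l|)
    (fun _ _ => abs_nonneg _)

end LocalSolutions

end RoughFoliation

/-! ### Global uniqueness and existence -/

namespace RoughFoliation

section GlobalSolutions

variable {p d : ℕ} {M Z : Type*} [TopologicalSpace M] [TopologicalSpace Z] {A : FoliatedAtlas p M Z}
  {X : Driver d} {α R : ℝ} [CompactSpace M] [T2Space M] [LocallyCompactSpace Z] [T2Space Z]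
  {V : Fin (d + 1) → A.LeafwiseVectorField 3}

/-- Solutions that agree at a time agree shortly afterwards. -/
theorem IsSol.eventuallyEq (hα : 1 / 3 < α) (hα' : α ≤ 1 / 2) (hR : 0 ≤ R) (hX : X.IsRough α R)
    {a b : ℝ} {x x' : ℝ → M} (hx : IsSol V X α a b x) (hx' : IsSol V X α a b x') (hab : a < b)
    (ha : x a = x' a) : ∃ c > a, c ≤ b ∧ ∀ t ∈ Set.Icc a c, x t = x' t := by
  have hα0 : 0 < α := by linarith
  obtain ⟨φ, hφ, hxs, B₂, C, r, K, W, hB₂, hr, hbox, hC, hCB, hCn, hK0, hK, hW, -⟩ :=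
    exists_local_fields V (x a)
  have hU : φ.source ∩ φ ⁻¹' (Metric.ball (φ (x a)).1 r ×ˢ B₂) ∈ 𝓝 (x a) := by
    refine Filter.inter_mem (φ.open_source.mem_nhds hxs)
      ((φ.continuousAt hxs).preimage_mem_nhds ?_)
    exact prod_mem_nhds (Metric.ball_mem_nhds _ hr) (Filter.mem_of_superset hCn hCB)
  have hstay : ∀ y : ℝ → M, IsSol V X α a b y → y a = x a → ∃ ε > 0, ∀ t ∈ Set.Icc a b, t < a + ε →
      y t ∈ φ.source ∩ φ ⁻¹' (Metric.ball (φ (x a)).1 r ×ˢ B₂) := by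
    intro y hy hya
    have h1 := hy.continuousOn hα0 hα' hR hX a ⟨le_rfl, hab.le⟩
    have h2 := h1.preimage_mem_nhdsWithin (by rw [hya]; exact hU)
    obtain ⟨ε, hε, hsub⟩ := Metric.mem_nhdsWithin_iff.1 h2
    refine ⟨ε, hε, fun t ht hta => hsub ⟨?_, ht⟩⟩
    rw [Metric.mem_ball, Real.dist_eq, abs_of_nonneg (sub_nonneg.2 ht.1)]
    linarith
  obtain ⟨ε₁, hε₁, h1⟩ := hstay x hx rfl
  obtain ⟨ε₂, hε₂, h2⟩ := hstay x' hx' ha.symm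
  set c₀ := min (min b (a + ε₁ / 2)) (a + ε₂ / 2) with hc₀
  have hc₀a : a < c₀ := lt_min (lt_min hab (by linarith)) (by linarith)
  have hc₀b : c₀ ≤ b := (min_le_left _ _).trans (min_le_left _ _)
  have hc₀1 : c₀ ≤ a + ε₁ / 2 := (min_le_left _ _).trans (min_le_right _ _)
  have hc₀2 : c₀ ≤ a + ε₂ / 2 := min_le_right _ _
  have hxc : ∀ t ∈ Set.Icc a c₀, x t ∈ φ.source ∩ φ ⁻¹' (Metric.ball (φ (x a)).1 r ×ˢ B₂) :=
    fun t ht => h1 t ⟨ht.1, ht.2.trans hc₀b⟩ (by linarith [ht.2])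
  have hxc' : ∀ t ∈ Set.Icc a c₀, x' t ∈ φ.source ∩ φ ⁻¹' (Metric.ball (φ (x a)).1 r ×ˢ B₂) :=
    fun t ht => h2 t ⟨ht.1, ht.2.trans hc₀b⟩ (by linarith [ht.2])
  set z := (φ (x a)).2 with hz
  have hzC : z ∈ C := mem_of_mem_nhds hCn
  have hsolc := hx.mono le_rfl hc₀b
  have hsolc' := hx'.mono le_rfl hc₀b
  have hWd : ∀ i, Differentiable ℝ (W z i) := fun i => (hK z hzC i).differentiable
  have hWb : ∀ i, ∀ y ∈ Metric.ball (φ (x a)).1 r,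
      W z i y = (V i).comp φ (φ.symm (y, z)) := fun i y hy => hW z i y
    (Metric.ball_subset_ball (by linarith) hy)
  obtain ⟨C₁, hC₁0, hC₁⟩ := hsolc.exists_davie_chart hα hφ hr hB₂ hbox (fun t ht => (hxc t ht).1)
    (fun t ht => (hxc t ht).2) hWd hWb
  obtain ⟨C₂, hC₂0, hC₂⟩ := hsolc'.exists_davie_chart hα hφ hr hB₂ hbox (fun t ht => (hxc' t ht).1)
    (fun t ht => (hxc' t ht).2) hWd (by rw [← ha]; exact hWb)
  obtain ⟨δ, hδ, -, huniq⟩ := davie_unique hα hα' hK0 hR d (C := max C₁ C₂)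
    (hC₁0.trans (le_max_left _ _))
  have hP : ∀ {s t : ℝ}, s ≤ t → 0 ≤ (t - s) ^ (3 * α) := fun h =>
    Real.rpow_nonneg (sub_nonneg.2 h) _
  set c := min c₀ (a + δ) with hc
  have hcc₀ : c ≤ c₀ := min_le_left _ _
  have hfst := huniq (V := fun i : Fin d => W z i.succ) (V₀ := W z 0) (X := X)
    (fun i => hK z hzC i.succ) (hK z hzC 0) hX a c (min_le_right _ _) (fun t => (φ (x t)).1)
    (fun t => (φ (x' t)).1) (by simp only [ha])
    (fun s t h1 h2 h3 => (hC₁ s t h1 h2 (h3.trans hcc₀)).trans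
      (mul_le_mul_of_nonneg_right (le_max_left _ _) (hP h2)))
    (fun s t h1 h2 h3 => (hC₂ s t h1 h2 (h3.trans hcc₀)).trans
      (mul_le_mul_of_nonneg_right (le_max_right _ _) (hP h2)))
  refine ⟨c, lt_min hc₀a (by linarith), hcc₀.trans hc₀b, fun t ht => ?_⟩
  have ht' : t ∈ Set.Icc a c₀ := ⟨ht.1, ht.2.trans hcc₀⟩
  have e1 := hsolc.snd_eq hα hφ hr hB₂ hbox (fun t ht => (hxc t ht).1)
    (fun t ht => (hxc t ht).2) ht'
  have e2 := hsolc'.snd_eq hα hφ hr hB₂ hbox (fun t ht => (hxc' t ht).1)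
    (fun t ht => (hxc' t ht).2) ht'
  rw [← ha] at e2
  have e3 : φ (x t) = φ (x' t) := Prod.ext (hfst t ht.1 ht.2) (e1.trans e2.symm)
  exact φ.injOn (hxc t ht').1 (hxc' t ht').1 e3

/-- Uniqueness of solutions. -/
theorem IsSol.eqOn (hα : 1 / 3 < α) (hα' : α ≤ 1 / 2) (hR : 0 ≤ R) (hX : X.IsRough α R)
    {a b : ℝ} {x x' : ℝ → M} (hx : IsSol V X α a b x) (hx' : IsSol V X α a b x')
    (ha : x a = x' a) : Set.EqOn x x' (Set.Icc a b) := by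
  have hα0 : 0 < α := by linarith
  have hc := (hx.continuousOn hα0 hα' hR hX).prodMk (hx'.continuousOn hα0 hα' hR hX)
  have hclosed : IsClosed ({t | x t = x' t} ∩ Set.Icc a b) := by
    have := hc.preimage_isClosed_of_isClosed isClosed_Icc (isClosed_diagonal (X := M))
    rw [Set.inter_comm]
    exact this
  -- Continuous induction: the set of times of agreement is closed, contains a, and by local
  -- uniqueness extends to the right of each of its points before b.
  refine hclosed.Icc_subset_of_forall_mem_nhdsWithin ha ?_
  rintro t ⟨ht, hta, htb⟩
  obtain ⟨c, hct, -, hcc⟩ := (hx.mono hta le_rfl).eventuallyEq hα hα' hR hX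
    (hx'.mono hta le_rfl) htb ht
  exact Filter.mem_of_superset (Ioc_mem_nhdsGT hct) fun s hs => hcc s ⟨hs.1.le, hs.2⟩

omit [T2Space M] [T2Space Z] in
/-- Existence on intervals of a fixed length. -/
theorem exists_uniform_solution (hα : 1 / 3 < α) (hα' : α ≤ 1 / 2) (hR : 0 ≤ R)
    (V : Fin (d + 1) → A.LeafwiseVectorField 3) :
    ∃ δ, 0 < δ ∧ δ ≤ 1 ∧ ∃ Cf : (M → ℝ) → ℝ, ∀ X : Driver d, X.IsRough α R →
      ∀ (a : ℝ) (m : M), ∃ x : ℝ → M, x a = m ∧ (∀ t ∈ Set.Icc a (a + δ), x t ∈ A.leaf m) ∧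
        ∀ f, A.IsLeafwiseFunction 3 f → DavieEstimate V X α x f (Cf f) a (a + δ) := by
  choose U hU δ hδ hδ1 Cf h using exists_local_solution (R := R) hα hα' hR V
  obtain ⟨t, -, ht⟩ := (isCompact_univ (X := M)).elim_nhds_subcover U fun x _ => hU x
  obtain ⟨δ₀, hδ₀, hδ₀1, hδ₀t⟩ : ∃ δ₀ > 0, δ₀ ≤ 1 ∧ ∀ x ∈ t, δ₀ ≤ δ x := by
    clear ht
    induction t using Finset.cons_induction with
    | empty => exact ⟨1, one_pos, le_rfl, by simp⟩
    | cons x t hx ih =>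
      obtain ⟨δ₀, h0, h1, h2⟩ := ih
      refine ⟨min δ₀ (δ x), lt_min h0 (hδ x), (min_le_left _ _).trans h1, fun y hy => ?_⟩
      rcases Finset.mem_cons.1 hy with rfl | hy
      · exact min_le_right _ _
      · exact (min_le_left _ _).trans (h2 y hy)
  refine ⟨δ₀, hδ₀, hδ₀1, fun f => ∑ x ∈ t, |Cf x f|, fun X hX a m => ?_⟩
  obtain ⟨x₀, hx₀, hm⟩ := Set.mem_iUnion₂.1 (ht (Set.mem_univ m))
  obtain ⟨x, hxa, hl, hx⟩ := h x₀ X hX a m hm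
  have hle : a + δ₀ ≤ a + δ x₀ := by have := hδ₀t x₀ hx₀; linarith
  refine ⟨x, hxa, fun s hs => hl s ⟨hs.1, hs.2.trans hle⟩, fun f hf => (hx f hf).mono ?_ le_rfl hle⟩
  exact (le_abs_self _).trans (Finset.single_le_sum (f := fun x => |Cf x f|)
    (fun _ _ => abs_nonneg _) hx₀)

/-- Existence of solutions on arbitrary intervals, with constants that depend on the driver only
through its Hölder constant. -/
theorem exists_solution (hα : 1 / 3 < α) (hα' : α ≤ 1 / 2) (hR : 0 ≤ R)
    (V : Fin (d + 1) → A.LeafwiseVectorField 3) (T : ℝ) :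
    ∃ Cf : (M → ℝ) → ℝ, ∀ X : Driver d, X.IsRough α R → ∀ (m : M), ∃ x : ℝ → M, x 0 = m ∧
      (∀ t ∈ Set.Icc 0 T, x t ∈ A.leaf m) ∧
        ∀ f, A.IsLeafwiseFunction 3 f → DavieEstimate V X α x f (Cf f) 0 T := by
  have hα0 : 0 < α := by linarith
  obtain ⟨δ₀, hδ₀, -, Cf, hloc⟩ := exists_uniform_solution (R := R) hα hα' hR V
  -- Local solutions live for time 2δ but are advanced only by δ, so consecutive pieces overlap on
  -- an interval of length δ.
  set δ := δ₀ / 2 with hδ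
  have hδ0 : 0 < δ := by positivity
  have hδ2 : δ₀ = δ + δ := by rw [hδ]; ring
  have hn : ∀ n : ℕ, ∀ X : Driver d, X.IsRough α R → ∀ (m : M), ∃ x : ℝ → M, x 0 = m ∧
      (∀ t ∈ Set.Icc 0 ((n + 1) * δ), x t ∈ A.leaf m) ∧
        ∀ f, A.IsLeafwiseFunction 3 f → ∀ s t, 0 ≤ s → s ≤ t → t ≤ (n + 1) * δ → t ≤ s + δ →
          |f (x t) - f (x s) - davieExp V X f s t (x s)| ≤ Cf f * (t - s) ^ (3 * α) := by
    intro n X hX m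
    induction n with
    | zero =>
      obtain ⟨x, h0, hl, hx⟩ := hloc X hX 0 m
      simp only [Nat.cast_zero, zero_add, one_mul]
      exact ⟨x, h0, fun t ht => hl t ⟨ht.1, by linarith [ht.2]⟩, fun f hf s t hs hst ht _ =>
        hx f hf s t hs hst (by linarith)⟩
    | succ n ih =>
      obtain ⟨x, h0, hl, hx⟩ := ih
      set a : ℝ := n * δ with ha
      have ha0 : 0 ≤ a := by positivity
      have e1 : ((n : ℝ) + 1) * δ = a + δ := by rw [ha]; ring
      have e2 : (((n + 1 : ℕ) : ℝ) + 1) * δ = a + δ₀ := by rw [ha, hδ2]; push_cast; ring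
      rw [e1] at hl hx
      rw [e2]
      obtain ⟨x', h0', hl', hx'⟩ := hloc X hX a (x a)
      have hs : IsSol V X α a (a + δ) x := fun f hf => ⟨Cf f, fun s t has hst hta =>
        hx f hf s t (ha0.trans has) hst hta (by linarith)⟩
      have hs' : IsSol V X α a (a + δ) x' := fun f hf => ⟨Cf f, (hx' f hf).mono le_rfl le_rfl
        (by linarith)⟩
      -- Uniqueness identifies the old and the new piece on the overlap [a, a + δ]. Every pair s ≤ t
      -- ≤ s + δ then lies entirely in the domain of one of the pieces, so no estimate across a
      -- junction is needed.
      have heq := hs.eqOn hα hα' hR hX hs' h0'.symm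
      classical
      set y : ℝ → M := fun t => if t ≤ a + δ then x t else x' t with hy
      have hy1 : ∀ t, t ≤ a + δ → y t = x t := fun t ht => if_pos ht
      have hy2 : ∀ t, a ≤ t → y t = x' t := fun t ht => by
        by_cases h : t ≤ a + δ
        · rw [hy1 t h]
          exact heq ⟨ht, h⟩
        · exact if_neg h
      refine ⟨y, by rw [hy1 0 (by positivity), h0], fun t ht => ?_, fun f hf s t hs hst ht hts => ?_⟩
      · by_cases h : t ≤ a + δ
        · rw [hy1 t h]
          exact hl t ⟨ht.1, h⟩
        · rw [hy2 t (by linarith)]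
          exact Relation.TransGen.trans (hl a ⟨ha0, by linarith⟩)
            (hl' t ⟨by linarith, ht.2⟩)
      · by_cases h : t ≤ a + δ
        · rw [hy1 t h, hy1 s (hst.trans h)]
          exact hx f hf s t hs hst h hts
        · rw [hy2 t (by linarith), hy2 s (by linarith)]
          exact hx' f hf s t (by linarith) hst ht
  -- When t - s ≥ δ no regularity is involved: f and its expansion are bounded on the compact space,
  -- and (t - s)^{3α} is bounded below by δ^{3α}.
  have hlong : ∀ f, A.IsLeafwiseFunction 3 f → ∃ C, 0 ≤ C ∧ ∀ X : Driver d, X.IsRough α R →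
      ∀ s t, δ ≤ t - s → t - s ≤ T → ∀ u v : M,
        |f u - f v - davieExp V X f s t v| ≤ C * (t - s) ^ (3 * α) := by
    intro f hf
    obtain ⟨B, hB0, hB⟩ := exists_davieExp_bound (α := α) V hf hR
    obtain ⟨F, hF⟩ := isCompact_univ.exists_bound_of_continuousOn
      (IsLeafwiseFunction.continuous hf).continuousOn
    have hP : 0 < δ ^ (3 * α) := Real.rpow_pos_of_pos hδ0 _
    refine ⟨(2 * |F| + B * (|T| ^ α + |T| ^ (2 * α) + |T|)) / δ ^ (3 * α), by positivity,
      fun X hX s t h1 h2 u v => ?_⟩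
    have h0 : 0 ≤ t - s := hδ0.le.trans h1
    have h3 : t - s ≤ |T| := h2.trans (le_abs_self T)
    have b1 := hB X hX s t v (sub_nonneg.1 h0)
    have b2 : |f u| ≤ |F| := (hF u (Set.mem_univ u)).trans (le_abs_self F)
    have b3 : |f v| ≤ |F| := (hF v (Set.mem_univ v)).trans (le_abs_self F)
    have b4 : |f u - f v - davieExp V X f s t v|
        ≤ 2 * |F| + B * (|T| ^ α + |T| ^ (2 * α) + |T|) := by
      have := abs_sub (f u - f v) (davieExp V X f s t v)
      have := abs_sub (f u) (f v)
      have b5 : B * ((t - s) ^ α + (t - s) ^ (2 * α) + (t - s))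
          ≤ B * (|T| ^ α + |T| ^ (2 * α) + |T|) := by gcongr
      linarith
    refine b4.trans ?_
    have : δ ^ (3 * α) ≤ (t - s) ^ (3 * α) := by gcongr
    calc _ = (2 * |F| + B * (|T| ^ α + |T| ^ (2 * α) + |T|)) / δ ^ (3 * α) * δ ^ (3 * α) := by
          field_simp
      _ ≤ _ := by gcongr
  have hC : ∀ f, ∃ C, A.IsLeafwiseFunction 3 f → (0 ≤ C ∧ ∀ X : Driver d, X.IsRough α R →
      ∀ s t, δ ≤ t - s → t - s ≤ T → ∀ u v : M,
        |f u - f v - davieExp V X f s t v| ≤ C * (t - s) ^ (3 * α)) := fun f => by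
    by_cases hf : A.IsLeafwiseFunction 3 f
    · obtain ⟨C, hC⟩ := hlong f hf
      exact ⟨C, fun _ => hC⟩
    · exact ⟨0, fun h => absurd h hf⟩
  choose C hC using hC
  obtain ⟨n, hnT⟩ := exists_nat_ge (T / δ)
  have hnT' : T ≤ (n + 1) * δ := by
    rw [div_le_iff₀ hδ0] at hnT
    linarith
  refine ⟨fun f => max (Cf f) (C f), fun X hX m => ?_⟩
  obtain ⟨x, h0, hl, hx⟩ := hn n X hX m
  refine ⟨x, h0, fun t ht => hl t ⟨ht.1, ht.2.trans hnT'⟩, fun f hf s t hs hst htT => ?_⟩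
  have hP := Real.rpow_nonneg (sub_nonneg.2 hst) (3 * α)
  by_cases h : t ≤ s + δ
  · exact (hx f hf s t hs hst (htT.trans hnT') h).trans
      (mul_le_mul_of_nonneg_right (le_max_left _ _) hP)
  · exact ((hC f hf).2 X hX s t (by linarith) (by linarith) (x t) (x s)).trans
      (mul_le_mul_of_nonneg_right (le_max_right _ _) hP)

end GlobalSolutions

end RoughFoliation

namespace RoughFoliation

/-! ### Rough paths as drivers -/

section RoughPathDriver

variable {α : HolderExponent} {T : ℝ≥0} {d : ℕ}

/-- The supremum ranges over s < t only. On the diagonal both functions vanish by their own Hölder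
bounds, as β > 0. -/
theorem norm_sub_le_holderDist {F : Type*} [NormedAddCommGroup F] {β : ℝ} (hβ : 0 < β)
    {f g : C(Simplex T, F)}
    (hf : ∃ C : ℝ, ∀ q : Simplex T, ‖f q‖ ≤ C * ((q.1.2 : ℝ) - (q.1.1 : ℝ)) ^ β)
    (hg : ∃ C : ℝ, ∀ q : Simplex T, ‖g q‖ ≤ C * ((q.1.2 : ℝ) - (q.1.1 : ℝ)) ^ β) (q : Simplex T) :
    ‖f q - g q‖ ≤ holderDist β f g * ((q.1.2 : ℝ) - (q.1.1 : ℝ)) ^ β := by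
  rcases q.2.lt_or_eq with hlt | heq
  · have hq : (0 : ℝ) < (q.1.2 : ℝ) - (q.1.1 : ℝ) := sub_pos.2 hlt
    rw [← div_le_iff₀ (Real.rpow_pos_of_pos hq β)]
    exact le_ciSup (holderDist_bddAbove hf hg) ⟨q, hlt⟩
  · obtain ⟨C, hC⟩ := hf
    obtain ⟨D, hD⟩ := hg
    have hC' := hC q
    have hD' := hD q
    rw [heq, sub_self, Real.zero_rpow hβ.ne', mul_zero] at hC' hD' ⊢
    rw [norm_le_zero_iff.1 hC', norm_le_zero_iff.1 hD', sub_zero, norm_zero]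

theorem holderDist_le {F : Type*} [NormedAddCommGroup F] {β C : ℝ} (hC : 0 ≤ C)
    {f g : C(Simplex T, F)}
    (h : ∀ q : Simplex T, ‖f q - g q‖ ≤ C * ((q.1.2 : ℝ) - (q.1.1 : ℝ)) ^ β) :
    holderDist β f g ≤ C := by
  refine Real.iSup_le (fun q => ?_) hC
  have hq : (0 : ℝ) < (q.1.1.2 : ℝ) - (q.1.1.1 : ℝ) := sub_pos.2 q.2
  rw [div_le_iff₀ (Real.rpow_pos_of_pos hq β)]
  exact h q.1

theorem _root_.RoughPath.norm_fst_sub_le (w v : RoughPath α T d) (q : Simplex T) :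
    ‖w.fst q - v.fst q‖ ≤ dist w v * ((q.1.2 : ℝ) - (q.1.1 : ℝ)) ^ (α : ℝ) :=
  (norm_sub_le_holderDist (RoughPath.exponent_pos α) w.holder_fst v.holder_fst q).trans
    (mul_le_mul_of_nonneg_right (le_max_left _ _) (Real.rpow_nonneg (sub_nonneg.2 q.2) _))

theorem _root_.RoughPath.norm_snd_sub_le (w v : RoughPath α T d) (q : Simplex T) :
    ‖w.snd q - v.snd q‖ ≤ dist w v * ((q.1.2 : ℝ) - (q.1.1 : ℝ)) ^ (2 * (α : ℝ)) :=
  (norm_sub_le_holderDist (mul_pos two_pos (RoughPath.exponent_pos α)) w.holder_snd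
    v.holder_snd q).trans
    (mul_le_mul_of_nonneg_right (le_max_right _ _) (Real.rpow_nonneg (sub_nonneg.2 q.2) _))

theorem _root_.RoughPath.dist_le {w v : RoughPath α T d} {C : ℝ} (hC : 0 ≤ C)
    (h1 : ∀ q : Simplex T, ‖w.fst q - v.fst q‖ ≤ C * ((q.1.2 : ℝ) - (q.1.1 : ℝ)) ^ (α : ℝ))
    (h2 : ∀ q : Simplex T,
      ‖w.snd q - v.snd q‖ ≤ C * ((q.1.2 : ℝ) - (q.1.1 : ℝ)) ^ (2 * (α : ℝ))) :
    dist w v ≤ C :=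
  max_le (holderDist_le hC h1) (holderDist_le hC h2)

theorem _root_.RoughPath.tendsto_fst {ι : Type*} {l : Filter ι} {w : ι → RoughPath α T d}
    {w₀ : RoughPath α T d} (h : Tendsto w l (𝓝 w₀)) (q : Simplex T) :
    Tendsto (fun i => (w i).fst q) l (𝓝 (w₀.fst q)) := by
  rw [tendsto_iff_dist_tendsto_zero] at h ⊢
  refine squeeze_zero (fun _ => dist_nonneg) (fun i => ?_)
    (by simpa using h.mul_const (((q.1.2 : ℝ) - (q.1.1 : ℝ)) ^ (α : ℝ)))
  rw [dist_eq_norm]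
  exact (w i).norm_fst_sub_le w₀ q

theorem _root_.RoughPath.tendsto_snd {ι : Type*} {l : Filter ι} {w : ι → RoughPath α T d}
    {w₀ : RoughPath α T d} (h : Tendsto w l (𝓝 w₀)) (q : Simplex T) :
    Tendsto (fun i => (w i).snd q) l (𝓝 (w₀.snd q)) := by
  rw [tendsto_iff_dist_tendsto_zero] at h ⊢
  refine squeeze_zero (fun _ => dist_nonneg) (fun i => ?_)
    (by simpa using h.mul_const (((q.1.2 : ℝ) - (q.1.1 : ℝ)) ^ (2 * (α : ℝ))))
  rw [dist_eq_norm]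
  exact (w i).norm_snd_sub_le w₀ q

/-- Integration by parts for absolutely continuous functions. This is the shuffle relation, which
passes to the closure and so holds for every geometric rough path. -/
theorem area_add_area (w : LipschitzPath T d) (i j : Fin d) (s t : ℝ) :
    w.area i j s t + w.area j i s t
      = (w.coord i t - w.coord i s) * (w.coord j t - w.coord j s) := by
  obtain ⟨K, hK⟩ := w.exists_lipschitz_coord
  have hac := fun i => (hK i).lipschitzOnWith (s := Set.uIcc s t) |>.absolutelyContinuousOnInterval
  have h := (hac i).integral_deriv_mul_eq_sub (hac j)
  have hi : ∀ i j, IntervalIntegrable (fun u => w.coord i u * deriv (w.coord j) u) volume s t := by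
    intro i j
    simpa using w.intervalIntegrable_coord_deriv 0 i j s t
  have hd : ∀ j, IntervalIntegrable (deriv (w.coord j)) volume s t :=
    fun j => (hac j).intervalIntegrable_deriv
  have ha : ∀ i j, w.area i j s t = (∫ u in s..t, w.coord i u * deriv (w.coord j) u)
      - w.coord i s * (w.coord j t - w.coord j s) := by
    intro i j
    rw [← w.integral_deriv_coord j s t, ← intervalIntegral.integral_const_mul,
      ← intervalIntegral.integral_sub (hi i j) ((hd j).const_mul _)]
    refine intervalIntegral.integral_congr fun u _ => ?_
    ring
  have hsum : (∫ u in s..t, w.coord i u * deriv (w.coord j) u)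
      + (∫ u in s..t, w.coord j u * deriv (w.coord i) u)
      = w.coord i t * w.coord j t - w.coord i s * w.coord j s := by
    rw [← h, ← intervalIntegral.integral_add (hi i j) (hi j i)]
    refine intervalIntegral.integral_congr fun u _ => ?_
    ring
  rw [ha i j, ha j i]
  linear_combination hsum

/-- The second level of a geometric rough path has symmetric part `w¹ ⊗ w¹ / 2`. -/
theorem geometric_symm (w : GeometricRoughPath α T d) (q : Simplex T) (i j : Fin d) :
    w.1.snd q (i, j) + w.1.snd q (j, i) = w.1.fst q i * w.1.fst q j := by
  obtain ⟨u, hu, hlim⟩ := mem_closure_iff_seq_limit.1 w.2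
  have h1 := RoughPath.tendsto_fst hlim q
  have h2 := RoughPath.tendsto_snd hlim q
  have e1 : ∀ i : Fin d, Tendsto (fun n => (u n).fst q i) atTop (𝓝 (w.1.fst q i)) := fun i =>
    ((EuclideanSpace.proj i : EuclideanSpace ℝ (Fin d) →L[ℝ] ℝ).continuous.tendsto _).comp h1
  have e2 : ∀ ij : Fin d × Fin d, Tendsto (fun n => (u n).snd q ij) atTop (𝓝 (w.1.snd q ij)) :=
    fun ij => ((EuclideanSpace.proj ij :
      EuclideanSpace ℝ (Fin d × Fin d) →L[ℝ] ℝ).continuous.tendsto _).comp h2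
  refine tendsto_nhds_unique ((e2 (i, j)).add (e2 (j, i))) (((e1 i).mul (e1 j)).congr fun n => ?_)
  obtain ⟨v, hv⟩ := hu n
  rw [← hv]
  have := area_add_area v i j (q.1.1 : ℝ) (q.1.2 : ℝ)
  simp only [v.coord_coe] at this
  simpa [naturalLift] using this.symm

/-- The point of the simplex given by the projections of two times to `[0, T]`. -/
noncomputable def simplexPoint (T : ℝ≥0) (s t : ℝ) : Simplex T :=
  ⟨(Set.projIcc (0 : ℝ) T T.coe_nonneg s,
    max (Set.projIcc (0 : ℝ) T T.coe_nonneg s) (Set.projIcc (0 : ℝ) T T.coe_nonneg t)), le_max_left _ _⟩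

theorem continuous_simplexPoint : Continuous fun q : ℝ × ℝ => simplexPoint T q.1 q.2 := by
  have h := continuous_projIcc (a := (0 : ℝ)) (b := T) (h := T.coe_nonneg)
  refine Continuous.subtype_mk ?_ _
  fun_prop

theorem simplexPoint_of_le {s t : ℝ} (h : s ≤ t) : simplexPoint T s t =
    ⟨(Set.projIcc (0 : ℝ) T T.coe_nonneg s, Set.projIcc (0 : ℝ) T T.coe_nonneg t),
      Set.monotone_projIcc T.coe_nonneg h⟩ := by
  refine Subtype.ext (Prod.ext rfl ?_)
  exact max_eq_right (Set.monotone_projIcc T.coe_nonneg h)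

theorem simplexPoint_coe (q : Simplex T) : simplexPoint T (q.1.1 : ℝ) (q.1.2 : ℝ) = q := by
  rw [simplexPoint_of_le q.2]
  refine Subtype.ext (Prod.ext ?_ ?_) <;> simp [Set.projIcc_val]

theorem simplexPoint_length {s t : ℝ} (h : s ≤ t) :
    ((simplexPoint T s t).1.2 : ℝ) - ((simplexPoint T s t).1.1 : ℝ) ≤ t - s := by
  rw [simplexPoint_of_le h]
  have := (LipschitzWith.projIcc (a := (0 : ℝ)) (b := T) T.coe_nonneg).dist_le_mul t s
  rw [NNReal.coe_one, one_mul, Subtype.dist_eq, Real.dist_eq, Real.dist_eq,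
    abs_of_nonneg (sub_nonneg.2 h)] at this
  exact (le_abs_self _).trans this

/-- A rough path, extended constantly outside `[0, T]`, as a driver. -/
noncomputable def pathDriver (w : RoughPath α T d) : Driver d where
  X1 s t i := w.fst (simplexPoint T s t) i
  X2 s t i j := w.snd (simplexPoint T s t) (i, j)

theorem isRough_pathDriver (w : GeometricRoughPath α T d) {R : ℝ} (hR : 0 ≤ R)
    (h1 : ∀ q : Simplex T, ‖w.1.fst q‖ ≤ R * ((q.1.2 : ℝ) - (q.1.1 : ℝ)) ^ (α : ℝ))
    (h2 : ∀ q : Simplex T, ‖w.1.snd q‖ ≤ R * ((q.1.2 : ℝ) - (q.1.1 : ℝ)) ^ (2 * (α : ℝ))) :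
    (pathDriver w.1).IsRough α R := by
  have hα := RoughPath.exponent_pos α
  have hlen : ∀ s t : ℝ, s ≤ t → ∀ β : ℝ, 0 ≤ β →
      (((simplexPoint T s t).1.2 : ℝ) - ((simplexPoint T s t).1.1 : ℝ)) ^ β ≤ (t - s) ^ β :=
    fun s t h β hβ => Real.rpow_le_rpow (sub_nonneg.2 (simplexPoint T s t).2)
      (simplexPoint_length h) hβ
  refine ⟨?_, ?_, ?_, ?_, fun s t h i j => geometric_symm w _ i j, ?_, ?_⟩
  · intro s u t hsu hut i
    simp only [pathDriver, simplexPoint_of_le hsu, simplexPoint_of_le hut,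
      simplexPoint_of_le (hsu.trans hut)]
    rw [w.1.chen_fst _ _ _ (Set.monotone_projIcc T.coe_nonneg hsu) (Set.monotone_projIcc T.coe_nonneg hut)]
    rfl
  · intro s u t hsu hut i j
    simp only [pathDriver, simplexPoint_of_le hsu, simplexPoint_of_le hut,
      simplexPoint_of_le (hsu.trans hut)]
    exact w.1.chen_snd _ _ _ (Set.monotone_projIcc T.coe_nonneg hsu) (Set.monotone_projIcc T.coe_nonneg hut) i j
  · intro s t h i
    refine (PiLp.norm_apply_le (w.1.fst (simplexPoint T s t)) i).trans ((h1 _).trans ?_)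
    exact mul_le_mul_of_nonneg_left (hlen s t h _ hα.le) hR
  · intro s t h i j
    refine (PiLp.norm_apply_le (w.1.snd (simplexPoint T s t)) (i, j)).trans ((h2 _).trans ?_)
    exact mul_le_mul_of_nonneg_left (hlen s t h _ (by positivity)) hR
  · intro i
    refine Continuous.continuousOn ?_
    exact (EuclideanSpace.proj i : EuclideanSpace ℝ (Fin d) →L[ℝ] ℝ).continuous.comp
      (w.1.fst.continuous.comp continuous_simplexPoint)
  · intro i j
    refine Continuous.continuousOn ?_
    exact (EuclideanSpace.proj (i, j) : EuclideanSpace ℝ (Fin d × Fin d) →L[ℝ] ℝ).continuous.comp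
      (w.1.snd.continuous.comp continuous_simplexPoint)

/-- Rough paths close to a given one have a common Hölder constant. -/
theorem exists_isRough (w : GeometricRoughPath α T d) :
    ∃ R : ℝ, 0 ≤ R ∧ ∀ v : GeometricRoughPath α T d, dist v w ≤ 1 →
      (pathDriver v.1).IsRough α R := by
  obtain ⟨C, hC⟩ := w.1.holder_fst
  obtain ⟨D, hD⟩ := w.1.holder_snd
  refine ⟨1 + |C| + |D|, by positivity, fun v hv => ?_⟩
  have hv' : dist v.1 w.1 ≤ 1 := hv
  refine isRough_pathDriver v (by positivity) (fun q => ?_) (fun q => ?_)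
  · have h0 := Real.rpow_nonneg (sub_nonneg.2 q.2) (α : ℝ)
    have h1 := (v.1.norm_fst_sub_le w.1 q).trans (mul_le_mul_of_nonneg_right hv' h0)
    have h2 := norm_le_norm_add_norm_sub' (v.1.fst q) (w.1.fst q)
    have h3 := mul_le_mul_of_nonneg_right (le_abs_self C) h0
    have h4 := mul_nonneg (abs_nonneg D) h0
    linarith [hC q]
  · have h0 := Real.rpow_nonneg (sub_nonneg.2 q.2) (2 * (α : ℝ))
    have h1 := (v.1.norm_snd_sub_le w.1 q).trans (mul_le_mul_of_nonneg_right hv' h0)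
    have h2 := norm_le_norm_add_norm_sub' (v.1.snd q) (w.1.snd q)
    have h3 := mul_le_mul_of_nonneg_right (le_abs_self D) h0
    have h4 := mul_nonneg (abs_nonneg C) h0
    linarith [hD q]

end RoughPathDriver

/-! ### The Lyons–Itô map -/

section LyonsIto

variable {p d : ℕ} {M Z : Type*} [TopologicalSpace M] [TopologicalSpace Z] {A : FoliatedAtlas p M Z}
  {α : HolderExponent} {T : ℝ≥0} {V : Fin (d + 1) → A.LeafwiseVectorField 3}

/-- A path on `[0, T]`, extended constantly to all of `ℝ`. -/
noncomputable def extendPath (x : TimeInterval T → M) (t : ℝ) : M :=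
  x (Set.projIcc (0 : ℝ) T T.coe_nonneg t)

omit [TopologicalSpace M] in
theorem extendPath_coe (x : TimeInterval T → M) (t : TimeInterval T) :
    extendPath x (t : ℝ) = x t := by
  rw [extendPath, Set.projIcc_val]

omit [TopologicalSpace M] in
theorem extendPath_restrict (x : ℝ → M) {t : ℝ} (ht : t ∈ Set.Icc (0 : ℝ) T) :
    extendPath (fun s : TimeInterval T => x s) t = x t := by
  rw [extendPath, Set.projIcc_of_mem _ ht]

/-- The constant is the same on both sides, so uniformity of constants is not lost in passing
between times in [0, T] and real times. -/
theorem davieEstimate_extendPath_iff {w : RoughPath α T d} {x : TimeInterval T → M} {f : M → ℝ}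
    {C : ℝ} : DavieEstimate V (pathDriver w) α (extendPath x) f C 0 T ↔
      ∀ (s t : TimeInterval T) (hst : s ≤ t),
        |f (x t) - f (x s) -
          (∑ i : Fin d, (V i.succ).apply f (x s) * w.fst ⟨(s, t), hst⟩ i
            + ∑ j : Fin d, ∑ k : Fin d,
                (V j.succ).apply ((V k.succ).apply f) (x s) * w.snd ⟨(s, t), hst⟩ (j, k)
            + (V 0).apply f (x s) * ((t : ℝ) - (s : ℝ)))|
          ≤ C * ((t : ℝ) - (s : ℝ)) ^ (3 * (α : ℝ)) := by
  constructor
  · intro h s t hst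
    have := h s t s.2.1 hst t.2.2
    rw [extendPath_coe, extendPath_coe] at this
    have e := simplexPoint_coe (T := T) ⟨(s, t), hst⟩
    simp only at e
    simpa only [davieExp, pathDriver, e] using this
  · intro h s t hs hst ht
    have := h ⟨s, hs, hst.trans ht⟩ ⟨t, hs.trans hst, ht⟩ hst
    have e := simplexPoint_coe (T := T) ⟨(⟨s, hs, hst.trans ht⟩, ⟨t, hs.trans hst, ht⟩), hst⟩
    simp only at e
    have es := extendPath_coe x ⟨s, hs, hst.trans ht⟩
    have et := extendPath_coe x ⟨t, hs.trans hst, ht⟩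
    simp only at es et
    simpa only [davieExp, pathDriver, e, es, et] using this

theorem isRDESolution_iff {w : GeometricRoughPath α T d} {m : M} {x : C(TimeInterval T, M)} :
    IsRDESolution V w m x ↔
      x (startTime T) = m ∧ IsSol V (pathDriver w.1) α 0 T (extendPath x) := by
  simp only [IsRDESolution, IsSol, davieEstimate_extendPath_iff]

omit [TopologicalSpace M] in
theorem extendPath_zero (x : TimeInterval T → M) : extendPath x 0 = x (startTime T) :=
  extendPath_coe x (startTime T)

variable [CompactSpace M] [T2Space M] [LocallyCompactSpace Z] [T2Space Z]

theorem isRDESolution_unique {w : GeometricRoughPath α T d} {m : M} {x x' : C(TimeInterval T, M)}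
    (hx : IsRDESolution V w m x) (hx' : IsRDESolution V w m x') : x = x' := by
  rw [isRDESolution_iff] at hx hx'
  obtain ⟨R, hR, h⟩ := exists_isRough w
  have := hx.2.eqOn α.2.1 α.2.2.le hR (h w (by simp)) hx'.2
    (by rw [extendPath_zero, extendPath_zero, hx.1, hx'.1])
  ext t
  have := this t.2
  rwa [extendPath_coe, extendPath_coe] at this

/-- The Lyons–Itô map yields the solution, which stays in a leaf and satisfies Davie estimates that
are locally uniform in the rough path. -/
theorem lyonsIto_spec (V : Fin (d + 1) → A.LeafwiseVectorField 3) {R : ℝ} (hR : 0 ≤ R) :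
    ∃ Cf : (M → ℝ) → ℝ, ∀ (w : GeometricRoughPath α T d), (pathDriver w.1).IsRough α R → ∀ m : M,
      IsRDESolution V w m (lyonsIto V m w) ∧ (∀ t, lyonsIto V m w t ∈ A.leaf m) ∧
      ∀ f, A.IsLeafwiseFunction 3 f →
        DavieEstimate V (pathDriver w.1) α (extendPath (lyonsIto V m w)) f (Cf f) 0 T := by
  obtain ⟨Cf, hCf⟩ := exists_solution (R := R) α.2.1 α.2.2.le hR V T
  refine ⟨Cf, fun w hw m => ?_⟩
  obtain ⟨x, hx0, hleaf, hx⟩ := hCf _ hw m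
  have hsol : IsSol V (pathDriver w.1) α 0 T x := fun f hf => ⟨_, hx f hf⟩
  have hcont := hsol.continuousOn (RoughPath.exponent_pos α) α.2.2.le hR hw
  let y : C(TimeInterval T, M) := ⟨fun t => x t, continuousOn_iff_continuous_domRestrict.1 hcont⟩
  have hy : ∀ f, A.IsLeafwiseFunction 3 f →
      DavieEstimate V (pathDriver w.1) α (extendPath y) f (Cf f) 0 T := by
    intro f hf s t hs hst ht
    have e1 : extendPath y s = x s := extendPath_restrict x ⟨hs, hst.trans ht⟩
    have e2 : extendPath y t = x t := extendPath_restrict x ⟨hs.trans hst, ht⟩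
    rw [e1, e2]
    exact hx f hf s t hs hst ht
  have hsol' : IsRDESolution V w m y :=
    isRDESolution_iff.2 ⟨hx0, fun f hf => ⟨_, hy f hf⟩⟩
  have hex : ∃ x, IsRDESolution V w m x := ⟨y, hsol'⟩
  have hL : lyonsIto V m w = y := by
    rw [lyonsIto, dif_pos hex]
    exact isRDESolution_unique hex.choose_spec hsol'
  rw [hL]
  exact ⟨hsol', fun t => hleaf t t.2, hy⟩

theorem isRDESolution_lyonsIto (w : GeometricRoughPath α T d) (m : M) :
    IsRDESolution V w m (lyonsIto V m w) ∧ ∀ t, lyonsIto V m w t ∈ A.leaf m := by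
  obtain ⟨R, hR, h⟩ := exists_isRough w
  obtain ⟨Cf, hCf⟩ := lyonsIto_spec V hR
  exact ⟨(hCf w (h w (by simp)) m).1, (hCf w (h w (by simp)) m).2.1⟩

theorem isRDESolution_iff_eq (w : GeometricRoughPath α T d) (m : M) (x : C(TimeInterval T, M)) :
    IsRDESolution V w m x ↔ x = lyonsIto V m w :=
  ⟨fun h => isRDESolution_unique h (isRDESolution_lyonsIto w m).1,
    fun h => h ▸ (isRDESolution_lyonsIto w m).1⟩

/-- Compactness and uniqueness replace a stability estimate. Along any ultrafilter finer than `l`,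
the solutions converge at each time, since M is compact. Rough paths near `w₀` share a Hölder
constant, so the Davie estimates hold with common constants and pass to the limit, the expansion
being continuous in the point and the rough path. The limit path is thus a solution driven by `w₀`
from `m₀`, hence the only one. -/
theorem tendsto_lyonsIto_apply {ι : Type*} {l : Filter ι} {w : ι → GeometricRoughPath α T d}
    {w₀ : GeometricRoughPath α T d} {m : ι → M} {m₀ : M} (hw : Tendsto w l (𝓝 w₀))
    (hm : Tendsto m l (𝓝 m₀)) (t : TimeInterval T) :
    Tendsto (fun i => lyonsIto V (m i) (w i) t) l (𝓝 (lyonsIto V m₀ w₀ t)) := by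
  obtain ⟨R, hR, hrough⟩ := exists_isRough w₀
  obtain ⟨Cf, hCf⟩ := lyonsIto_spec V hR
  have hclose : ∀ᶠ i in l, dist (w i) w₀ ≤ 1 :=
    (hw.eventually (Metric.closedBall_mem_nhds w₀ one_pos))
  rw [tendsto_iff_ultrafilter]
  intro g hg
  have hlim : ∀ s : TimeInterval T, ∃ y : M,
      Tendsto (fun i => lyonsIto V (m i) (w i) s) (g : Filter ι) (𝓝 y) := by
    intro s
    obtain ⟨y, -, hy⟩ := isCompact_univ.ultrafilter_le_nhds
      (Ultrafilter.map (fun i => lyonsIto V (m i) (w i) s) g) (by simp)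
    exact ⟨y, hy⟩
  choose y hy using hlim
  have hdav : ∀ f, A.IsLeafwiseFunction 3 f →
      DavieEstimate V (pathDriver w₀.1) α (extendPath y) f (Cf f) 0 T := by
    intro f hf
    rw [davieEstimate_extendPath_iff]
    intro s t hst
    have hc : ∀ {u : M → ℝ}, Continuous u → ∀ r : TimeInterval T,
        Tendsto (fun i => u (lyonsIto V (m i) (w i) r)) (g : Filter ι) (𝓝 (u (y r))) :=
      fun hu r => (hu.tendsto _).comp (hy r)
    have hV1 : ∀ i, Continuous ((V i).apply f) := fun i =>
      IsLeafwiseFunction.continuous (isLeafwiseFunction_apply (V i) (k := 2) (by norm_num) hf)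
    have hV2 : ∀ i j, Continuous ((V i).apply ((V j).apply f)) := fun i j =>
      IsLeafwiseFunction.continuous (isLeafwiseFunction_apply (V i) (k := 1) (by norm_num)
        (isLeafwiseFunction_apply (V j) (k := 2) (by norm_num) hf))
    have hw' : Tendsto (fun i => (w i).1) (g : Filter ι) (𝓝 w₀.1) :=
      (continuous_subtype_val.tendsto _).comp (hw.mono_left hg)
    have e1 : ∀ i : Fin d, Tendsto (fun n => (w n).1.fst ⟨(s, t), hst⟩ i) (g : Filter ι)
        (𝓝 (w₀.1.fst ⟨(s, t), hst⟩ i)) := fun i =>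
      ((EuclideanSpace.proj i : EuclideanSpace ℝ (Fin d) →L[ℝ] ℝ).continuous.tendsto _).comp
        (RoughPath.tendsto_fst hw' _)
    have e2 : ∀ ij : Fin d × Fin d, Tendsto (fun n => (w n).1.snd ⟨(s, t), hst⟩ ij)
        (g : Filter ι) (𝓝 (w₀.1.snd ⟨(s, t), hst⟩ ij)) := fun ij =>
      ((EuclideanSpace.proj ij :
        EuclideanSpace ℝ (Fin d × Fin d) →L[ℝ] ℝ).continuous.tendsto _).comp
        (RoughPath.tendsto_snd hw' _)
    have hmain := (((hc (IsLeafwiseFunction.continuous hf) t).sub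
      (hc (IsLeafwiseFunction.continuous hf) s)).sub
      (((tendsto_finsetSum Finset.univ fun i _ => (hc (hV1 (Fin.succ i)) s).mul (e1 i)).add
        (tendsto_finsetSum Finset.univ fun j _ => tendsto_finsetSum Finset.univ fun k _ =>
          (hc (hV2 (Fin.succ j) (Fin.succ k)) s).mul (e2 (j, k)))).add
        ((hc (hV1 0) s).mul_const ((t : ℝ) - (s : ℝ))))).abs
    refine le_of_tendsto hmain ?_
    filter_upwards [hg hclose] with i hi
    exact davieEstimate_extendPath_iff.1 ((hCf (w i) (hrough _ hi) (m i)).2.2 f hf) s t hst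
  have hsol : IsSol V (pathDriver w₀.1) α 0 T (extendPath y) := fun f hf => ⟨_, hdav f hf⟩
  have hR0 := hrough w₀ (by simp)
  have hsol0 := (isRDESolution_iff.1 (hCf w₀ hR0 m₀).1)
  have hy0 : y (startTime T) = m₀ := by
    refine tendsto_nhds_unique (hy (startTime T)) ((hm.mono_left hg).congr fun i => ?_)
    exact (isRDESolution_lyonsIto (w i) (m i)).1.1.symm
  have heq := hsol.eqOn α.2.1 α.2.2.le hR hR0 hsol0.2
    (by rw [extendPath_zero, extendPath_zero, hsol0.1, hy0]) t.2
  rw [extendPath_coe, extendPath_coe] at heq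
  rw [← heq]
  exact hy t

/-- The Lyons–Itô map is continuous in the starting point and the rough path. -/
theorem tendsto_lyonsIto {ι : Type*} {l : Filter ι} {w : ι → GeometricRoughPath α T d}
    {w₀ : GeometricRoughPath α T d} {m : ι → M} {m₀ : M} (hw : Tendsto w l (𝓝 w₀))
    (hm : Tendsto m l (𝓝 m₀)) :
    Tendsto (fun i => lyonsIto V (m i) (w i)) l (𝓝 (lyonsIto V m₀ w₀)) := by
  let : UniformSpace M := uniformSpaceOfCompactR1
  rw [ContinuousMap.tendsto_iff_tendstoLocallyUniformly,
    tendstoLocallyUniformly_iff_forall_tendsto]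
  intro t₀
  -- Local uniform convergence at t₀ asks that the values of the limit and of the approximants at
  -- times t near t₀ be close in the uniformity. It suffices that both converge to the value of the
  -- limit at t₀ as index and time vary jointly.
  refine Tendsto.mono_right (Tendsto.prodMk_nhds (x := lyonsIto V m₀ w₀ t₀) ?_ ?_)
    (nhds_le_uniformity (lyonsIto V m₀ w₀ t₀))
  · exact ((lyonsIto V m₀ w₀).continuous.tendsto t₀).comp tendsto_snd
  obtain ⟨R, hR, hrough⟩ := exists_isRough w₀
  obtain ⟨Cf, hCf⟩ := lyonsIto_spec V hR
  have hclose : ∀ᶠ i in l, dist (w i) w₀ ≤ 1 :=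
    (hw.eventually (Metric.closedBall_mem_nhds w₀ one_pos))
  refine tendsto_of_leafwise (A := A) fun f hf => ?_
  obtain ⟨B, hB0, hB⟩ := exists_holder_of_davie V hf (RoughPath.exponent_pos α) α.2.2.le hR (Cf f)
  have h1 : Tendsto (fun q : ι × TimeInterval T => f (lyonsIto V (m q.1) (w q.1) t₀)) (l ×ˢ 𝓝 t₀)
      (𝓝 (f (lyonsIto V m₀ w₀ t₀))) :=
    (((IsLeafwiseFunction.continuous hf).tendsto _).comp
      (tendsto_lyonsIto_apply hw hm t₀)).comp tendsto_fst
  have h2 : Tendsto (fun q : ι × TimeInterval T => B * |(q.2 : ℝ) - t₀| ^ (α : ℝ)) (l ×ˢ 𝓝 t₀)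
      (𝓝 0) :=
    ((tendsto_const_mul_abs_sub_rpow (RoughPath.exponent_pos α)).comp
      (continuous_subtype_val.tendsto t₀)).comp tendsto_snd
  -- The Hölder constant B along test functions depends only on R, not on the index. Pointwise
  -- convergence at t₀ thus extends to nearby times.
  have h3 : Tendsto (fun q : ι × TimeInterval T => f (lyonsIto V (m q.1) (w q.1) q.2)
      - f (lyonsIto V (m q.1) (w q.1) t₀)) (l ×ˢ 𝓝 t₀) (𝓝 0) := by
    refine squeeze_zero_norm' ?_ h2
    filter_upwards [hclose.prod_mk (Metric.closedBall_mem_nhds t₀ one_pos)] with q hq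
    have hq2 : |(q.2 : ℝ) - t₀| ≤ 1 := hq.2
    have := hB _ (hrough _ hq.1) _ 0 T ((hCf _ (hrough _ hq.1) (m q.1)).2.2 f hf) t₀ q.2 t₀.2
      q.2.2 hq2
    rwa [extendPath_coe, extendPath_coe] at this
  simpa using h3.add h1

end LyonsIto

end RoughFoliation

namespace RoughFoliation

/-! ### Completeness of the space of rough paths -/

section Complete

variable {α : HolderExponent} {T : ℝ≥0} {d : ℕ}

instance : CompactSpace (Simplex T) :=
  isCompact_iff_compactSpace.1 (OrderClosedTopology.isClosed_le' (α := TimeInterval T)).isCompact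

theorem simplex_length_nonneg (q : Simplex T) : 0 ≤ (q.1.2 : ℝ) - (q.1.1 : ℝ) := sub_nonneg.2 q.2

theorem simplex_rpow_le (q : Simplex T) {β : ℝ} (hβ : 0 ≤ β) :
    ((q.1.2 : ℝ) - (q.1.1 : ℝ)) ^ β ≤ (T : ℝ) ^ β :=
  Real.rpow_le_rpow (simplex_length_nonneg q) (by linarith [q.1.2.2.2, q.1.1.2.1]) hβ

/-- A Cauchy sequence converges uniformly at both levels, since Hölder distances dominate uniform
ones on a bounded simplex. Chen's relations are closed under pointwise limits, and letting the
second index tend to infinity in the Cauchy estimate turns uniform into Hölder convergence. -/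
instance : CompleteSpace (RoughPath α T d) := by
  refine UniformSpace.complete_of_cauchySeq_tendsto fun u hu => ?_
  have hα := RoughPath.exponent_pos α
  have h1 : CauchySeq fun n => (u n).fst := by
    have : LipschitzWith ((T : ℝ≥0) ^ (α : ℝ)) (RoughPath.fst : RoughPath α T d → _) := by
      refine LipschitzWith.of_dist_le_mul fun w v => ?_
      rw [ContinuousMap.dist_le (by positivity)]
      intro q
      rw [dist_eq_norm, mul_comm]
      exact (w.norm_fst_sub_le v q).trans
        (mul_le_mul_of_nonneg_left (simplex_rpow_le q hα.le) dist_nonneg)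
    exact hu.map this.uniformContinuous
  have h2 : CauchySeq fun n => (u n).snd := by
    have : LipschitzWith ((T : ℝ≥0) ^ (2 * (α : ℝ))) (RoughPath.snd : RoughPath α T d → _) := by
      refine LipschitzWith.of_dist_le_mul fun w v => ?_
      rw [ContinuousMap.dist_le (by positivity)]
      intro q
      rw [dist_eq_norm, mul_comm]
      exact (w.norm_snd_sub_le v q).trans
        (mul_le_mul_of_nonneg_left (simplex_rpow_le q (by positivity)) dist_nonneg)
    exact hu.map this.uniformContinuous
  obtain ⟨f, hf⟩ := cauchySeq_tendsto_of_complete h1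
  obtain ⟨g, hg⟩ := cauchySeq_tendsto_of_complete h2
  have hf' : ∀ q, Tendsto (fun n => (u n).fst q) atTop (𝓝 (f q)) := fun q =>
    ((continuous_eval_const (F := C(Simplex T, EuclideanSpace ℝ (Fin d))) q).tendsto f).comp hf
  have hg' : ∀ q, Tendsto (fun n => (u n).snd q) atTop (𝓝 (g q)) := fun q =>
    ((continuous_eval_const (F := C(Simplex T, EuclideanSpace ℝ (Fin d × Fin d))) q).tendsto g).comp hg
  have hfi : ∀ q (i : Fin d), Tendsto (fun n => (u n).fst q i) atTop (𝓝 (f q i)) := fun q i =>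
    ((EuclideanSpace.proj i : EuclideanSpace ℝ (Fin d) →L[ℝ] ℝ).continuous.tendsto _).comp (hf' q)
  have hgi : ∀ q (ij : Fin d × Fin d), Tendsto (fun n => (u n).snd q ij) atTop (𝓝 (g q ij)) :=
    fun q ij => ((EuclideanSpace.proj ij :
      EuclideanSpace ℝ (Fin d × Fin d) →L[ℝ] ℝ).continuous.tendsto _).comp (hg' q)
  have hd1 : ∀ ε, ∀ n, (∀ m ≥ n, dist (u n) (u m) ≤ ε) → ∀ q,
      ‖(u n).fst q - f q‖ ≤ ε * ((q.1.2 : ℝ) - (q.1.1 : ℝ)) ^ (α : ℝ) := by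
    intro ε n hn q
    refine le_of_tendsto (tendsto_const_nhds.sub (hf' q)).norm ?_
    filter_upwards [eventually_ge_atTop n] with m hm
    exact ((u n).norm_fst_sub_le (u m) q).trans
      (mul_le_mul_of_nonneg_right (hn m hm) (Real.rpow_nonneg (simplex_length_nonneg q) _))
  have hd2 : ∀ ε, ∀ n, (∀ m ≥ n, dist (u n) (u m) ≤ ε) → ∀ q,
      ‖(u n).snd q - g q‖ ≤ ε * ((q.1.2 : ℝ) - (q.1.1 : ℝ)) ^ (2 * (α : ℝ)) := by
    intro ε n hn q
    refine le_of_tendsto (tendsto_const_nhds.sub (hg' q)).norm ?_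
    filter_upwards [eventually_ge_atTop n] with m hm
    exact ((u n).norm_snd_sub_le (u m) q).trans
      (mul_le_mul_of_nonneg_right (hn m hm) (Real.rpow_nonneg (simplex_length_nonneg q) _))
  obtain ⟨n₁, hn₁⟩ := Metric.cauchySeq_iff'.1 hu 1 one_pos
  have hn₁' : ∀ m ≥ n₁, dist (u n₁) (u m) ≤ 1 := fun m hm => by
    rw [dist_comm]; exact (hn₁ m hm).le
  let W : RoughPath α T d :=
    { fst := f
      snd := g
      chen_fst := fun s r t hsr hrt => by
        refine tendsto_nhds_unique (hf' _) ?_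
        simpa only [← (u _).chen_fst s r t hsr hrt] using (hf' ⟨(s, r), hsr⟩).add (hf' ⟨(r, t), hrt⟩)
      chen_snd := fun s r t hsr hrt i j => by
        refine tendsto_nhds_unique (hgi _ _) ?_
        simpa only [← (u _).chen_snd s r t hsr hrt i j] using
          ((hgi ⟨(s, r), hsr⟩ (i, j)).add (hgi ⟨(r, t), hrt⟩ (i, j))).add
            ((hfi ⟨(s, r), hsr⟩ i).mul (hfi ⟨(r, t), hrt⟩ j))
      holder_fst := by
        obtain ⟨C, hC⟩ := (u n₁).holder_fst
        refine ⟨C + 1, fun q => ?_⟩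
        have e1 := hd1 1 n₁ hn₁' q
        have e2 := norm_le_norm_add_norm_sub ((u n₁).fst q) (f q)
        linarith [hC q]
      holder_snd := by
        obtain ⟨C, hC⟩ := (u n₁).holder_snd
        refine ⟨C + 1, fun q => ?_⟩
        have e1 := hd2 1 n₁ hn₁' q
        have e2 := norm_le_norm_add_norm_sub ((u n₁).snd q) (g q)
        linarith [hC q] }
  refine ⟨W, Metric.tendsto_atTop.2 fun ε hε => ?_⟩
  obtain ⟨N, hN⟩ := Metric.cauchySeq_iff.1 hu (ε / 2) (half_pos hε)
  refine ⟨N, fun n hn => lt_of_le_of_lt ?_ (half_lt_self hε)⟩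
  have hn' : ∀ m ≥ n, dist (u n) (u m) ≤ ε / 2 := fun m hm => (hN n hn m (le_trans hn hm)).le
  exact RoughPath.dist_le (by positivity) (hd1 _ n hn') (hd2 _ n hn')

instance : CompleteSpace (GeometricRoughPath α T d) := isClosed_closure.completeSpace_coe

end Complete

/-! ### Estimates for iterated integrals of Lipschitz functions -/

section Area

/-- The iterated integral `∫_s^t (f_u - f_s) dg_u`. -/
noncomputable def iteratedIntegral (f g : ℝ → ℝ) (s t : ℝ) : ℝ := ∫ u in s..t, (f u - f s) * deriv g u

theorem abs_iteratedIntegral_le {f g : ℝ → ℝ} {K L : ℝ≥0} (hf : LipschitzWith K f)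
    (hg : LipschitzWith L g) {s t : ℝ} (hst : s ≤ t) :
    |iteratedIntegral f g s t| ≤ K * L * (t - s) ^ 2 := by
  have hb : ∀ u ∈ Set.uIoc s t, ‖(f u - f s) * deriv g u‖ ≤ (K * (t - s)) * L := by
    intro u hu
    rw [Set.uIoc_of_le hst] at hu
    rw [norm_mul]
    gcongr
    · have := hf.dist_le_mul u s
      rw [Real.dist_eq, Real.dist_eq, abs_of_nonneg (by linarith [hu.1] : (0 : ℝ) ≤ u - s)] at this
      rw [Real.norm_eq_abs]
      refine this.trans ?_
      gcongr
      exact hu.2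
    · exact norm_deriv_le_of_lipschitz hg
  have := intervalIntegral.norm_integral_le_of_norm_le_const hb
  rw [Real.norm_eq_abs, abs_of_nonneg (sub_nonneg.2 hst)] at this
  exact this.trans (le_of_eq (by ring))

theorem intervalIntegrable_iteratedIntegral {f g : ℝ → ℝ} {K L : ℝ≥0} (hf : LipschitzWith K f)
    (hg : LipschitzWith L g) (c s t : ℝ) :
    IntervalIntegrable (fun u => (f u - c) * deriv g u) volume s t :=
  hg.lipschitzOnWith.absolutelyContinuousOnInterval.intervalIntegrable_deriv.continuousOn_mul
    (hf.continuous.sub continuous_const).continuousOn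

/-- Bilinearity of the iterated integral. The derivative of g - g' is the difference of derivatives
only almost everywhere, at common points of differentiability of the two Lipschitz functions. -/
theorem iteratedIntegral_sub {f f' g g' : ℝ → ℝ} {K K' L L' : ℝ≥0} (hf : LipschitzWith K f)
    (hf' : LipschitzWith K' f') (hg : LipschitzWith L g) (hg' : LipschitzWith L' g') (s t : ℝ) :
    iteratedIntegral f g s t - iteratedIntegral f' g' s t
      = iteratedIntegral (f - f') g s t + iteratedIntegral f' (g - g') s t := by
  have h1 := intervalIntegrable_iteratedIntegral hf hg (f s) s t
  have h2 := intervalIntegrable_iteratedIntegral hf' hg' (f' s) s t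
  have h3 := intervalIntegrable_iteratedIntegral (hf.sub hf') hg ((f - f') s) s t
  have h4 := intervalIntegrable_iteratedIntegral hf' (hg.sub hg') (f' s) s t
  unfold iteratedIntegral
  rw [← intervalIntegral.integral_sub h1 h2]
  have h4' : IntervalIntegrable (fun u => (f' u - f' s) * deriv (g - g') u) volume s t := h4
  have h3' : IntervalIntegrable (fun u => ((f - f') u - (f - f') s) * deriv g u) volume s t := h3
  rw [← intervalIntegral.integral_add h3' h4']
  refine intervalIntegral.integral_congr_ae ?_
  filter_upwards [hg.ae_differentiableAt_real, hg'.ae_differentiableAt_real] with u h1 h2 _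
  rw [deriv_sub h1 h2]
  simp only [Pi.sub_apply]
  ring

theorem abs_iteratedIntegral_sub_le {f f' g g' : ℝ → ℝ} {K ε : ℝ≥0} (hf : LipschitzWith K f)
    (hf' : LipschitzWith K f') (hg : LipschitzWith K g) (hg' : LipschitzWith K g')
    (hff : LipschitzWith ε (f - f')) (hgg : LipschitzWith ε (g - g')) {s t : ℝ} (hst : s ≤ t) :
    |iteratedIntegral f g s t - iteratedIntegral f' g' s t| ≤ 2 * K * ε * (t - s) ^ 2 := by
  rw [iteratedIntegral_sub hf hf' hg hg']
  refine (abs_add_le _ _).trans ?_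
  have h1 := abs_iteratedIntegral_le hff hg hst
  have h2 := abs_iteratedIntegral_le hf' hgg hst
  nlinarith

/-- The iterated integral of affine functions. -/
theorem iteratedIntegral_affine {f g : ℝ → ℝ} {a b c e s t : ℝ} (hst : s ≤ t)
    (hf : ∀ u ∈ Set.Icc s t, f u = a + (u - s) * b) (hg : ∀ u ∈ Set.Icc s t, g u = c + (u - s) * e) :
    iteratedIntegral f g s t = (f t - f s) * (g t - g s) / 2 := by
  have h1 : iteratedIntegral f g s t = ∫ u in s..t, (u - s) * (b * e) := by
    unfold iteratedIntegral
    rw [intervalIntegral.integral_of_le hst, intervalIntegral.integral_of_le hst,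
      integral_Ioc_eq_integral_Ioo, integral_Ioc_eq_integral_Ioo]
    refine setIntegral_congr_fun measurableSet_Ioo fun u hu => ?_
    have hd : deriv g u = e := by
      have : g =ᶠ[𝓝 u] fun u => c + (u - s) * e := by
        filter_upwards [Icc_mem_nhds hu.1 hu.2] with v hv using hg v hv
      rw [this.deriv_eq]
      have : HasDerivAt (fun u => c + (u - s) * e) (1 * e) u :=
        (((hasDerivAt_id u).sub_const s).mul_const e).const_add c
      rw [this.deriv, one_mul]
    rw [hd, hf u ⟨hu.1.le, hu.2.le⟩, hf s ⟨le_rfl, hst⟩]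
    ring
  rw [h1, hf s ⟨le_rfl, hst⟩, hf t ⟨hst, le_rfl⟩, hg s ⟨le_rfl, hst⟩, hg t ⟨hst, le_rfl⟩,
    intervalIntegral.integral_mul_const, intervalIntegral.integral_sub
      intervalIntegral.intervalIntegrable_id intervalIntegrable_const, integral_id,
    intervalIntegral.integral_const, smul_eq_mul]
  ring

theorem norm_le_card_mul {ι : Type*} [Fintype ι] {x : EuclideanSpace ℝ ι} {c : ℝ}
    (h : ∀ i, |x i| ≤ c) : ‖x‖ ≤ Fintype.card ι * c := by
  have h3 : ‖x‖ ≤ ∑ i, |x i| := by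
    rw [EuclideanSpace.norm_eq]
    refine Real.sqrt_le_iff.2 ⟨Finset.sum_nonneg fun _ _ => abs_nonneg _, ?_⟩
    simpa using Finset.sum_sq_le_sq_sum_of_nonneg (s := Finset.univ)
      (f := fun i => |x i|) (fun _ _ => abs_nonneg _)
  refine h3.trans ((Finset.sum_le_sum fun i _ => h i).trans ?_)
  simp

end Area

/-! ### Dyadic approximations -/

section Dyadic

variable {α : HolderExponent} {T : ℝ≥0} {d : ℕ}

theorem sum_clamp (N : ℕ) (x : ℝ) :
    ∑ j ∈ Finset.range N, max 0 (min 1 (x - j)) = max 0 (min (N : ℝ) x) := by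
  induction N with
  | zero => simp
  | succ N ih =>
    rw [Finset.sum_range_succ, ih]
    have : (0 : ℝ) ≤ N := N.cast_nonneg
    push_cast
    rcases le_total x N with h | h
    · rw [min_eq_right h, min_eq_right (by linarith : x ≤ N + 1),
        max_eq_left ((min_le_right _ _).trans (by linarith : x - N ≤ 0)), add_zero]
    · rw [min_eq_left h, max_eq_right this]
      rcases le_total x (N + 1) with h' | h'
      · rw [min_eq_right h', min_eq_right (by linarith), max_eq_right (by linarith),
          max_eq_right (by linarith)]
        ring
      · rw [min_eq_left h', min_eq_left (by linarith), max_eq_right (by linarith),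
          max_eq_right (by linarith)]

/-- Each weight is nondecreasing in t, so the absolute changes of the weights add up to the change
of their sum, which by `sum_clamp` is at most 2^n (t - s)/T. Hence the largest increment, and not
the number of summands, determines the Lipschitz constant. -/
theorem abs_dyadic_sum_sub_le (n : ℕ) {δ : ℕ → ℝ} {L : ℝ} (hδ : ∀ j < 2 ^ n, |δ j| ≤ L) {s t : ℝ}
    (hst : s ≤ t) :
    |∑ j ∈ Finset.range (2 ^ n), max 0 (min 1 (2 ^ n * t / T - j)) * δ j
      - ∑ j ∈ Finset.range (2 ^ n), max 0 (min 1 (2 ^ n * s / T - j)) * δ j|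
      ≤ L * (2 ^ n / T) * (t - s) := by
  have hL : 0 ≤ L := (abs_nonneg _).trans (hδ 0 (by positivity))
  have hτ : 2 ^ n * s / (T : ℝ) ≤ 2 ^ n * t / T := by gcongr
  have hmono : ∀ j : ℕ, max 0 (min 1 (2 ^ n * s / (T : ℝ) - j))
      ≤ max 0 (min 1 (2 ^ n * t / (T : ℝ) - j)) := fun j => by gcongr
  rw [← Finset.sum_sub_distrib]
  calc _ ≤ ∑ j ∈ Finset.range (2 ^ n), |max 0 (min 1 (2 ^ n * t / (T : ℝ) - j)) * δ j
        - max 0 (min 1 (2 ^ n * s / (T : ℝ) - j)) * δ j| := Finset.abs_sum_le_sum_abs _ _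
    _ ≤ ∑ j ∈ Finset.range (2 ^ n), (max 0 (min 1 (2 ^ n * t / (T : ℝ) - j))
        - max 0 (min 1 (2 ^ n * s / (T : ℝ) - j))) * L := by
      refine Finset.sum_le_sum fun j hj => ?_
      rw [← sub_mul, abs_mul, abs_of_nonneg (sub_nonneg.2 (hmono j))]
      exact mul_le_mul_of_nonneg_left (hδ j (Finset.mem_range.1 hj)) (sub_nonneg.2 (hmono j))
    _ = (max 0 (min ((2 ^ n : ℕ) : ℝ) (2 ^ n * t / T))
        - max 0 (min ((2 ^ n : ℕ) : ℝ) (2 ^ n * s / T))) * L := by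
      rw [← Finset.sum_mul, Finset.sum_sub_distrib, sum_clamp, sum_clamp]
    _ ≤ (2 ^ n * t / T - 2 ^ n * s / T) * L := by
      refine mul_le_mul_of_nonneg_right ?_ hL
      have h1 := ((LipschitzWith.id.const_min ((2 ^ n : ℕ) : ℝ)).const_max 0).dist_le_mul
        (2 ^ n * t / (T : ℝ)) (2 ^ n * s / (T : ℝ))
      simp only [id, NNReal.coe_one, one_mul, Real.dist_eq, abs_of_nonneg (sub_nonneg.2 hτ)] at h1
      exact (le_abs_self _).trans h1
    _ = _ := by ring

/-- The `j`-th point of the dyadic grid of level `n`. -/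
noncomputable def gridPoint (T : ℝ≥0) (n j : ℕ) : ℝ := j * T / 2 ^ n

/-- The coordinate increment over the `j`-th dyadic interval of level `n`. -/
noncomputable def gridIncr (w : PathSpace T d) (n j : ℕ) (i : Fin d) : ℝ :=
  w.extend (gridPoint T n (j + 1)) i - w.extend (gridPoint T n j) i

theorem gridPoint_nonneg (n j : ℕ) : 0 ≤ gridPoint T n j := by
  unfold gridPoint; positivity

theorem gridPoint_le {n j : ℕ} (hj : j ≤ 2 ^ n) : gridPoint T n j ≤ T := by
  rw [gridPoint, div_le_iff₀ (by positivity), mul_comm]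
  have : (j : ℝ) ≤ 2 ^ n := by exact_mod_cast hj
  gcongr

theorem gridPoint_mono (n : ℕ) : Monotone (gridPoint T n) := fun i j h => by
  unfold gridPoint; gcongr

theorem gridPoint_succ_level (n j : ℕ) : gridPoint T (n + 1) (2 * j) = gridPoint T n j := by
  unfold gridPoint; push_cast; rw [pow_succ]; field_simp

theorem dyadicApprox_coord (w : PathSpace T d) (n : ℕ) (i : Fin d) {t : ℝ}
    (ht : t ∈ Set.Icc (0 : ℝ) T) : (w.dyadicApprox n).coord i t
      = ∑ j ∈ Finset.range (2 ^ n), max 0 (min 1 (2 ^ n * t / T - j)) * gridIncr w n j i := by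
  rw [LipschitzPath.coord, PathSpace.extend, Set.projIcc_of_mem _ ht]
  change w.dyadicFun n t i = _
  simp [PathSpace.dyadicFun, gridIncr, gridPoint]

theorem projIcc_coord (w : LipschitzPath T d) (i : Fin d) (t : ℝ) :
    w.coord i t = w.coord i (Set.projIcc (0 : ℝ) T T.coe_nonneg t) := by
  rw [LipschitzPath.coord_coe]; rfl

theorem lipschitzWith_of_icc {f : ℝ → ℝ} {K : ℝ≥0}
    (hf : ∀ t, f t = f (Set.projIcc (0 : ℝ) T T.coe_nonneg t))
    (h : ∀ s t, s ∈ Set.Icc (0 : ℝ) T → t ∈ Set.Icc (0 : ℝ) T → s ≤ t → |f t - f s| ≤ K * (t - s)) :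
    LipschitzWith K f := by
  refine LipschitzWith.of_le_add_mul K fun x y => ?_
  have key : ∀ s t : TimeInterval T, |f t - f s| ≤ K * |(t : ℝ) - s| := by
    intro s t
    rcases le_total s t with hst | hst
    · rw [abs_of_nonneg (sub_nonneg.2 (show (s : ℝ) ≤ t from hst))]
      exact h s t s.2 t.2 hst
    · rw [abs_sub_comm, abs_sub_comm (t : ℝ),
        abs_of_nonneg (sub_nonneg.2 (show (t : ℝ) ≤ s from hst))]
      exact h t s t.2 s.2 hst
  have h1 := key (Set.projIcc (0 : ℝ) T T.coe_nonneg y) (Set.projIcc (0 : ℝ) T T.coe_nonneg x)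
  have h2 := (LipschitzWith.projIcc (a := (0 : ℝ)) (b := T) T.coe_nonneg).dist_le_mul x y
  rw [NNReal.coe_one, one_mul, Subtype.dist_eq, Real.dist_eq] at h2
  rw [← hf, ← hf] at h1
  have h3 := mul_le_mul_of_nonneg_left h2 K.coe_nonneg
  linarith [le_abs_self (f x - f y)]

/-- The dyadic approximations are Lipschitz, with a constant given by the grid increments. -/
theorem lipschitzWith_dyadicApprox_coord (w : PathSpace T d) (n : ℕ) (i : Fin d) {L : ℝ≥0}
    (hL : ∀ j < 2 ^ n, |gridIncr w n j i| ≤ L) :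
    LipschitzWith (L * (2 ^ n / T)) ((w.dyadicApprox n).coord i) := by
  refine lipschitzWith_of_icc (projIcc_coord _ i) fun s t hs ht hst => ?_
  rw [dyadicApprox_coord w n i hs, dyadicApprox_coord w n i ht]
  push_cast
  exact abs_dyadic_sum_sub_le n hL hst

theorem lipschitzWith_dyadicApprox_coord_sub (w v : PathSpace T d) (n : ℕ) (i : Fin d) {L : ℝ≥0}
    (hL : ∀ j < 2 ^ n, |gridIncr w n j i - gridIncr v n j i| ≤ L) :
    LipschitzWith (L * (2 ^ n / T)) ((w.dyadicApprox n).coord i - (v.dyadicApprox n).coord i) := by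
  refine lipschitzWith_of_icc (T := T) (fun t => ?_) fun s t hs ht hst => ?_
  · rw [Pi.sub_apply, Pi.sub_apply, ← projIcc_coord, ← projIcc_coord]
  simp only [Pi.sub_apply]
  rw [dyadicApprox_coord w n i hs, dyadicApprox_coord w n i ht, dyadicApprox_coord v n i hs,
    dyadicApprox_coord v n i ht, ← Finset.sum_sub_distrib, ← Finset.sum_sub_distrib]
  simp only [← mul_sub]
  push_cast
  exact abs_dyadic_sum_sub_le n hL hst

/-- On the k-th cell the weights of earlier increments equal 1, so these telescope to the value at
the left grid point (the path starts at 0), and the weights of later increments vanish. Only the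
k-th weight varies, linearly. -/
theorem dyadicApprox_coord_eq (hT : 0 < T) (w : PathSpace T d) (n : ℕ) (i : Fin d) {k : ℕ}
    (hk : k < 2 ^ n) {t : ℝ}
    (ht : t ∈ Set.Icc (gridPoint T n k) (gridPoint T n (k + 1))) :
    (w.dyadicApprox n).coord i t = w.extend (gridPoint T n k) i
      + (t - gridPoint T n k) * (2 ^ n / T * gridIncr w n k i) := by
  have hT' : (0 : ℝ) < T := hT
  have ht' : t ∈ Set.Icc (0 : ℝ) T := ⟨(gridPoint_nonneg n k).trans ht.1,
    ht.2.trans (gridPoint_le hk)⟩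
  have h1 : (k : ℝ) ≤ 2 ^ n * t / T := by
    have := ht.1
    rw [gridPoint, div_le_iff₀ (by positivity)] at this
    rw [le_div_iff₀ hT']; linarith
  have h2 : 2 ^ n * t / T ≤ (k : ℝ) + 1 := by
    have := ht.2
    rw [gridPoint, le_div_iff₀ (by positivity)] at this
    push_cast at this
    rw [div_le_iff₀ hT']; linarith
  rw [dyadicApprox_coord w n i ht']
  have hsub : Finset.range (k + 1) ⊆ Finset.range (2 ^ n) := Finset.range_subset_range.2 hk
  rw [← Finset.sum_subset hsub]
  · rw [Finset.sum_range_succ]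
    have e1 : ∑ j ∈ Finset.range k, max 0 (min 1 (2 ^ n * t / (T : ℝ) - j)) * gridIncr w n j i
        = w.extend (gridPoint T n k) i := by
      have e2 : ∀ j ∈ Finset.range k, max 0 (min 1 (2 ^ n * t / (T : ℝ) - j)) * gridIncr w n j i
          = w.extend (gridPoint T n (j + 1)) i - w.extend (gridPoint T n j) i := by
        intro j hj
        have : (j : ℝ) + 1 ≤ k := by exact_mod_cast Finset.mem_range.1 hj
        rw [min_eq_left (by linarith), max_eq_right zero_le_one, one_mul, gridIncr]
      rw [Finset.sum_congr rfl e2, Finset.sum_range_sub (fun j => w.extend (gridPoint T n j) i)]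
      have : w.extend (gridPoint T n 0) = 0 := by
        rw [PathSpace.extend, gridPoint, Nat.cast_zero, zero_mul, zero_div, Set.projIcc_left]
        exact w.path_start
      simp [this]
    rw [e1, min_eq_right (by linarith), max_eq_right (by linarith), gridPoint]
    field_simp
  · intro j _ hj
    have : (k : ℝ) + 1 ≤ j := by
      have := Finset.mem_range.not.1 hj
      exact_mod_cast (not_lt.1 this)
    rw [max_eq_left ((min_le_right _ _).trans (by linarith)), zero_mul]

/-- Dyadic approximations agree with the path on the grid. -/
theorem dyadicApprox_coord_gridPoint (hT : 0 < T) (w : PathSpace T d) (n : ℕ) (i : Fin d) {k : ℕ}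
    (hk : k ≤ 2 ^ n) :
    (w.dyadicApprox n).coord i (gridPoint T n k) = w.extend (gridPoint T n k) i := by
  have hT' : (0 : ℝ) < T := hT
  rcases hk.lt_or_eq with h | h
  · rw [dyadicApprox_coord_eq hT w n i h ⟨le_rfl, gridPoint_mono n (Nat.le_succ k)⟩]
    ring
  -- The final grid point starts no cell of [0, T] and is reached as the right end of the last one.
  · have h2 : 0 < 2 ^ n := by positivity
    obtain ⟨l, rfl⟩ : ∃ l, k = l + 1 := ⟨k - 1, by omega⟩
    rw [dyadicApprox_coord_eq hT w n i (by omega) ⟨gridPoint_mono n (Nat.le_succ l), le_rfl⟩,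
      gridIncr]
    have : (gridPoint T n (l + 1) - gridPoint T n l) * (2 ^ n / T) = 1 := by
      unfold gridPoint; push_cast; field_simp; ring
    linear_combination (w.extend (gridPoint T n (l + 1)) i - w.extend (gridPoint T n l) i) * this

/-- The area of a dyadic approximation over a dyadic interval. -/
theorem dyadicApprox_area (hT : 0 < T) (w : PathSpace T d) (n : ℕ) (i j : Fin d) {k : ℕ}
    (hk : k < 2 ^ n) : (w.dyadicApprox n).area i j (gridPoint T n k) (gridPoint T n (k + 1))
      = gridIncr w n k i * gridIncr w n k j / 2 := by
  have := iteratedIntegral_affine (gridPoint_mono (T := T) n (Nat.le_succ k))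
    (fun u hu => dyadicApprox_coord_eq hT w n i hk hu)
    (fun u hu => dyadicApprox_coord_eq hT w n j hk hu)
  rw [dyadicApprox_coord_gridPoint hT w n i hk.le, dyadicApprox_coord_gridPoint hT w n j hk.le,
    dyadicApprox_coord_gridPoint hT w n i hk, dyadicApprox_coord_gridPoint hT w n j hk] at this
  exact this

/-- The difference of the areas of two consecutive dyadic approximations over a dyadic interval. -/
noncomputable def areaIncr (w : PathSpace T d) (n k : ℕ) (i j : Fin d) : ℝ :=
  (gridIncr w (n + 1) (2 * k) i * gridIncr w (n + 1) (2 * k + 1) j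
    - gridIncr w (n + 1) (2 * k + 1) i * gridIncr w (n + 1) (2 * k) j) / 2

/-- Over one cell of level n the coarse path is affine and the fine path consists of two affine
pieces. With half-increments a and b, the areas differ by (a_i b_j - b_i a_j)/2, a Lévy area. The
cross terms that Chen's relation adds when cells are joined cancel, because both paths agree on the
coarse grid. -/
theorem dyadicApprox_area_sub (hT : 0 < T) (w : PathSpace T d) (n : ℕ) (i j : Fin d) {k l : ℕ}
    (hkl : k ≤ l) (hl : l ≤ 2 ^ n) :
    (w.dyadicApprox (n + 1)).area i j (gridPoint T n k) (gridPoint T n l)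
      - (w.dyadicApprox n).area i j (gridPoint T n k) (gridPoint T n l)
      = ∑ m ∈ Finset.Ico k l, areaIncr w n m i j := by
  induction l, hkl using Nat.le_induction with
  | base => simp [LipschitzPath.area]
  | succ l hkl ih =>
    have hl' : l < 2 ^ n := hl
    have hl2 : 2 * l + 1 < 2 ^ (n + 1) := by rw [pow_succ]; omega
    have hk2 : 2 * k ≤ 2 ^ (n + 1) := by rw [pow_succ]; omega
    rw [Finset.sum_Ico_succ_top hkl, ← ih hl'.le, LipschitzPath.area_chen _ i j _ (gridPoint T n l),
      LipschitzPath.area_chen (w.dyadicApprox n) i j _ (gridPoint T n l),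
      dyadicApprox_area hT w n i j hl']
    have e := LipschitzPath.area_chen (w.dyadicApprox (n + 1)) i j (gridPoint T n l)
      (gridPoint T (n + 1) (2 * l + 1)) (gridPoint T n (l + 1))
    have g2 : gridPoint T n (l + 1) = gridPoint T (n + 1) (2 * l + 1 + 1) := by
      rw [← gridPoint_succ_level]; rfl
    have c : ∀ i : Fin d, ∀ m ≤ 2 ^ n, (w.dyadicApprox (n + 1)).coord i (gridPoint T n m)
        = (w.dyadicApprox n).coord i (gridPoint T n m) := by
      intro i m hm
      rw [dyadicApprox_coord_gridPoint hT w n i hm, ← gridPoint_succ_level,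
        dyadicApprox_coord_gridPoint hT w (n + 1) i (by rw [pow_succ]; omega)]
    rw [e, c i l hl'.le, c i k (hkl.trans hl'.le), c j l hl'.le, c j (l + 1) hl]
    have a1 := dyadicApprox_area hT w (n + 1) i j (k := 2 * l) (by omega)
    have a2 := dyadicApprox_area hT w (n + 1) i j (k := 2 * l + 1) hl2
    rw [← g2] at a2
    rw [gridPoint_succ_level] at a1
    rw [a1, a2, dyadicApprox_coord_gridPoint hT w (n + 1) i hl2.le,
      dyadicApprox_coord_gridPoint hT w (n + 1) j hl2.le,
      dyadicApprox_coord_gridPoint hT w n j hl, dyadicApprox_coord_gridPoint hT w n j hl'.le,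
      ← c i l hl'.le,
      ← gridPoint_succ_level n l, dyadicApprox_coord_gridPoint hT w (n + 1) i (by omega)]
    simp only [areaIncr, gridIncr, ← g2, ← gridPoint_succ_level n l]
    ring

/-- The natural lift depends continuously on the path in the Lipschitz norm. -/
theorem dist_naturalLift_le {u v : LipschitzPath T d} {K ε : ℝ≥0}
    (hu : ∀ i, LipschitzWith K (u.coord i)) (hv : ∀ i, LipschitzWith K (v.coord i))
    (huv : ∀ i, LipschitzWith ε (u.coord i - v.coord i)) :
    dist (naturalLift α u) (naturalLift α v)
      ≤ (d * (T : ℝ) ^ (1 - (α : ℝ)) + (d * d) * (2 * K * (T : ℝ) ^ (2 - 2 * (α : ℝ)))) * ε := by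
  have hα := RoughPath.exponent_pos α
  have hα' := α.2.2
  refine RoughPath.dist_le (by positivity) (fun q => ?_) (fun q => ?_)
  · have h0 := simplex_length_nonneg q
    have h1 : ∀ i, |((naturalLift α u).fst q - (naturalLift α v).fst q) i|
        ≤ ε * ((q.1.2 : ℝ) - q.1.1) := by
      intro i
      have := (huv i).dist_le_mul (q.1.2 : ℝ) (q.1.1 : ℝ)
      rw [Real.dist_eq, Real.dist_eq, abs_of_nonneg h0] at this
      simp only [Pi.sub_apply, LipschitzPath.coord_coe] at this
      simp only [naturalLift, ContinuousMap.coe_mk, PiLp.sub_apply]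
      convert! this using 2
      ring
    have h2 := rpow_holder_bound (γ := 1) hα (by linarith) q
    rw [Real.rpow_one] at h2
    refine (norm_le_card_mul h1).trans ?_
    rw [Fintype.card_fin]
    calc (d : ℝ) * (ε * ((q.1.2 : ℝ) - q.1.1))
        ≤ d * (ε * ((T : ℝ) ^ (1 - (α : ℝ)) * ((q.1.2 : ℝ) - (q.1.1 : ℝ)) ^ (α : ℝ))) := by gcongr
      _ = (d * (T : ℝ) ^ (1 - (α : ℝ)) + 0) * ε * ((q.1.2 : ℝ) - (q.1.1 : ℝ)) ^ (α : ℝ) := by ring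
      _ ≤ _ := by gcongr; positivity
  · have h0 := simplex_length_nonneg q
    have h1 : ∀ ij, |((naturalLift α u).snd q - (naturalLift α v).snd q) ij|
        ≤ 2 * K * ε * ((q.1.2 : ℝ) - q.1.1) ^ 2 := fun ij =>
      abs_iteratedIntegral_sub_le (hu ij.1) (hv ij.1) (hu ij.2) (hv ij.2) (huv ij.1) (huv ij.2) q.2
    have h2 := rpow_holder_bound (γ := 2) (mul_pos two_pos hα) (by linarith) q
    rw [Real.rpow_two] at h2
    refine (norm_le_card_mul h1).trans ?_
    rw [Fintype.card_prod, Fintype.card_fin]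
    push_cast
    calc (d * d : ℝ) * (2 * K * ε * ((q.1.2 : ℝ) - q.1.1) ^ 2)
        ≤ d * d * (2 * K * ε * ((T : ℝ) ^ (2 - 2 * (α : ℝ))
          * ((q.1.2 : ℝ) - (q.1.1 : ℝ)) ^ (2 * (α : ℝ)))) := by gcongr
      _ = (0 + d * d * (2 * K * (T : ℝ) ^ (2 - 2 * (α : ℝ)))) * ε
          * ((q.1.2 : ℝ) - (q.1.1 : ℝ)) ^ (2 * (α : ℝ)) := by ring
      _ ≤ _ := by gcongr; positivity

theorem abs_extend_sub_le (w v : PathSpace T d) (t : ℝ) (i : Fin d) :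
    |w.extend t i - v.extend t i| ≤ dist w.path v.path := by
  refine (PiLp.norm_apply_le (w.extend t - v.extend t) i).trans ?_
  rw [← dist_eq_norm]
  exact ContinuousMap.dist_apply_le_dist _

theorem abs_gridIncr_le (w : PathSpace T d) (n j : ℕ) (i : Fin d) :
    |gridIncr w n j i| ≤ 2 * ‖w.path‖ := by
  have h : ∀ t, |w.extend t i| ≤ ‖w.path‖ := fun t =>
    (PiLp.norm_apply_le (w.extend t) i).trans (w.path.norm_coe_le_norm _)
  unfold gridIncr
  have := abs_sub (w.extend (gridPoint T n (j + 1)) i) (w.extend (gridPoint T n j) i)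
  linarith [h (gridPoint T n (j + 1)), h (gridPoint T n j)]

theorem abs_gridIncr_sub_le (w v : PathSpace T d) (n j : ℕ) (i : Fin d) :
    |gridIncr w n j i - gridIncr v n j i| ≤ 2 * dist w.path v.path := by
  have h1 := abs_le.1 (abs_extend_sub_le w v (gridPoint T n (j + 1)) i)
  have h2 := abs_le.1 (abs_extend_sub_le w v (gridPoint T n j) i)
  unfold gridIncr
  rw [abs_le]
  constructor <;> linarith

/-- At a fixed level the approximation involves finitely many values of the path, so uniform
closeness of paths implies Lipschitz closeness of approximations, with a factor depending on n. -/
theorem continuous_dyadicLift (n : ℕ) :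
    Continuous (dyadicLift α n : PathSpace T d → GeometricRoughPath α T d) := by
  have hpath : Continuous (PathSpace.path : PathSpace T d → _) := continuous_induced_dom
  refine continuous_iff_continuousAt.2 fun v => ?_
  rw [ContinuousAt, tendsto_iff_dist_tendsto_zero]
  set K : ℝ≥0 := 2 * (‖v.path‖₊ + 1) * (2 ^ n / T) with hK
  set C : ℝ := (d * (T : ℝ) ^ (1 - (α : ℝ)) + (d * d) * (2 * K * (T : ℝ) ^ (2 - 2 * (α : ℝ))))
  have hd : Tendsto (fun w : PathSpace T d => dist w.path v.path) (𝓝 v) (𝓝 0) :=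
    tendsto_iff_dist_tendsto_zero.1 (hpath.tendsto v)
  have hlim : Tendsto (fun w : PathSpace T d => C * (2 * dist w.path v.path * (2 ^ n / T))) (𝓝 v)
      (𝓝 0) := by
    simpa using ((hd.const_mul 2).mul_const (2 ^ n / (T : ℝ))).const_mul C
  refine squeeze_zero' (Eventually.of_forall fun _ => dist_nonneg) ?_ hlim
  filter_upwards [hd.eventually (gt_mem_nhds one_pos)] with w hw
  have hb : ∀ w : PathSpace T d, dist w.path v.path < 1 → ∀ i,
      LipschitzWith K ((w.dyadicApprox n).coord i) := by
    intro w hw i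
    refine lipschitzWith_dyadicApprox_coord w n i fun j _ => (abs_gridIncr_le w n j i).trans ?_
    push_cast
    have := norm_le_norm_add_norm_sub' w.path v.path
    rw [dist_eq_norm] at hw
    gcongr
    linarith
  have := dist_naturalLift_le (α := α) (ε := 2 * nndist w.path v.path * (2 ^ n / T)) (hb w hw)
    (hb v (by simp)) fun i => lipschitzWith_dyadicApprox_coord_sub w v n i fun j _ =>
      abs_gridIncr_sub_le w v n j i
  exact this.trans (le_of_eq (by push_cast; rfl))

end Dyadic

end RoughFoliation

namespace RoughFoliation

/-! ### Distance of paths that agree on a grid -/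

section GridDistance

variable {α : HolderExponent} {T : ℝ≥0} {d : ℕ}

theorem exists_grid_below {h t : ℝ} (hh : 0 < h) (ht : 0 ≤ t) {N : ℕ} (htN : t ≤ N * h) :
    ∃ k ≤ N, k * h ≤ t ∧ t - k * h ≤ h := by
  refine ⟨⌊t / h⌋₊, ?_, ?_, ?_⟩
  · refine Nat.floor_le_of_le ?_
    rwa [div_le_iff₀ hh]
  · have := Nat.floor_le (div_nonneg ht hh.le)
    rwa [le_div_iff₀ hh] at this
  · have := (Nat.lt_floor_add_one (t / h)).le
    rw [div_le_iff₀ hh] at this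
    linarith

/-- An interval at least one mesh long contains a grid point, so the rounded-up left end does not
exceed the rounded-down right end. -/
theorem exists_grid_between {h s t : ℝ} (hh : 0 < h) (hs : 0 ≤ s) (hst : h ≤ t - s) {N : ℕ}
    (htN : t ≤ N * h) :
    ∃ k l : ℕ, k ≤ l ∧ l ≤ N ∧ s ≤ k * h ∧ k * h - s ≤ h ∧ l * h ≤ t ∧ t - l * h ≤ h := by
  obtain ⟨l, hl, hlt, htl⟩ := exists_grid_below hh (by linarith : 0 ≤ t) htN
  have h1 := Nat.le_ceil (s / h)
  have h2 := (Nat.ceil_lt_add_one (div_nonneg hs hh.le)).le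
  rw [div_le_iff₀ hh] at h1
  have h3 : (⌈s / h⌉₊ : ℝ) * h ≤ s + h := by
    have := mul_le_mul_of_nonneg_right h2 hh.le
    rwa [add_mul, div_mul_cancel₀ _ hh.ne', one_mul] at this
  have h4 := Nat.ceil_lt_add_one (div_nonneg hs hh.le)
  refine ⟨⌈s / h⌉₊, l, ?_, hl, h1, by linarith, hlt, htl⟩
  have h5 : (⌈s / h⌉₊ : ℝ) < l + 1 := by
    have e1 := mul_lt_mul_of_pos_right h4 hh
    rw [add_mul, div_mul_cancel₀ _ hh.ne', one_mul] at e1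
    refine lt_of_mul_lt_mul_right ?_ hh.le
    linarith
  have : ⌈s / h⌉₊ < l + 1 := by exact_mod_cast h5
  omega

variable {u v : LipschitzPath T d} {r q : ℝ} {N : ℕ}

/-- Two Lipschitz paths that agree on the points of a grid of mesh `q²`. -/
structure GridClose (u v : LipschitzPath T d) (r q : ℝ) (N : ℕ) : Prop where
  one_le : 1 ≤ r
  pos : 0 < q
  length : N * q ^ 2 = T
  lip_left : ∀ i s t, s ≤ t → |u.coord i t - u.coord i s| ≤ 2 * r / q * (t - s)
  lip_right : ∀ i s t, s ≤ t → |v.coord i t - v.coord i s| ≤ 2 * r / q * (t - s)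
  area_left : ∀ i j s t, s ≤ t → |u.area i j s t| ≤ (2 * r / q) ^ 2 * (t - s) ^ 2
  area_right : ∀ i j s t, s ≤ t → |v.area i j s t| ≤ (2 * r / q) ^ 2 * (t - s) ^ 2
  agree : ∀ i, ∀ k ≤ N, u.coord i (k * q ^ 2) = v.coord i (k * q ^ 2)
  incr : ∀ i, ∀ k l, k ≤ l → l ≤ N →
    |v.coord i (l * q ^ 2) - v.coord i (k * q ^ 2)| ≤ r * q * √((l : ℝ) - k)
  area : ∀ i j, ∀ k l, k ≤ l → l ≤ N →
    |u.area i j (k * q ^ 2) (l * q ^ 2) - v.area i j (k * q ^ 2) (l * q ^ 2)|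
      ≤ r * q ^ 2 * √((l : ℝ) - k)

/-- Since the last common grid point, each path has moved by at most (2r/q) q² = 2rq. -/
theorem GridClose.abs_sub_le (h : GridClose u v r q N) (i : Fin d) {t : ℝ} (ht : 0 ≤ t)
    (htT : t ≤ T) : |u.coord i t - v.coord i t| ≤ 4 * r * q := by
  have hq := h.pos
  obtain ⟨k, hk, hkt, htk⟩ := exists_grid_below (pow_pos h.pos 2) ht (h.length ▸ htT)
  have h1 := h.lip_left i _ _ hkt
  have h2 := h.lip_right i _ _ hkt
  rw [h.agree i k hk] at h1
  have hr := h.one_le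
  have h3 : 2 * r / q * (t - k * q ^ 2) ≤ 2 * r * q := by
    calc _ ≤ 2 * r / q * q ^ 2 := by gcongr
      _ = _ := by field_simp
  rw [abs_le] at *
  constructor <;> linarith [h1.1, h1.2, h2.1, h2.2]

/-- Two regimes for ρ = (t - s)/q². If ρ ≤ 1 the Lipschitz bounds apply and ρ ≤ ρ^β. If ρ ≥ 1 the
uniform distance is enough, as ρ^β ≥ 1. -/
theorem GridClose.fst_le (h : GridClose u v r q N) (i : Fin d) {s t : ℝ} (hs : 0 ≤ s) (hst : s ≤ t)
    (ht : t ≤ T) {β : ℝ} (hβ0 : 0 ≤ β) (hβ : β ≤ 1) :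
    |(u.coord i t - u.coord i s) - (v.coord i t - v.coord i s)|
      ≤ 8 * r * q * ((t - s) / q ^ 2) ^ β := by
  have hq := h.pos
  have hr := h.one_le
  have h0 : 0 ≤ t - s := sub_nonneg.2 hst
  have hρ0 : 0 ≤ (t - s) / q ^ 2 := by positivity
  rcases le_total (t - s) (q ^ 2) with hle | hle
  · have hρ : (t - s) / q ^ 2 ≤ 1 := by rwa [div_le_one (by positivity)]
    have h1 := h.lip_left i s t hst
    have h2 := h.lip_right i s t hst
    have h3 : (t - s) / q ^ 2 ≤ ((t - s) / q ^ 2) ^ β := Real.self_le_rpow_of_le_one hρ0 hρ hβ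
    have h4 : 2 * r / q * (t - s) = 2 * r * q * ((t - s) / q ^ 2) := by field_simp
    have h5 : 2 * r * q * ((t - s) / q ^ 2) ≤ 2 * r * q * ((t - s) / q ^ 2) ^ β := by gcongr
    have h6 : 0 ≤ 2 * r * q * ((t - s) / q ^ 2) ^ β := by positivity
    rw [abs_le] at *
    constructor <;> linarith [h1.1, h1.2, h2.1, h2.2]
  · have hρ : 1 ≤ ((t - s) / q ^ 2) ^ β :=
      Real.one_le_rpow (by rwa [one_le_div (by positivity)]) hβ0
    have h1 := h.abs_sub_le i hs (hst.trans ht)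
    have h2 := h.abs_sub_le i (hs.trans hst) ht
    have h3 : 8 * r * q * 1 ≤ 8 * r * q * ((t - s) / q ^ 2) ^ β := by gcongr
    rw [abs_le] at *
    constructor <;> linarith [h1.1, h1.2, h2.1, h2.2]

/-- Below one mesh both areas are quadratic in t - s. Above it, s and t are moved inward to grid
points s' and t'. The difference of areas over [s', t'] is controlled by assumption, and all other
terms in Chen's relation involve an end piece of at most one mesh. The grid bounds grow like √ρ,
where ρ = (t - s)/q², and √ρ ≤ ρ^β requires β ≥ 1/2. -/
theorem GridClose.snd_le (h : GridClose u v r q N) (i j : Fin d) {s t : ℝ} (hs : 0 ≤ s)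
    (hst : s ≤ t) (ht : t ≤ T) {β : ℝ} (hβ0 : 1 / 2 ≤ β) (hβ : β ≤ 2) :
    |u.area i j s t - v.area i j s t| ≤ 33 * r ^ 2 * q ^ 2 * ((t - s) / q ^ 2) ^ β := by
  have hq := h.pos
  have hr := h.one_le
  have h0 : 0 ≤ t - s := sub_nonneg.2 hst
  have hρ0 : 0 ≤ (t - s) / q ^ 2 := by positivity
  rcases le_total (t - s) (q ^ 2) with hle | hle
  · have hρ : (t - s) / q ^ 2 ≤ 1 := by rwa [div_le_one (by positivity)]
    have h1 := h.area_left i j s t hst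
    have h2 := h.area_right i j s t hst
    have h3 : ((t - s) / q ^ 2) ^ 2 ≤ ((t - s) / q ^ 2) ^ β := by
      rw [← Real.rpow_two]
      exact Real.rpow_le_rpow_of_exponent_ge_of_imp hρ0 hρ hβ (by intro _ h; linarith)
    have h4 : (2 * r / q) ^ 2 * (t - s) ^ 2 = 4 * r ^ 2 * q ^ 2 * ((t - s) / q ^ 2) ^ 2 := by
      field_simp; ring
    have h5 : 4 * r ^ 2 * q ^ 2 * ((t - s) / q ^ 2) ^ 2
        ≤ 4 * r ^ 2 * q ^ 2 * ((t - s) / q ^ 2) ^ β := by gcongr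
    have h6 : 0 ≤ r ^ 2 * q ^ 2 * ((t - s) / q ^ 2) ^ β := by positivity
    have h7 := abs_sub (u.area i j s t) (v.area i j s t)
    linarith
  · have hρ1 : 1 ≤ (t - s) / q ^ 2 := by rwa [one_le_div (by positivity)]
    obtain ⟨k, l, hkl, hl, hsk, hsk', hlt, hlt'⟩ :=
      exists_grid_between (pow_pos h.pos 2) hs hle (h.length ▸ ht)
    have hkN := hkl.trans hl
    have hklr : (k : ℝ) * q ^ 2 ≤ l * q ^ 2 := by gcongr
    have hs' : (k : ℝ) * q ^ 2 ≤ T := by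
      rw [← h.length]; gcongr
    have hl0 : 0 ≤ (l : ℝ) * q ^ 2 := by positivity
    set s' := (k : ℝ) * q ^ 2 with hs'def
    set t' := (l : ℝ) * q ^ 2 with ht'def
    set P := √((t - s) / q ^ 2) with hP
    have hP1 : 1 ≤ P := Real.one_le_sqrt.2 hρ1
    have hlk : √((l : ℝ) - k) ≤ P := by
      refine Real.sqrt_le_sqrt ?_
      rw [le_div_iff₀ (by positivity), sub_mul]
      linarith
    have hPβ : P ≤ ((t - s) / q ^ 2) ^ β := by
      rw [hP, Real.sqrt_eq_rpow]
      exact Real.rpow_le_rpow_of_exponent_le hρ1 hβ0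
    have harea : ∀ a b : ℝ, a ≤ b → b - a ≤ q ^ 2 →
        (2 * r / q) ^ 2 * (b - a) ^ 2 ≤ 4 * (r ^ 2 * q ^ 2) := by
      intro a b hab hb
      have : 0 ≤ b - a := sub_nonneg.2 hab
      calc _ ≤ (2 * r / q) ^ 2 * (q ^ 2) ^ 2 := by gcongr
        _ = _ := by field_simp; ring
    have hlip : ∀ a b : ℝ, a ≤ b → b - a ≤ q ^ 2 → 2 * r / q * (b - a) ≤ 2 * r * q := by
      intro a b hab hb
      calc _ ≤ 2 * r / q * q ^ 2 := by gcongr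
        _ = _ := by field_simp
    have a1 := (h.area_left i j _ _ hsk).trans (harea _ _ hsk hsk')
    have a2 := (h.area_right i j _ _ hsk).trans (harea _ _ hsk hsk')
    have a3 := (h.area_left i j _ _ hlt).trans (harea _ _ hlt hlt')
    have a4 := (h.area_right i j _ _ hlt).trans (harea _ _ hlt hlt')
    have a5 : |u.area i j s' t' - v.area i j s' t'| ≤ r * q ^ 2 * P :=
      (h.area i j k l hkl hl).trans (by gcongr)
    have b1 := (h.lip_left i _ _ hsk).trans (hlip _ _ hsk hsk')
    have b2 := (h.lip_right i _ _ hsk).trans (hlip _ _ hsk hsk')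
    have b3 := (h.lip_left j _ _ hlt).trans (hlip _ _ hlt hlt')
    have b4 := (h.lip_right j _ _ hlt).trans (hlip _ _ hlt hlt')
    have c1 : ∀ i, |v.coord i t' - v.coord i s'| ≤ r * q * P := fun i =>
      (h.incr i k l hkl hl).trans (by gcongr)
    have e1 : |u.coord i s - v.coord i s| ≤ 4 * r * q := h.abs_sub_le i hs (hst.trans ht)
    have e2 : |u.coord j t - v.coord j t| ≤ 4 * r * q := h.abs_sub_le j (hs.trans hst) ht
    have g1 : ∀ i, u.coord i s' = v.coord i s' := fun i => h.agree i k hkN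
    have g2 : ∀ i, u.coord i t' = v.coord i t' := fun i => h.agree i l hl
    rw [u.area_chen i j s t' t, u.area_chen i j s s' t', v.area_chen i j s t' t,
      v.area_chen i j s s' t']
    -- After Chen's relation and agreement at s' and t', there remain four end areas, one area
    -- difference between grid points and four products. In units of r² q² P they contribute 16, 1
    -- and 16, whence the constant 33.
    have key : u.area i j s s' + u.area i j s' t'
          + (u.coord i s' - u.coord i s) * (u.coord j t' - u.coord j s') + u.area i j t' t
          + (u.coord i t' - u.coord i s) * (u.coord j t - u.coord j t')
        - (v.area i j s s' + v.area i j s' t'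
          + (v.coord i s' - v.coord i s) * (v.coord j t' - v.coord j s') + v.area i j t' t
          + (v.coord i t' - v.coord i s) * (v.coord j t - v.coord j t'))
        = u.area i j s s' - v.area i j s s' + (u.area i j t' t - v.area i j t' t)
          + (u.area i j s' t' - v.area i j s' t')
          - (u.coord i s - v.coord i s) * (v.coord j t' - v.coord j s')
          + (u.coord i s' - u.coord i s) * (u.coord j t - u.coord j t')
          - (v.coord i s' - v.coord i s) * (v.coord j t - v.coord j t')
          + (v.coord i t' - v.coord i s') * (u.coord j t - v.coord j t) := by
      rw [g1 i, g1 j, g2 i, g2 j]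
      ring
    rw [key]
    have m1 : |(u.coord i s - v.coord i s) * (v.coord j t' - v.coord j s')|
        ≤ (4 * r * q) * (r * q * P) := by
      rw [abs_mul]; exact mul_le_mul e1 (c1 j) (abs_nonneg _) (by positivity)
    have m2 : |(u.coord i s' - u.coord i s) * (u.coord j t - u.coord j t')|
        ≤ (2 * r * q) * (2 * r * q) := by
      rw [abs_mul]; exact mul_le_mul b1 b3 (abs_nonneg _) (by positivity)
    have m3 : |(v.coord i s' - v.coord i s) * (v.coord j t - v.coord j t')|
        ≤ (2 * r * q) * (2 * r * q) := by
      rw [abs_mul]; exact mul_le_mul b2 b4 (abs_nonneg _) (by positivity)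
    have m4 : |(v.coord i t' - v.coord i s') * (u.coord j t - v.coord j t)|
        ≤ (r * q * P) * (4 * r * q) := by
      rw [abs_mul]; exact mul_le_mul (c1 i) e2 (abs_nonneg _) (by positivity)
    have hE : r ^ 2 * q ^ 2 ≤ r ^ 2 * q ^ 2 * P := le_mul_of_one_le_right (by positivity) hP1
    have hE2 : r * q ^ 2 * P ≤ r ^ 2 * q ^ 2 * P := by
      have : r ≤ r ^ 2 := by nlinarith
      gcongr
    have hE3 : 33 * (r ^ 2 * q ^ 2 * P) ≤ 33 * r ^ 2 * q ^ 2 * ((t - s) / q ^ 2) ^ β := by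
      calc _ = 33 * r ^ 2 * q ^ 2 * P := by ring
        _ ≤ _ := by gcongr
    refine le_trans ?_ hE3
    have n1 : (4 * r * q) * (r * q * P) = 4 * (r ^ 2 * q ^ 2 * P) := by ring
    have n2 : (2 * r * q) * (2 * r * q) = 4 * (r ^ 2 * q ^ 2) := by ring
    have n4 : (r * q * P) * (4 * r * q) = 4 * (r ^ 2 * q ^ 2 * P) := by ring
    rw [n1] at m1
    rw [n2] at m2 m3
    rw [n4] at m4
    rw [abs_le] at *
    constructor <;> linarith [a1.1, a1.2, a2.1, a2.2, a3.1, a3.2, a4.1, a4.2, a5.1, a5.2, m1.1,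
      m1.2, m2.1, m2.2, m3.1, m3.2, m4.1, m4.2]

/-- With mesh q², the first level costs q (q²)^{-α} = (q²)^{1/2 - α}. The second costs q²
(q²)^{-2α}, which is the square of the same quantity, and one of its two factors is absorbed by q² ≤
T. The inequality q² ≤ T requires N > 0; when N = 0 the time interval is a point. -/
theorem GridClose.dist_le (h : GridClose u v r q N) :
    dist (naturalLift α u) (naturalLift α v)
      ≤ (8 * d + 33 * (d * d) * (T : ℝ) ^ (1 / 2 - (α : ℝ))) * (r ^ 2 * (q ^ 2) ^ (1 / 2 - (α : ℝ))) := by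
  have hα := α.2.1
  have hα' := α.2.2
  have hq := h.pos
  have hr := h.one_le
  have hq2 : 0 < q ^ 2 := by positivity
  refine RoughPath.dist_le (by positivity) (fun x => ?_) (fun x => ?_)
  · have h0 := simplex_length_nonneg x
    have h1 : ∀ i, |((naturalLift α u).fst x - (naturalLift α v).fst x) i|
        ≤ 8 * r * q * (((x.1.2 : ℝ) - x.1.1) / q ^ 2) ^ (α : ℝ) := by
      intro i
      have := h.fst_le i x.1.1.2.1 x.2 x.1.2.2.2 (β := α) (by linarith) (by linarith)
      simp only [LipschitzPath.coord_coe] at this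
      exact this
    refine (norm_le_card_mul h1).trans ?_
    rw [Fintype.card_fin, Real.div_rpow h0 hq2.le]
    have e1 : q / (q ^ 2) ^ (α : ℝ) = (q ^ 2) ^ (1 / 2 - (α : ℝ)) := by
      rw [Real.rpow_sub hq2, ← Real.sqrt_eq_rpow, Real.sqrt_sq hq.le]
    have e2 : r ≤ r ^ 2 := by nlinarith
    calc (d : ℝ) * (8 * r * q * (((x.1.2 : ℝ) - x.1.1) ^ (α : ℝ) / (q ^ 2) ^ (α : ℝ)))
        = (8 * d) * (r * (q / (q ^ 2) ^ (α : ℝ))) * ((x.1.2 : ℝ) - x.1.1) ^ (α : ℝ) := by ring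
      _ = (8 * d + 0) * (r * (q ^ 2) ^ (1 / 2 - (α : ℝ))) * ((x.1.2 : ℝ) - x.1.1) ^ (α : ℝ) := by
        rw [e1, add_zero]
      _ ≤ _ := by gcongr; positivity
  · have h0 := simplex_length_nonneg x
    have h1 : ∀ ij, |((naturalLift α u).snd x - (naturalLift α v).snd x) ij|
        ≤ 33 * r ^ 2 * q ^ 2 * (((x.1.2 : ℝ) - x.1.1) / q ^ 2) ^ (2 * (α : ℝ)) := fun ij =>
      h.snd_le ij.1 ij.2 x.1.1.2.1 x.2 x.1.2.2.2 (by linarith) (by linarith)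
    refine (norm_le_card_mul h1).trans ?_
    rw [Fintype.card_prod, Fintype.card_fin, Real.div_rpow h0 hq2.le]
    rcases Nat.eq_zero_or_pos N with hN | hN
    · have hT : (T : ℝ) = 0 := by rw [← h.length, hN]; simp
      have e : (x.1.2 : ℝ) - x.1.1 = 0 := by
        have h1 := x.1.2.2.2
        have h2 := x.1.1.2.1
        linarith
      rw [e, Real.zero_rpow (by linarith)]
      simp
    have hqT : q ^ 2 ≤ T := by
      rw [← h.length]
      exact le_mul_of_one_le_left hq2.le (by exact_mod_cast hN)
    have e1 : q ^ 2 / (q ^ 2) ^ (2 * (α : ℝ)) ≤ (T : ℝ) ^ (1 / 2 - (α : ℝ))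
        * (q ^ 2) ^ (1 / 2 - (α : ℝ)) := by
      calc q ^ 2 / (q ^ 2) ^ (2 * (α : ℝ)) = (q ^ 2) ^ ((1 / 2 - (α : ℝ)) + (1 / 2 - (α : ℝ))) := by
            rw [show (1 / 2 - (α : ℝ)) + (1 / 2 - (α : ℝ)) = 1 - 2 * α by ring, Real.rpow_sub hq2,
              Real.rpow_one]
        _ = (q ^ 2) ^ (1 / 2 - (α : ℝ)) * (q ^ 2) ^ (1 / 2 - (α : ℝ)) := Real.rpow_add hq2 _ _
        _ ≤ _ := by
          gcongr
    push_cast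
    calc (d * d : ℝ) * (33 * r ^ 2 * q ^ 2 * (((x.1.2 : ℝ) - x.1.1) ^ (2 * (α : ℝ))
          / (q ^ 2) ^ (2 * (α : ℝ))))
        = 33 * (d * d) * (r ^ 2 * (q ^ 2 / (q ^ 2) ^ (2 * (α : ℝ))))
          * ((x.1.2 : ℝ) - x.1.1) ^ (2 * (α : ℝ)) := by ring
      _ ≤ 33 * (d * d) * (r ^ 2 * ((T : ℝ) ^ (1 / 2 - (α : ℝ)) * (q ^ 2) ^ (1 / 2 - (α : ℝ))))
          * ((x.1.2 : ℝ) - x.1.1) ^ (2 * (α : ℝ)) := by gcongr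
      _ = (0 + 33 * (d * d) * (T : ℝ) ^ (1 / 2 - (α : ℝ))) * (r ^ 2 * (q ^ 2) ^ (1 / 2 - (α : ℝ)))
          * ((x.1.2 : ℝ) - x.1.1) ^ (2 * (α : ℝ)) := by ring
      _ ≤ _ := by gcongr; positivity

/-- Consecutive dyadic approximations are close if the increments of the path and the sums of the
area increments over the grid are small. -/
theorem gridClose_dyadicApprox (hT : 0 < T) (w : PathSpace T d) (n : ℕ) {r : ℝ} (hr : 1 ≤ r)
    (h1 : ∀ i, ∀ k l, k ≤ l → l ≤ 2 ^ n →
      |w.extend (gridPoint T n l) i - w.extend (gridPoint T n k) i|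
        ≤ r * √((T : ℝ) / 2 ^ n) * √((l : ℝ) - k))
    (h2 : ∀ i, ∀ k < 2 ^ (n + 1), |gridIncr w (n + 1) k i| ≤ r * √((T : ℝ) / 2 ^ n))
    (h3 : ∀ i j, ∀ k l, k ≤ l → l ≤ 2 ^ n →
      |∑ m ∈ Finset.Ico k l, areaIncr w n m i j| ≤ r * ((T : ℝ) / 2 ^ n) * √((l : ℝ) - k)) :
    GridClose (w.dyadicApprox (n + 1)) (w.dyadicApprox n) r √((T : ℝ) / 2 ^ n) (2 ^ n) := by
  have hT' : (0 : ℝ) < T := hT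
  have hq2 : √((T : ℝ) / 2 ^ n) ^ 2 = T / 2 ^ n := Real.sq_sqrt (by positivity)
  have hq : 0 < √((T : ℝ) / 2 ^ n) := Real.sqrt_pos.2 (by positivity)
  have hg : ∀ k : ℕ, (k : ℝ) * ((T : ℝ) / 2 ^ n) = gridPoint T n k := fun k => by
    rw [gridPoint, mul_div_assoc]
  -- With q the square root of the mesh, the level n + 1 path has increments at most rq over cells
  -- of length q²/2, hence slope at most 2r/q. The coarse path has slope at most r/q.
  have hK : 2 * r / √((T : ℝ) / 2 ^ n) = 2 * (r * √((T : ℝ) / 2 ^ n)) * (2 ^ n / T) := by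
    have : √((T : ℝ) / 2 ^ n) * √((T : ℝ) / 2 ^ n) * (2 ^ n / T) = 1 := by
      rw [← sq, hq2]; field_simp
    rw [div_eq_iff hq.ne']
    linear_combination (-2 * r) * this
  set q := √((T : ℝ) / 2 ^ n) with hqdef
  let K : ℝ≥0 := ⟨2 * r / q, by positivity⟩
  have hcoe : (K : ℝ) = 2 * r / q := rfl
  have hlu : ∀ i, LipschitzWith K ((w.dyadicApprox (n + 1)).coord i) := by
    intro i
    have := lipschitzWith_dyadicApprox_coord w (n + 1) i (L := ⟨r * q, by positivity⟩) (h2 i)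
    refine this.weaken (le_of_eq (NNReal.coe_injective ?_))
    rw [hcoe, hK, pow_succ]
    change r * q * (2 ^ n * 2 / (T : ℝ)) = _
    ring
  have hlv : ∀ i, LipschitzWith K ((w.dyadicApprox n).coord i) := by
    intro i
    have := lipschitzWith_dyadicApprox_coord w n i (L := ⟨r * q, by positivity⟩) fun j hj => by
      have := h1 i j (j + 1) (Nat.le_succ j) hj
      rw [Nat.cast_succ, add_sub_cancel_left, Real.sqrt_one, mul_one] at this
      exact this
    refine this.weaken (NNReal.coe_le_coe.1 ?_)
    rw [hcoe, hK]
    change r * q * (2 ^ n / (T : ℝ)) ≤ _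
    have : 0 ≤ r * q * (2 ^ n / (T : ℝ)) := by positivity
    linarith
  have hlip : ∀ u : LipschitzPath T d, (∀ i, LipschitzWith K (u.coord i)) → ∀ i s t, s ≤ t →
      |u.coord i t - u.coord i s| ≤ 2 * r / q * (t - s) := by
    intro u hu i s t hst
    have := (hu i).dist_le_mul t s
    rwa [Real.dist_eq, Real.dist_eq, abs_of_nonneg (sub_nonneg.2 hst)] at this
  have harea : ∀ u : LipschitzPath T d, (∀ i, LipschitzWith K (u.coord i)) → ∀ i j s t, s ≤ t →
      |u.area i j s t| ≤ (2 * r / q) ^ 2 * (t - s) ^ 2 := by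
    intro u hu i j s t hst
    have := abs_iteratedIntegral_le (hu i) (hu j) hst
    rw [hcoe, ← sq] at this
    exact this
  refine ⟨hr, hq, ?_, hlip _ hlu, hlip _ hlv, harea _ hlu, harea _ hlv, ?_, ?_, ?_⟩
  · rw [hq2]; push_cast; field_simp
  · intro i k hk
    rw [hq2, hg, dyadicApprox_coord_gridPoint hT w n i hk, ← gridPoint_succ_level,
      dyadicApprox_coord_gridPoint hT w (n + 1) i (by rw [pow_succ]; omega)]
  · intro i k l hkl hl
    rw [hq2, hg, hg, dyadicApprox_coord_gridPoint hT w n i hl,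
      dyadicApprox_coord_gridPoint hT w n i (hkl.trans hl)]
    exact h1 i k l hkl hl
  · intro i j k l hkl hl
    rw [hq2, hg, hg, dyadicApprox_area_sub hT w n i j hkl hl]
    exact h3 i j k l hkl hl

/-- Grid estimates with constants of polynomial growth in the level imply that the dyadic lifts
converge. -/
theorem cauchySeq_dyadicLift (hT : 0 < T) (w : PathSpace T d) {c : ℝ} (hc : 1 ≤ c)
    (h1 : ∀ᶠ n : ℕ in atTop, ∀ i, ∀ k l, k ≤ l → l ≤ 2 ^ n →
      |w.extend (gridPoint T n l) i - w.extend (gridPoint T n k) i|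
        ≤ c * (n + 1) * √((T : ℝ) / 2 ^ n) * √((l : ℝ) - k))
    (h3 : ∀ᶠ n : ℕ in atTop, ∀ i j, ∀ k l, k ≤ l → l ≤ 2 ^ n →
      |∑ m ∈ Finset.Ico k l, areaIncr w n m i j|
        ≤ c * (n + 1) * ((T : ℝ) / 2 ^ n) * √((l : ℝ) - k)) :
    CauchySeq fun n => dyadicLift α n w := by
  have hα' := α.2.2
  have hT' : (0 : ℝ) < T := hT
  refine cauchySeq_of_summable_dist ?_
  set γ : ℝ := 1 / 2 - (α : ℝ) with hγ
  have hγ0 : 0 < γ := by linarith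
  set C : ℝ := 8 * d + 33 * (d * d) * (T : ℝ) ^ γ with hC
  set θ : ℝ := (1 / 2 : ℝ) ^ γ with hθ
  have hθ0 : 0 ≤ θ := by positivity
  have hθ1 : θ < 1 := Real.rpow_lt_one (by norm_num) (by norm_num) hγ0
  -- The distance of consecutive lifts is of order r² (T/2^n)^γ with r linear in n, and a polynomial
  -- times a geometric sequence is summable. This is where α < 1/2 is used.
  have hsum : Summable fun n : ℕ => C * (4 * c ^ 2 * (T : ℝ) ^ γ) * (((n : ℝ) + 1) ^ 2 * θ ^ n) := by
    refine Summable.mul_left _ ?_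
    have e : ∀ k : ℕ, Summable fun n : ℕ => (n : ℝ) ^ k * θ ^ n := fun k =>
      summable_pow_mul_geometric_of_norm_lt_one k (by rwa [Real.norm_of_nonneg hθ0])
    refine (((e 2).add ((e 1).mul_left 2)).add (e 0)).congr fun n => ?_
    ring
  refine Summable.of_norm_bounded_eventually_nat hsum ?_
  filter_upwards [h1, h3, (tendsto_add_atTop_nat 1).eventually h1] with n e1 e3 e2
  rw [Real.norm_of_nonneg dist_nonneg, dist_comm]
  have hn : (0 : ℝ) ≤ n := n.cast_nonneg
  have hr : c * (n + 1) ≤ 2 * c * (n + 1) := by nlinarith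
  have hr1 : 1 ≤ 2 * c * ((n : ℝ) + 1) := by nlinarith
  -- The factor 2 in r = 2c(n + 1) absorbs the constant c(n + 2) with which the increments of level
  -- n + 1 are bounded.
  have hclose := gridClose_dyadicApprox hT w n (r := 2 * c * (n + 1)) hr1
    (fun i k l hkl hl => (e1 i k l hkl hl).trans (by gcongr))
    (fun i k hk => by
      have := e2 i k (k + 1) (Nat.le_succ k) hk
      push_cast at this
      rw [add_sub_cancel_left, Real.sqrt_one, mul_one] at this
      refine this.trans ?_
      have e4 : c * ((n : ℝ) + 1 + 1) ≤ 2 * c * (n + 1) := by nlinarith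
      have e5 : (T : ℝ) / 2 ^ (n + 1) ≤ T / 2 ^ n := by
        rw [pow_succ]
        gcongr
        linarith [pow_pos (zero_lt_two' ℝ) n]
      exact mul_le_mul e4 (Real.sqrt_le_sqrt e5) (Real.sqrt_nonneg _) (by positivity))
    (fun i j k l hkl hl => (e3 i j k l hkl hl).trans (by gcongr))
  refine (hclose.dist_le (α := α)).trans (le_of_eq ?_)
  rw [Real.sq_sqrt (by positivity), Real.div_rpow hT'.le (by positivity), hθ,
    Real.div_rpow zero_le_one zero_le_two, Real.one_rpow, div_pow, one_pow,
    ← Real.rpow_natCast ((2 : ℝ) ^ _), ← Real.rpow_mul zero_le_two, mul_comm _ (n : ℝ),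
    Real.rpow_mul zero_le_two, Real.rpow_natCast]
  ring

end GridDistance

end RoughFoliation

namespace RoughFoliation

/-! ### Exponential moments -/

section ExponentialMoments

open ENNReal (ofReal)

theorem lintegral_exp_gaussianReal (v : ℝ≥0) (c : ℝ) :
    ∫⁻ x, ofReal (Real.exp (c * x)) ∂gaussianReal 0 v = ofReal (Real.exp (v * c ^ 2 / 2)) := by
  rw [← ofReal_integral_eq_lintegral_ofReal (integrable_exp_mul_gaussianReal c)
    (Eventually.of_forall fun x => (Real.exp_pos _).le)]
  have := mgf_gaussianReal (p := gaussianReal 0 v) (X := id) (v := v) (μ := 0) Measure.map_id c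
  simp only [mgf, id, zero_mul, zero_add] at this
  rw [this]

/-- The Gaussian integral equals (1 - z)^{-1/2} with z = 2θv. For 0 ≤ z ≤ 1/2 this is at most e^z,
because 1 ≤ (1 + 2z)(1 - z) ≤ e^{2z}(1 - z). -/
theorem lintegral_exp_sq_gaussianReal {v : ℝ≥0} (hv : v ≠ 0) {θ : ℝ} (hθ : 0 ≤ θ)
    (hθv : 2 * θ * v ≤ 1 / 2) :
    ∫⁻ x, ofReal (Real.exp (θ * x ^ 2)) ∂gaussianReal 0 v ≤ ofReal (Real.exp (2 * θ * v)) := by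
  have hv' : (0 : ℝ) < v := lt_of_le_of_ne v.coe_nonneg (by exact_mod_cast hv.symm)
  set z := 2 * θ * v with hz
  have hz0 : 0 ≤ z := by positivity
  have hz1 : 0 < 1 - z := by linarith
  set b := (1 - z) / (2 * v) with hb
  have hb0 : 0 < b := by positivity
  rw [gaussianReal_of_var_ne_zero 0 hv, lintegral_withDensity_eq_lintegral_mul _
    (measurable_gaussianPDF 0 v) (by fun_prop)]
  have e1 : ∀ x : ℝ, (gaussianPDF 0 v * fun x => ofReal (Real.exp (θ * x ^ 2))) x
      = ofReal ((√(2 * Real.pi * v))⁻¹ * Real.exp (-b * x ^ 2)) := by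
    intro x
    rw [Pi.mul_apply, gaussianPDF, ← ENNReal.ofReal_mul (gaussianPDFReal_nonneg _ _ _),
      gaussianPDFReal, mul_assoc, ← Real.exp_add]
    congr 3
    rw [hb, hz]
    field_simp
    ring
  simp only [e1]
  rw [← ofReal_integral_eq_lintegral_ofReal ((integrable_exp_neg_mul_sq hb0).const_mul _)
    (Eventually.of_forall fun x => by positivity), integral_const_mul, integral_gaussian]
  refine ENNReal.ofReal_le_ofReal ?_
  have e2 : Real.pi / b = (2 * Real.pi * v) * (1 - z)⁻¹ := by rw [hb]; field_simp
  have hp : 0 < 2 * Real.pi * (v : ℝ) := by positivity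
  rw [e2, Real.sqrt_mul hp.le, inv_mul_cancel_left₀ (Real.sqrt_pos.2 hp).ne']
  refine Real.sqrt_le_iff.2 ⟨(Real.exp_pos _).le, ?_⟩
  rw [← Real.exp_nat_mul, inv_le_iff_one_le_mul₀ hz1]
  have h3 := Real.add_one_le_exp (((2 : ℕ) : ℝ) * z)
  push_cast at h3 ⊢
  calc (1 : ℝ) ≤ (2 * z + 1) * (1 - z) := by nlinarith
    _ ≤ _ := by gcongr

variable {Ω : Type*} [MeasurableSpace Ω] {μ : Measure Ω} [IsProbabilityMeasure μ]

/-- The exponential moment of a product of independent Gaussian variables. -/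
theorem lintegral_exp_mul_gaussian_le {v : ℝ≥0} (hv : v ≠ 0) {X Y : Ω → ℝ} (hX : Measurable X)
    (hY : Measurable Y) (hXY : IndepFun X Y μ) (hXl : μ.map X = gaussianReal 0 v)
    (hYl : μ.map Y = gaussianReal 0 v) {c : ℝ} (hc : (c * v) ^ 2 ≤ 1 / 2) :
    ∫⁻ ω, ofReal (Real.exp (c * (X ω * Y ω))) ∂μ ≤ ofReal (Real.exp ((c * v) ^ 2)) := by
  have hmap := (indepFun_iff_map_prod_eq_prod_map_map hX.aemeasurable hY.aemeasurable).1 hXY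
  have hF : Measurable fun q : ℝ × ℝ => ofReal (Real.exp (c * (q.1 * q.2))) := by fun_prop
  have e1 : ∫⁻ ω, ofReal (Real.exp (c * (X ω * Y ω))) ∂μ
      = ∫⁻ q, ofReal (Real.exp (c * (q.1 * q.2))) ∂(μ.map fun ω => (X ω, Y ω)) := by
    rw [lintegral_map hF (hX.prodMk hY)]
  rw [e1, hmap, hXl, hYl, lintegral_prod _ hF.aemeasurable]
  -- Integrating out the second variable first leaves the exponential of a multiple of the square of
  -- the first.
  have e2 : ∀ x : ℝ, ∫⁻ y, ofReal (Real.exp (c * (x * y))) ∂gaussianReal 0 v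
      = ofReal (Real.exp ((v * c ^ 2 / 2) * x ^ 2)) := by
    intro x
    simp only [← mul_assoc]
    rw [lintegral_exp_gaussianReal]
    congr 2
    ring
  simp only [e2]
  have e3 : 2 * (v * c ^ 2 / 2) * (v : ℝ) = (c * v) ^ 2 := by ring
  rw [← e3] at hc ⊢
  exact lintegral_exp_sq_gaussianReal hv (by positivity) hc

omit [IsProbabilityMeasure μ] in
/-- Markov's inequality for exponential moments. -/
theorem measure_abs_gt_le {X : Ω → ℝ} (hX : Measurable X) {K : ℝ} (r : ℝ)
    (h1 : ∫⁻ ω, ofReal (Real.exp (X ω)) ∂μ ≤ ofReal K)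
    (h2 : ∫⁻ ω, ofReal (Real.exp (-X ω)) ∂μ ≤ ofReal K) :
    μ {ω | r < |X ω|} ≤ 2 * ofReal (K * Real.exp (-r)) := by
  have key : ∀ Y : Ω → ℝ, Measurable Y → ∫⁻ ω, ofReal (Real.exp (Y ω)) ∂μ ≤ ofReal K →
      μ {ω | ofReal (Real.exp r) ≤ ofReal (Real.exp (Y ω))} ≤ ofReal (K * Real.exp (-r)) := by
    intro Y hY h
    refine (meas_ge_le_lintegral_div (by fun_prop) (by simp [Real.exp_pos]) (by simp)).trans ?_
    rw [Real.exp_neg, ← div_eq_mul_inv, ENNReal.ofReal_div_of_pos (Real.exp_pos r)]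
    gcongr
  have hsub : {ω | r < |X ω|} ⊆ {ω | ofReal (Real.exp r) ≤ ofReal (Real.exp (X ω))}
      ∪ {ω | ofReal (Real.exp r) ≤ ofReal (Real.exp (-X ω))} := by
    intro ω hω
    rcases lt_abs.1 (show r < |X ω| from hω) with h | h
    · exact Or.inl (ENNReal.ofReal_le_ofReal (Real.exp_le_exp.2 h.le))
    · exact Or.inr (ENNReal.ofReal_le_ofReal (Real.exp_le_exp.2 h.le))
  refine (measure_mono hsub).trans ((measure_union_le _ _).trans ?_)
  rw [two_mul]
  exact add_le_add (key _ hX h1) (key _ hX.neg h2)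

omit [IsProbabilityMeasure μ] in
/-- A Borel–Cantelli bound for families indexed by pairs of points of the dyadic grids. -/
theorem ae_eventually_abs_le {X : ℕ → ℕ → ℕ → Ω → ℝ} (hX : ∀ n k l, Measurable (X n k l)) {K : ℝ}
    (h1 : ∀ n k l, k < l → l ≤ 2 ^ n → ∫⁻ ω, ofReal (Real.exp (X n k l ω)) ∂μ ≤ ofReal K)
    (h2 : ∀ n k l, k < l → l ≤ 2 ^ n → ∫⁻ ω, ofReal (Real.exp (-X n k l ω)) ∂μ ≤ ofReal K) :
    ∀ᵐ ω ∂μ, ∀ᶠ n : ℕ in atTop, ∀ k l, k < l → l ≤ 2 ^ n → |X n k l ω| ≤ 3 * (n + 1) := by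
  let s : ℕ → Finset (ℕ × ℕ) := fun n =>
    ((Finset.range (2 ^ n + 1)) ×ˢ (Finset.range (2 ^ n + 1))).filter fun q => q.1 < q.2
  let A : ℕ → Set Ω := fun n => ⋃ q ∈ s n, {ω | 3 * ((n : ℝ) + 1) < |X n q.1 q.2 ω|}
  have hK : 0 ≤ |K| := abs_nonneg K
  -- The threshold 3(n + 1) gives tails of order 8^{-(n + 1)}, which beat the at most 4^{n + 1}
  -- pairs of grid points and leave the summable bound 2^{-(n + 1)}.
  have hexp : ∀ n : ℕ, Real.exp (-(3 * ((n : ℝ) + 1))) ≤ (1 / 8 : ℝ) ^ (n + 1) := by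
    intro n
    have e1 : (2 : ℝ) ≤ Real.exp 1 := by
      have := Real.add_one_le_exp (1 : ℝ); linarith
    have e2 : Real.exp (-3) ≤ 1 / 8 := by
      have e3 : Real.exp 3 = Real.exp 1 ^ 3 := by rw [← Real.exp_nat_mul]; norm_num
      rw [Real.exp_neg, e3, one_div]
      refine inv_anti₀ (by norm_num) ?_
      calc (8 : ℝ) = 2 ^ 3 := by norm_num
        _ ≤ _ := by gcongr
    have e4 : Real.exp (-(3 * ((n : ℝ) + 1))) = Real.exp (-3) ^ (n + 1) := by
      rw [← Real.exp_nat_mul]; congr 1; push_cast; ring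
    rw [e4]
    gcongr
  have hA : ∀ n, μ (A n) ≤ ofReal (2 * |K| * (1 / 2 : ℝ) ^ (n + 1)) := by
    intro n
    have e0 : ∀ q ∈ s n, μ {ω | 3 * ((n : ℝ) + 1) < |X n q.1 q.2 ω|}
        ≤ ofReal (2 * (|K| * (1 / 8 : ℝ) ^ (n + 1))) := by
      intro q hq
      simp only [s, Finset.mem_filter, Finset.mem_product, Finset.mem_range] at hq
      refine (measure_abs_gt_le (hX n q.1 q.2) _ (h1 n _ _ hq.2 (by omega))
        (h2 n _ _ hq.2 (by omega))).trans ?_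
      rw [ENNReal.ofReal_mul zero_le_two, ENNReal.ofReal_ofNat]
      gcongr
      · exact le_abs_self K
      · exact hexp n
    have hcard : ((s n).card : ℝ) ≤ 4 ^ (n + 1) := by
      have e1 : (s n).card ≤ (2 ^ n + 1) * (2 ^ n + 1) := by
        refine (Finset.card_filter_le _ _).trans ?_
        rw [Finset.card_product, Finset.card_range]
      have e2 : (2 ^ n + 1) * (2 ^ n + 1) ≤ 4 ^ (n + 1) := by
        have e3 : 2 ^ n + 1 ≤ 2 ^ (n + 1) := by
          rw [pow_succ]
          have : 0 < 2 ^ n := by positivity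
          omega
        calc _ ≤ 2 ^ (n + 1) * 2 ^ (n + 1) := Nat.mul_le_mul e3 e3
          _ = 4 ^ (n + 1) := by rw [← mul_pow]; norm_num
      exact_mod_cast e1.trans e2
    calc μ (A n) ≤ ∑ q ∈ s n, μ {ω | 3 * ((n : ℝ) + 1) < |X n q.1 q.2 ω|} :=
          measure_biUnion_finset_le _ _
      _ ≤ ∑ _q ∈ s n, ofReal (2 * (|K| * (1 / 8 : ℝ) ^ (n + 1))) := Finset.sum_le_sum e0
      _ = ofReal ((s n).card * (2 * (|K| * (1 / 8 : ℝ) ^ (n + 1)))) := by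
        rw [Finset.sum_const, nsmul_eq_mul, ENNReal.ofReal_mul (Nat.cast_nonneg _),
          ENNReal.ofReal_natCast]
      _ ≤ ofReal (4 ^ (n + 1) * (2 * (|K| * (1 / 8 : ℝ) ^ (n + 1)))) := by gcongr
      _ = _ := by
        congr 1
        have : (4 : ℝ) ^ (n + 1) * (1 / 8) ^ (n + 1) = (1 / 2) ^ (n + 1) := by
          rw [← mul_pow]; norm_num
        rw [← this]
        ring
  have hsum : ∑' n, μ (A n) ≠ ⊤ := by
    have hs : Summable fun n : ℕ => 2 * |K| * (1 / 2 : ℝ) ^ (n + 1) :=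
      ((summable_nat_add_iff 1).2 summable_geometric_two).mul_left _
    refine ne_top_of_le_ne_top ?_ (ENNReal.tsum_le_tsum hA)
    rw [← ENNReal.ofReal_tsum_of_nonneg (fun n => by positivity) hs]
    exact ENNReal.ofReal_ne_top
  filter_upwards [ae_eventually_notMem hsum] with ω hω
  filter_upwards [hω] with n hn k l hkl hl
  by_contra hlt
  refine hn (Set.mem_iUnion₂.2 ⟨(k, l), ?_, not_le.1 hlt⟩)
  simp only [s, Finset.mem_filter, Finset.mem_product, Finset.mem_range]
  omega

end ExponentialMoments

/-! ### Wiener measure -/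

section Wiener

open ENNReal (ofReal)

variable {α : HolderExponent} {T : ℝ≥0} {d : ℕ} {μ : Measure (PathSpace T d)}

theorem continuous_extend (t : ℝ) : Continuous fun w : PathSpace T d => w.extend t :=
  (continuous_eval_const (F := C(TimeInterval T, EuclideanSpace ℝ (Fin d)))
    (Set.projIcc (0 : ℝ) T T.coe_nonneg t)).comp continuous_induced_dom

theorem measurable_extend (t : ℝ) : Measurable fun w : PathSpace T d => w.extend t :=
  (continuous_extend t).measurable

theorem measurable_gridIncr (n k : ℕ) (i : Fin d) :
    Measurable fun w : PathSpace T d => gridIncr w n k i := by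
  have h : ∀ t, Measurable fun w : PathSpace T d => w.extend t i := fun t =>
    (EuclideanSpace.proj i : EuclideanSpace ℝ (Fin d) →L[ℝ] ℝ).measurable.comp (measurable_extend t)
  exact (h _).sub (h _)

theorem measurable_areaIncr (n k : ℕ) (i j : Fin d) :
    Measurable fun w : PathSpace T d => areaIncr w n k i j := by
  unfold areaIncr
  have := fun m (i : Fin d) => measurable_gridIncr (T := T) (n + 1) m i
  exact (((this _ _).mul (this _ _)).sub ((this _ _).mul (this _ _))).div_const 2

/-- The law of the coordinates of an increment. -/
theorem map_extend_sub (hμ : IsWienerMeasure μ) {s t : ℝ} (hs : 0 ≤ s) (hst : s ≤ t) (ht : t ≤ T)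
    (i : Fin d) :
    μ.map (fun w => w.extend t i - w.extend s i) = gaussianReal 0 (t - s).toNNReal := by
  have h := hμ.hasLaw ⟨s, hs, hst.trans ht⟩ ⟨t, hs.trans hst, ht⟩ hst
  have hS : ((t - s) • (1 : Matrix (Fin d) (Fin d) ℝ)).PosSemidef :=
    Matrix.PosSemidef.one.smul (sub_nonneg.2 hst)
  have h2 := measurePreserving_eval_multivariateGaussian (μ := (0 : EuclideanSpace ℝ (Fin d))) hS
    (i := i)
  have h3 := (h2.hasLaw.comp h).map_eq
  simp only [PiLp.zero_apply, Matrix.smul_apply, Matrix.one_apply_eq, smul_eq_mul, mul_one] at h3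
  rw [← h3]
  congr 1
  funext w
  simp [PathSpace.extend, Set.projIcc_of_mem T.coe_nonneg (show s ∈ Set.Icc (0 : ℝ) T from ⟨hs, hst.trans ht⟩),
    Set.projIcc_of_mem T.coe_nonneg (show t ∈ Set.Icc (0 : ℝ) T from ⟨hs.trans hst, ht⟩)]

/-- Grid points beyond T are projected to T, so the family can be indexed by all of ℕ, its further
members being zero. -/
theorem iIndepFun_gridIncr (hμ : IsWienerMeasure μ) (n : ℕ) :
    iIndepFun (fun k (w : PathSpace T d) =>
      w.extend (gridPoint T n (k + 1)) - w.extend (gridPoint T n k)) μ :=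
  hμ.hasIndepIncrements.nat (t := fun k => Set.projIcc (0 : ℝ) T T.coe_nonneg (gridPoint T n k))
    ((Set.monotone_projIcc T.coe_nonneg).comp (gridPoint_mono n))

theorem gridPoint_sub (n k l : ℕ) :
    gridPoint T n l - gridPoint T n k = ((l : ℝ) - k) * (T / 2 ^ n) := by
  unfold gridPoint; ring

theorem lintegral_exp_mul_gridIncr_le (hT : 0 < T) (hμ : IsWienerMeasure μ) (n k : ℕ)
    (hk : k + 1 < 2 ^ n) (i j : Fin d) {c : ℝ} (hc : (c * (T / 2 ^ n)) ^ 2 ≤ 1 / 2) :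
    ∫⁻ w, ofReal (Real.exp (c * (gridIncr w n k i * gridIncr w n (k + 1) j))) ∂μ
      ≤ ofReal (Real.exp ((c * (T / 2 ^ n)) ^ 2)) := by
  have := hμ.isProbabilityMeasure
  have hind := (iIndepFun_gridIncr hμ n).indepFun (Nat.succ_ne_self k).symm
  have hp : ∀ i : Fin d, Measurable fun x : EuclideanSpace ℝ (Fin d) => x i := fun i =>
    (EuclideanSpace.proj i : EuclideanSpace ℝ (Fin d) →L[ℝ] ℝ).measurable
  have hind' := hind.comp (hp i) (hp j)
  have hv : (T / 2 ^ n : ℝ≥0) ≠ 0 := by positivity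
  have hlaw : ∀ k < 2 ^ n, ∀ i : Fin d, μ.map (fun w => gridIncr w n k i)
      = gaussianReal 0 (T / 2 ^ n : ℝ≥0) := by
    intro k hk i
    have := map_extend_sub hμ (gridPoint_nonneg n k) (gridPoint_mono n (Nat.le_succ k))
      (gridPoint_le hk) i
    rw [gridPoint_sub] at this
    convert! this using 2
    rw [Nat.cast_succ, add_sub_cancel_left, one_mul]
    refine NNReal.coe_injective ?_
    rw [Real.coe_toNNReal _ (by positivity)]
    push_cast
    rfl
  have h := lintegral_exp_mul_gaussian_le hv (measurable_gridIncr n k i)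
    (measurable_gridIncr n (k + 1) j) hind' (hlaw k (by omega) i) (hlaw (k + 1) hk j) (c := c)
  push_cast at h
  exact h hc

/-- The two products in the area increment are not independent of each other, but the increment is
half their difference. Convexity, e^{(a + b)/2} ≤ (e^a + e^b)/2, reduces the claim to each product
separately, which is a product of independent Gaussians. -/
theorem lintegral_exp_areaIncr_le (hT : 0 < T) (hμ : IsWienerMeasure μ) (n k : ℕ)
    (hk : k < 2 ^ n) (i j : Fin d) {c : ℝ} (hc : (c * (T / 2 ^ (n + 1))) ^ 2 ≤ 1 / 2) :
    ∫⁻ w, ofReal (Real.exp (c * areaIncr w n k i j)) ∂μ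
      ≤ ofReal (Real.exp ((c * (T / 2 ^ (n + 1))) ^ 2)) := by
  have hk' : 2 * k + 1 < 2 ^ (n + 1) := by rw [pow_succ]; omega
  have h1 := lintegral_exp_mul_gridIncr_le hT hμ (n + 1) (2 * k) hk' i j hc
  have h2 := lintegral_exp_mul_gridIncr_le hT hμ (n + 1) (2 * k) hk' j i (c := -c)
    (by rwa [neg_mul, neg_sq])
  rw [neg_mul, neg_sq] at h2
  have hm1 : Measurable fun w : PathSpace T d => ofReal (Real.exp (c *
      (gridIncr w (n + 1) (2 * k) i * gridIncr w (n + 1) (2 * k + 1) j))) :=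
    (Real.measurable_exp.comp (((measurable_gridIncr _ _ _).mul
      (measurable_gridIncr _ _ _)).const_mul c)).ennreal_ofReal
  have hpt : ∀ w : PathSpace T d, ofReal (Real.exp (c * areaIncr w n k i j))
      ≤ 2⁻¹ * (ofReal (Real.exp (c * (gridIncr w (n + 1) (2 * k) i
          * gridIncr w (n + 1) (2 * k + 1) j)))
        + ofReal (Real.exp (-c * (gridIncr w (n + 1) (2 * k) j
          * gridIncr w (n + 1) (2 * k + 1) i)))) := by
    intro w
    set a := c * (gridIncr w (n + 1) (2 * k) i * gridIncr w (n + 1) (2 * k + 1) j) with ha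
    set b := -c * (gridIncr w (n + 1) (2 * k) j * gridIncr w (n + 1) (2 * k + 1) i) with hb
    have e1 : c * areaIncr w n k i j = a / 2 + b / 2 := by
      rw [ha, hb, areaIncr]; ring
    have e2 : (2⁻¹ : ENNReal) = ofReal (1 / 2) := by
      rw [one_div, ENNReal.ofReal_inv_of_pos two_pos, ENNReal.ofReal_ofNat]
    rw [e1, e2, ← ENNReal.ofReal_add (Real.exp_pos _).le (Real.exp_pos _).le,
      ← ENNReal.ofReal_mul (by norm_num), Real.exp_add]
    refine ENNReal.ofReal_le_ofReal ?_
    have e3 : Real.exp a = Real.exp (a / 2) ^ 2 := by rw [← Real.exp_nat_mul]; congr 1; push_cast; ring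
    have e4 : Real.exp b = Real.exp (b / 2) ^ 2 := by rw [← Real.exp_nat_mul]; congr 1; push_cast; ring
    rw [e3, e4]
    nlinarith [sq_nonneg (Real.exp (a / 2) - Real.exp (b / 2))]
  refine (lintegral_mono hpt).trans ?_
  rw [lintegral_const_mul' _ _ (by simp), lintegral_add_left hm1]
  calc _ ≤ 2⁻¹ * (ofReal (Real.exp ((c * (T / 2 ^ (n + 1))) ^ 2))
        + ofReal (Real.exp ((c * (T / 2 ^ (n + 1))) ^ 2))) := by gcongr
    _ = _ := by
      rw [← two_mul, ← mul_assoc, ENNReal.inv_mul_cancel (by simp) (by simp), one_mul]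

/-- Functions of disjoint pairs of independent variables are independent. -/
theorem indepFun_sum_pairs {Ω E : Type*} [MeasurableSpace Ω] [MeasurableSpace E] [Zero E]
    {P : Measure Ω} {Y : ℕ → Ω → E} (hY : iIndepFun Y P) (hYm : ∀ m, Measurable (Y m))
    {G : E × E → ℝ} (hG : Measurable G) (k l : ℕ) :
    IndepFun (fun ω => ∑ m ∈ Finset.Ico k l, G (Y (2 * m) ω, Y (2 * m + 1) ω))
      (fun ω => G (Y (2 * l) ω, Y (2 * l + 1) ω)) P := by
  have hdisj : Disjoint (Finset.range (2 * l)) (Finset.Ico (2 * l) (2 * l + 2)) := by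
    rw [Finset.disjoint_left]
    intro a ha hb
    rw [Finset.mem_range] at ha
    rw [Finset.mem_Ico] at hb
    omega
  have h := hY.indepFun_finset _ _ hdisj hYm
  generalize hS : Finset.range (2 * l) = S at h
  generalize hU : Finset.Ico (2 * l) (2 * l + 2) = U at h
  -- Reads one coordinate of a finite family. The default 0 off S makes it a total measurable
  -- function and is never used at the indices that occur.
  let ev : (S : Finset ℕ) → ℕ → (S → E) → E := fun S r y => if h : r ∈ S then y ⟨r, h⟩ else 0
  have hev : ∀ S r, Measurable (ev S r) := by
    intro S r
    by_cases hr : r ∈ S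
    · simp only [ev, hr, dite_true]; exact measurable_pi_apply _
    · simp only [ev, hr, dite_false]; exact measurable_const
  have hev' : ∀ (S : Finset ℕ) (r : ℕ), r ∈ S → ∀ ω, ev S r (fun i : S => Y i ω) = Y r ω :=
    fun S r hr ω => dif_pos hr
  have h' := h.comp (φ := fun y => ∑ m ∈ Finset.Ico k l, G (ev S (2 * m) y, ev S (2 * m + 1) y))
    (ψ := fun y => G (ev U (2 * l) y, ev U (2 * l + 1) y))
    (Finset.measurable_sum _ fun m _ => hG.comp ((hev _ _).prodMk (hev _ _)))
    (hG.comp ((hev _ _).prodMk (hev _ _)))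
  refine h'.congr (Eventually.of_forall fun ω => ?_) (Eventually.of_forall fun ω => ?_)
  · refine Finset.sum_congr rfl fun m hm => ?_
    rw [Finset.mem_Ico] at hm
    rw [hev' S (2 * m) (hS ▸ Finset.mem_range.2 (by omega)),
      hev' S (2 * m + 1) (hS ▸ Finset.mem_range.2 (by omega))]
  · exact congrArg G (Prod.ext (hev' U (2 * l) (hU ▸ Finset.mem_Ico.2 (by omega)) ω)
      (hev' U (2 * l + 1) (hU ▸ Finset.mem_Ico.2 (by omega)) ω))

/-- The area increments of a level are independent of each other. -/
theorem indepFun_sum_areaIncr (hμ : IsWienerMeasure μ) (n k l : ℕ) (i j : Fin d) :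
    IndepFun (fun w => ∑ m ∈ Finset.Ico k l, areaIncr w n m i j)
      (fun w : PathSpace T d => areaIncr w n l i j) μ := by
  have hp : ∀ i : Fin d, Measurable fun x : EuclideanSpace ℝ (Fin d) => x i := fun i =>
    (EuclideanSpace.proj i : EuclideanSpace ℝ (Fin d) →L[ℝ] ℝ).measurable
  exact indepFun_sum_pairs (iIndepFun_gridIncr hμ (n + 1))
    (fun m => (measurable_extend _).sub (measurable_extend _))
    (G := fun q => (q.1 i * q.2 j - q.2 i * q.1 j) / 2)
    (((((hp i).comp measurable_fst).mul ((hp j).comp measurable_snd)).sub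
      (((hp i).comp measurable_snd).mul ((hp j).comp measurable_fst))).div_const 2) k l

/-- By independence the exponential moments multiply, so the exponent is linear in the number of
cells and quadratic in c. This is what lets the sum of l - k terms grow only like √(l - k). -/
theorem lintegral_exp_sum_areaIncr_le (hT : 0 < T) (hμ : IsWienerMeasure μ) (n : ℕ) {k l : ℕ}
    (hkl : k ≤ l) (hl : l ≤ 2 ^ n) (i j : Fin d) {c : ℝ}
    (hc : (c * (T / 2 ^ (n + 1))) ^ 2 ≤ 1 / 2) :
    ∫⁻ w, ofReal (Real.exp (c * ∑ m ∈ Finset.Ico k l, areaIncr w n m i j)) ∂μ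
      ≤ ofReal (Real.exp (((l : ℝ) - k) * (c * (T / 2 ^ (n + 1))) ^ 2)) := by
  have := hμ.isProbabilityMeasure
  induction l, hkl using Nat.le_induction with
  | base => simp
  | succ l hkl ih =>
    have hE : Measurable fun x : ℝ => ofReal (Real.exp (c * x)) := by fun_prop
    have hind := (indepFun_sum_areaIncr hμ n k l i j).comp hE hE
    have hm1 : Measurable fun w : PathSpace T d => ∑ m ∈ Finset.Ico k l, areaIncr w n m i j :=
      Finset.measurable_sum _ fun m _ => measurable_areaIncr n m i j
    have hprod := lintegral_mul_eq_lintegral_mul_lintegral_of_indepFun (hE.comp hm1)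
      (hE.comp (measurable_areaIncr n l i j)) hind
    have e1 : ∀ w : PathSpace T d,
        ofReal (Real.exp (c * ∑ m ∈ Finset.Ico k (l + 1), areaIncr w n m i j))
        = ((fun x : ℝ => ofReal (Real.exp (c * x))) ∘
            (fun w : PathSpace T d => ∑ m ∈ Finset.Ico k l, areaIncr w n m i j)
          * (fun x : ℝ => ofReal (Real.exp (c * x))) ∘
            (fun w : PathSpace T d => areaIncr w n l i j)) w := by
      intro w
      simp only [Pi.mul_apply, Function.comp_apply]
      rw [Finset.sum_Ico_succ_top hkl, mul_add, Real.exp_add,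
        ENNReal.ofReal_mul (Real.exp_pos _).le]
    simp only [e1]
    rw [hprod]
    refine (mul_le_mul' (ih (by omega)) (lintegral_exp_areaIncr_le hT hμ n l hl i j hc)).trans ?_
    rw [← ENNReal.ofReal_mul (Real.exp_pos _).le, ← Real.exp_add]
    refine ENNReal.ofReal_le_ofReal (Real.exp_le_exp.2 (le_of_eq ?_))
    push_cast
    ring

theorem lintegral_exp_extend_sub (hμ : IsWienerMeasure μ) {s t : ℝ} (hs : 0 ≤ s)
    (hst : s ≤ t) (ht : t ≤ T) (i : Fin d) (c : ℝ) :
    ∫⁻ w, ofReal (Real.exp (c * (w.extend t i - w.extend s i))) ∂μ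
      = ofReal (Real.exp ((t - s) * c ^ 2 / 2)) := by
  have h := lintegral_exp_gaussianReal (t - s).toNNReal c
  have hm : ∀ t, Measurable fun w : PathSpace T d => w.extend t i := fun t =>
    (EuclideanSpace.proj i : EuclideanSpace ℝ (Fin d) →L[ℝ] ℝ).measurable.comp (measurable_extend t)
  have hm' : Measurable fun w : PathSpace T d => w.extend t i - w.extend s i := (hm t).sub (hm s)
  rw [← map_extend_sub hμ hs hst ht i, lintegral_map (by fun_prop) hm',
    Real.coe_toNNReal _ (sub_nonneg.2 hst)] at h
  exact h

/-- Divided by its standard deviation √(T/2^n) √(l - k), an increment is standard Gaussian, with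
exponential moment e^{1/2} for both signs ε = ±1. Borel–Cantelli over all pairs of grid points does
the rest. -/
theorem ae_eventually_extend_sub_le (hT : 0 < T) (hμ : IsWienerMeasure μ) (i : Fin d) :
    ∀ᵐ w ∂μ, ∀ᶠ n : ℕ in atTop, ∀ k l : ℕ, k ≤ l → l ≤ 2 ^ n →
      |w.extend (gridPoint T n l) i - w.extend (gridPoint T n k) i|
        ≤ 3 * (n + 1) * √((T : ℝ) / 2 ^ n) * √((l : ℝ) - k) := by
  have := hμ.isProbabilityMeasure
  have hT' : (0 : ℝ) < T := hT
  have hm : ∀ t, Measurable fun w : PathSpace T d => w.extend t i := fun t =>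
    (EuclideanSpace.proj i : EuclideanSpace ℝ (Fin d) →L[ℝ] ℝ).measurable.comp (measurable_extend t)
  have hq : ∀ n : ℕ, 0 < √((T : ℝ) / 2 ^ n) := fun n => Real.sqrt_pos.2 (by positivity)
  let c : ℕ → ℕ → ℕ → ℝ := fun n k l => (√((T : ℝ) / 2 ^ n) * √((l : ℝ) - k))⁻¹
  have key : ∀ n k l, k < l → l ≤ 2 ^ n → ∀ ε : ℝ, ε ^ 2 = 1 →
      ∫⁻ w, ofReal (Real.exp ((ε * c n k l) *
        (w.extend (gridPoint T n l) i - w.extend (gridPoint T n k) i))) ∂μ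
      ≤ ofReal (Real.exp (1 / 2)) := by
    intro n k l hkl hl ε hε
    rw [lintegral_exp_extend_sub hμ (gridPoint_nonneg n k) (gridPoint_mono n hkl.le)
      (gridPoint_le hl) i]
    refine ENNReal.ofReal_le_ofReal (Real.exp_le_exp.2 (le_of_eq ?_))
    have hkl' : (0 : ℝ) < (l : ℝ) - k := sub_pos.2 (by exact_mod_cast hkl)
    rw [gridPoint_sub, mul_pow, hε, inv_pow, mul_pow, Real.sq_sqrt (by positivity),
      Real.sq_sqrt hkl'.le]
    field_simp
  have h := ae_eventually_abs_le (μ := μ) (K := Real.exp (1 / 2))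
    (X := fun n k l w => c n k l *
      (w.extend (gridPoint T n l) i - w.extend (gridPoint T n k) i))
    (fun n k l => ((hm _).sub (hm _)).const_mul _)
    (fun n k l hkl hl => by simpa using key n k l hkl hl 1 (by norm_num))
    (fun n k l hkl hl => by simpa using key n k l hkl hl (-1) (by norm_num))
  filter_upwards [h] with w hw
  filter_upwards [hw] with n hn k l hkl hl
  rcases hkl.eq_or_lt with rfl | hlt
  · simp
  have hkl' : (0 : ℝ) < (l : ℝ) - k := sub_pos.2 (by exact_mod_cast hlt)
  have hpos : 0 < √((T : ℝ) / 2 ^ n) * √((l : ℝ) - k) := mul_pos (hq n) (Real.sqrt_pos.2 hkl')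
  have := hn k l hlt hl
  rw [abs_mul, abs_of_pos (inv_pos.2 hpos), inv_mul_le_iff₀ hpos] at this
  linarith

/-- The natural scale of a sum of l - k area increments is (T/2^n) √(l - k). With this normalisation
the exponent per summand is 1/(4(l - k)), so the exponential moment of the whole sum is at most
e^{1/4}, uniformly in n, k and l. -/
theorem ae_eventually_sum_areaIncr_le (hT : 0 < T) (hμ : IsWienerMeasure μ) (i j : Fin d) :
    ∀ᵐ w ∂μ, ∀ᶠ n : ℕ in atTop, ∀ k l, k ≤ l → l ≤ 2 ^ n →
      |∑ m ∈ Finset.Ico k l, areaIncr w n m i j|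
        ≤ 3 * (n + 1) * ((T : ℝ) / 2 ^ n) * √((l : ℝ) - k) := by
  have := hμ.isProbabilityMeasure
  have hT' : (0 : ℝ) < T := hT
  let c : ℕ → ℕ → ℕ → ℝ := fun n k l => ((T : ℝ) / 2 ^ n * √((l : ℝ) - k))⁻¹
  have key : ∀ n k l, k < l → l ≤ 2 ^ n → ∀ ε : ℝ, ε ^ 2 = 1 →
      ∫⁻ w, ofReal (Real.exp ((ε * c n k l) * ∑ m ∈ Finset.Ico k l, areaIncr w n m i j)) ∂μ
      ≤ ofReal (Real.exp (1 / 4)) := by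
    intro n k l hkl hl ε hε
    have hkl' : (1 : ℝ) ≤ (l : ℝ) - k := by
      have : (k : ℝ) + 1 ≤ l := by exact_mod_cast hkl
      linarith
    have e1 : (ε * c n k l * ((T : ℝ) / 2 ^ (n + 1))) ^ 2 = 1 / (4 * ((l : ℝ) - k)) := by
      rw [mul_pow, mul_pow, hε, inv_pow, mul_pow, Real.sq_sqrt (by linarith), pow_succ (2 : ℝ) n]
      field_simp
      norm_num
    have e2 : (ε * c n k l * ((T : ℝ) / 2 ^ (n + 1))) ^ 2 ≤ 1 / 2 := by
      rw [e1]
      exact one_div_le_one_div_of_le two_pos (by linarith)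
    refine (lintegral_exp_sum_areaIncr_le hT hμ n hkl.le hl i j e2).trans
      (ENNReal.ofReal_le_ofReal (Real.exp_le_exp.2 (le_of_eq ?_)))
    rw [e1]
    field_simp
  have h := ae_eventually_abs_le (μ := μ) (K := Real.exp (1 / 4))
    (X := fun n k l w => c n k l * ∑ m ∈ Finset.Ico k l, areaIncr w n m i j)
    (fun n k l => (Finset.measurable_sum _ fun m _ => measurable_areaIncr n m i j).const_mul _)
    (fun n k l hkl hl => by simpa using key n k l hkl hl 1 (by norm_num))
    (fun n k l hkl hl => by simpa using key n k l hkl hl (-1) (by norm_num))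
  filter_upwards [h] with w hw
  filter_upwards [hw] with n hn k l hkl hl
  rcases hkl.eq_or_lt with rfl | hlt
  · simp
  have hkl' : (0 : ℝ) < (l : ℝ) - k := sub_pos.2 (by exact_mod_cast hlt)
  have hpos : 0 < (T : ℝ) / 2 ^ n * √((l : ℝ) - k) := by positivity
  have := hn k l hlt hl
  rw [abs_mul, abs_of_pos (inv_pos.2 hpos), inv_mul_le_iff₀ hpos] at this
  linarith

/-- Almost every Brownian path has a Brownian rough path above it. -/
theorem measure_exceptionalSet (hT : 0 < T) (hμ : IsWienerMeasure μ) :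
    μ (exceptionalSet α T d) = 0 := by
  have h1 := ae_all_iff.2 fun i => ae_eventually_extend_sub_le hT hμ i
  have h2 := ae_all_iff.2 fun i => ae_all_iff.2 fun j => ae_eventually_sum_areaIncr_le hT hμ i j
  have h : ∀ᵐ w ∂μ, CauchySeq fun n => dyadicLift α n w := by
    filter_upwards [h1, h2] with w e1 e2
    refine cauchySeq_dyadicLift hT w (c := 3) (by norm_num) (eventually_all.2 e1) ?_
    exact eventually_all.2 fun i => eventually_all.2 fun j => e2 i j
  exact ae_iff.1 h

end Wiener

end RoughFoliation

namespace RoughFoliation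

/-! ### Measurability of the Lyons–Itô map along Brownian rough path -/

section Measurability

variable {p d : ℕ} {M Z : Type*} [TopologicalSpace M] [TopologicalSpace Z] {A : FoliatedAtlas p M Z}
  {α : HolderExponent} {T : ℝ≥0} {V : Fin (d + 1) → A.LeafwiseVectorField 3}
  {μ : Measure (PathSpace T d)}

/-- Completeness turns the Cauchy property into existence of a limit, so the prescribed value `W₀ w`
plays no role here. -/
theorem tendsto_brownianRoughPath (W₀ : PathSpace T d → GeometricRoughPath α T d)
    {w : PathSpace T d} (hw : w ∉ exceptionalSet α T d) :
    Tendsto (fun n => dyadicLift α n w) atTop (𝓝 (brownianRoughPath α W₀ w)) := by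
  have hc : CauchySeq fun n => dyadicLift α n w := not_not.1 hw
  have h := cauchySeq_tendsto_of_complete hc
  rw [brownianRoughPath, dif_pos h]
  exact h.choose_spec

/-- The topology on leaf paths is induced from all continuous paths, and forming the Borel σ-field
commutes with pulling back. No measurability of the set of leaf paths is needed. -/
theorem measurable_leafPath_iff {Ω : Type*} [MeasurableSpace Ω] {g : Ω → LeafPath A T} :
    Measurable g ↔ Measurable[_, borel C(TimeInterval T, M)] fun ω => (g ω).path := by
  have h : borel (LeafPath A T)
      = (borel C(TimeInterval T, M)).comap LeafPath.path := borel_comap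
  change Measurable[_, borel (LeafPath A T)] g ↔ _
  rw [h, measurable_comap_iff]
  rfl

variable [CompactSpace M] [TopologicalSpace.MetrizableSpace M] [LocallyCompactSpace Z] [T2Space Z]

/-- An almost everywhere limit, in a metrizable path space, of maps that are continuous in w. The
values of `W₀` matter only on a null set. -/
theorem nullMeasurable_lyonsIto_brownianRoughPath [MeasurableSpace C(TimeInterval T, M)]
    [BorelSpace C(TimeInterval T, M)] (hnull : μ (exceptionalSet α T d) = 0)
    (W₀ : PathSpace T d → GeometricRoughPath α T d) (m : M) :
    NullMeasurable (fun w => lyonsIto V m (brownianRoughPath α W₀ w)) μ := by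
  have hcont : ∀ n, Continuous fun w : PathSpace T d => lyonsIto V m (dyadicLift α n w) := fun n =>
    continuous_iff_continuousAt.2 fun w =>
      tendsto_lyonsIto ((continuous_dyadicLift n).tendsto w) tendsto_const_nhds
  refine (aemeasurable_of_tendsto_metrizable_ae atTop
    (fun n => (hcont n).measurable.aemeasurable) ?_).nullMeasurable
  have : ∀ᵐ w ∂μ, w ∉ exceptionalSet α T d := measure_eq_zero_iff_ae_notMem.1 hnull
  filter_upwards [this] with w hw
  exact tendsto_lyonsIto (tendsto_brownianRoughPath W₀ hw) tendsto_const_nhds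

/-- Carathéodory's criterion: the map is continuous in m for every w, because the Lyons–Itô map is
continuous at each fixed rough path, including the arbitrary ones, and it is measurable in w for the
completed σ-field. Compact metrizable M is second countable. -/
theorem measurable_lyonsIto_brownianRoughPath [MeasurableSpace M] [BorelSpace M]
    [MeasurableSpace C(TimeInterval T, M)]
    [BorelSpace C(TimeInterval T, M)] (hnull : μ (exceptionalSet α T d) = 0)
    (W₀ : PathSpace T d → GeometricRoughPath α T d) :
    Measurable (fun q => lyonsIto V q.1 (brownianRoughPath α W₀ q.2) :
      M × NullMeasurableSpace (PathSpace T d) μ → C(TimeInterval T, M)) := by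
  let : MetricSpace M := TopologicalSpace.metrizableSpaceMetric M
  have : SecondCountableTopology M := inferInstance
  exact measurable_uncurry_of_continuous_of_measurable
    (u := fun (m : M) (w : NullMeasurableSpace (PathSpace T d) μ) =>
      lyonsIto V m (brownianRoughPath α W₀ w))
    (fun w => continuous_iff_continuousAt.2 fun m =>
      tendsto_lyonsIto tendsto_const_nhds tendsto_id)
    (nullMeasurable_lyonsIto_brownianRoughPath hnull W₀)

end Measurability

end RoughFoliation

theorem mainTheorem9 {p d : ℕ} {M Z : Type*}
    [TopologicalSpace M] [CompactSpace M] [TopologicalSpace.MetrizableSpace M]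
    [MeasurableSpace M] [BorelSpace M]
    [TopologicalSpace Z] [LocallyCompactSpace Z] [TopologicalSpace.SeparableSpace Z]
    [TopologicalSpace.MetrizableSpace Z]
    (A : FoliatedAtlas p M Z) (V : Fin (d + 1) → A.LeafwiseVectorField 3)
    (α : HolderExponent) (T : ℝ≥0) (hT : 0 < T)
    (μ : Measure (PathSpace T d)) (hμ : IsWienerMeasure μ) :
    -- the Lyons–Itô map is well defined: the RDE has exactly one solution
    (∀ (m : M) (w : GeometricRoughPath α T d) (x : C(TimeInterval T, M)),
      IsRDESolution V w m x ↔ x = lyonsIto V m w) ∧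
    -- Brownian rough path is well defined off a null set
    μ (exceptionalSet α T d) = 0 ∧
    ∀ W₀ : PathSpace T d → GeometricRoughPath α T d,
      (∀ w ∉ exceptionalSet α T d,
        Tendsto (fun n => dyadicLift α n w) atTop (𝓝 (brownianRoughPath α W₀ w))) ∧
      -- the solutions stay in one leaf and depend measurably on `(m, w)`
      ∃ hL : ∀ (m : M) (w : GeometricRoughPath α T d),
          ∃ m' : M, ∀ t, lyonsIto V m w t ∈ A.leaf m',
        Measurable (fun q => ⟨lyonsIto V q.1 (brownianRoughPath α W₀ q.2), hL q.1 _⟩ :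
          M × NullMeasurableSpace (PathSpace T d) μ → LeafPath A T) := by
  refine ⟨fun m w x => RoughFoliation.isRDESolution_iff_eq w m x,
    RoughFoliation.measure_exceptionalSet hT hμ, fun W₀ =>
    ⟨fun w hw => RoughFoliation.tendsto_brownianRoughPath W₀ hw,
      fun m w => ⟨m, (RoughFoliation.isRDESolution_lyonsIto w m).2⟩, ?_⟩⟩
  rw [RoughFoliation.measurable_leafPath_iff]
  borelize C(TimeInterval T, M)
  exact RoughFoliation.measurable_lyonsIto_brownianRoughPath
    (RoughFoliation.measure_exceptionalSet hT hμ) W₀
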